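/- Let $(\overline M,\langle\cdot,\cdot\rangle,\varphi)$ be a smooth seven-dimensional Riemannian manifold with a $G_2$-structure: $\varphi$ is a smooth three-form which at each point can be written $\varphi=\sum_{i\in\mathbb Z_7}e_i\wedge e_{i+1}\wedge e_{i+3}$ in some orthonormal basis $e_0,\dots,e_6$ (a Cayley basis). Let $*$ be the Hodge star for $Vol=e_0\wedge\dots\wedge e_6$, let $P$ be the vector cross product $\langle P(x,y),z\rangle=\varphi(x,y,z)$, let $\overline\nabla$ be the Levi-Civita connection, and let $p_\varphi$ be the vector field with $\langle p_\varphi,\cdot\rangle=pd^*\varphi:=*(*d\varphi\wedge\varphi)$. Suppose that the $G_2$-structure is of type $\mathcal X_4$, i.e. $\overline\nabla\varphi\in T^*\overline M\otimes\{v\lrcorner *\varphi\}$ and $\overline r(\varphi)(x,y)=\frac14\langle\overline\nabla_x\varphi,\,y\lrcorner *\varphi\rangle$ is a section of $\mathfrak g_2^\perp\subseteq\Lambda^2T^*\overline M$. Let $\iota:M\to\overline M$ be a smooth (immersed) hypersurface with smooth unit normal vector field $n$, let $II$ be its shape tensor, $B=\langle II,n\rangle$, $H=\frac16\mathrm{Tr}\,II$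 and $h=\langle H,n\rangle$. Given a smooth function $\theta$ on $M$, equip $M$ with the induced metric and the $SU(3)$-structure given by $Ix=P(n,x)$, $\omega(x,y)=\langle x,Iy\rangle$ and $$\Psi=\psi_++i\psi_-=\cos\theta\,\iota^*\varphi-\sin\theta\,\iota^*(n\lrcorner *\varphi)+i\left(\sin\theta\,\iota^*\varphi+\cos\theta\,\iota^*(n\lrcorner *\varphi)\right).$$ For a covariant $s$-tensor $b$ put $Ib(x_1,\dots,x_s)=(-1)^sb(Ix_1,\dots,Ix_s)$. Let $\nabla$ be the Levi-Civita connection of $M$, and let $\eta+\xi\in T^*M\otimes\mathfrak{su}(3)^\perp=T^*M\otimes(\mathbb R\oplus\mathfrak u(3)^\perp)$ be the intrinsic torsion, for which $\nabla+\eta+\xi$ makes $\omega,\psi_+,\psi_-$ parallel. Let $\mathcal W_1,\dots,\mathcal W_4$ be the Gray–Hervella modules, in which $\nabla\omega=-\xi\omega$ is decomposed; for $i=1,2$, let $\mathcal W_i^{+}$ ($\mathcal W_i^-$) be the set of the $a\in\mathcal W_i$ for which $r(a)(x,y)=\frac12\langle x\lrcorner a,\,y\lrcorner\psi_+\rangle$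 is symmetric (skew-symmetric); let $\mathcal W_5=T^*M\otimes\mathbb R$ be the module of $\eta$. The structure is of type a sum of some of these modules if at every point its torsion lies in this sum. Suppose moreover that $p_\varphi$ is tangent to $M$ at all points of $M$. Then the $SU(3)$-structure on $M$ is of type 1. $\mathcal W_1^++\mathcal W_1^-+\mathcal W_2^++\mathcal W_2^-+\mathcal W_3+\mathcal W_4$ if and only if $\iota^*pd^*\varphi=12\,I\,d\theta$; 2. $\mathcal W_1^++\mathcal W_1^-+\mathcal W_2^++\mathcal W_2^-+\mathcal W_4+\mathcal W_5$ if and only if $IB=B$; 3. $\mathcal W_1^++\mathcal W_1^-+\mathcal W_2^++\mathcal W_3+\mathcal W_4+\mathcal W_5$ if and only if $2h\sin\theta\,\langle\cdot,\cdot\rangle=\sin\theta\,(1+I)B$; 4. $\mathcal W_1^++\mathcal W_1^-+\mathcal W_2^-+\mathcal W_3+\mathcal W_4+\mathcal W_5$ if and only if $2h\cos\theta\,\langle\cdot,\cdot\rangle=\cos\theta\,(1+I)B$; 5. $\mathcal W_1^++\mathcal W_2^++\mathcal W_2^-+\mathcal W_3+\mathcal W_4+\mathcal W_5$ if and only if $h\sin\theta=0$;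 6. $\mathcal W_1^-+\mathcal W_2^++\mathcal W_2^-+\mathcal W_3+\mathcal W_4+\mathcal W_5$ if and only if $h\cos\theta=0$; 7. $\mathcal W_1^++\mathcal W_1^-+\mathcal W_3+\mathcal W_4+\mathcal W_5$ if and only if $(1+I)B=2h\,\langle\cdot,\cdot\rangle$; 8. $\mathcal W_2^++\mathcal W_2^-+\mathcal W_3+\mathcal W_4+\mathcal W_5$ if and only if $M$ is minimal ($H=0$); 9. $\mathcal W_1^++\mathcal W_1^-+\mathcal W_4+\mathcal W_5$ if and only if $M$ is totally umbilic ($II=\langle\cdot,\cdot\rangle H$); 10. $\mathcal W_4+\mathcal W_5$ if and only if $M$ is totally geodesic ($II=0$). -/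

import Mathlib

open scoped Manifold ContDiff

noncomputable section

/-! ## Multilinear algebra on a Euclidean vector space `(V, G)`

A covariant `k`-tensor is represented by its evaluation function `(Fin k → V) → ℝ`, and a metric by
its evaluation function `G : V → V → ℝ`. -/

section LinearAlgebra

/-- Covariant `k`-tensors on `V`, as functions of `k` vectors. -/
abbrev CovTensor (k : ℕ) (V : Type*) : Type _ := (Fin k → V) → ℝ

variable {V : Type*} [AddCommGroup V] [Module ℝ V]

/-- `e` is an orthonormal system of `n` vectors (used with `n = dim V`, so `e` is a basis). -/
def IsOrthoFrame {n : ℕ} (G : V → V → ℝ) (e : Fin n → V) : Prop :=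
  ∀ i j, G (e i) (e j) = if i = j then 1 else 0

/-- A chosen orthonormal basis. It is only used in expressions (metric contractions) which do not
depend on the choice. -/
def orthoFrame (n : ℕ) (G : V → V → ℝ) : Fin n → V :=
  Classical.epsilon fun e : Fin n → V => IsOrthoFrame G e

/-- The vector `z` with `⟨z, ·⟩ = f`, for a linear form `f`. -/
def sharp (n : ℕ) (G : V → V → ℝ) (f : V → ℝ) : V :=
  ∑ i, f (orthoFrame n G i) • orthoFrame n G i

/-- The scalar product `(1 / p!) ∑ α(e_{i₁}, …, e_{i_p}) β(e_{i₁}, …, e_{i_p})` of `p`-forms. -/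
def formInner (n p : ℕ) (G : V → V → ℝ) (α β : CovTensor p V) : ℝ :=
  (1 / (p.factorial : ℝ)) *
    ∑ s : Fin p → Fin n, α (fun i => orthoFrame n G (s i)) * β (fun i => orthoFrame n G (s i))

/-- The interior product `x ⌟ α`. -/
def contractVec {k : ℕ} (x : V) (α : CovTensor (k + 1) V) : CovTensor k V :=
  fun v => α (Fin.cons x v)

/-- The wedge product of a `p`-form and a `q`-form, normalised by
`(e₁ ∧ ⋯ ∧ e_k)(e₁, …, e_k) = 1`. -/
def wedge {p q : ℕ} (α : CovTensor p V) (β : CovTensor q V) : CovTensor (p + q) V :=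
  fun v => (1 / ((p.factorial : ℝ) * (q.factorial : ℝ))) *
    ∑ σ : Equiv.Perm (Fin (p + q)), ((Equiv.Perm.sign σ : ℤ) : ℝ) *
      (α (fun i => v (σ (Fin.castAdd q i))) * β (fun j => v (σ (Fin.natAdd p j))))

/-- The Hodge star on `p`-forms for the orientation given by the orthonormal basis `e`, i.e.
`(*α)(v) = (1 / p!) ∑ α(e_{i₁}, …, e_{i_p}) Vol(e_{i₁}, …, e_{i_p}, v)` with
`Vol = e₁ ∧ ⋯ ∧ e_{p + q}`; it satisfies `α ∧ *α = ⟨α, α⟩ Vol`. -/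
def hodgeStar (p q : ℕ) (G : V → V → ℝ) (e : Fin (p + q) → V) (α : CovTensor p V) :
    CovTensor q V :=
  fun v => (1 / (p.factorial : ℝ)) * ∑ s : Fin p → Fin (p + q), α (fun i => e (s i)) *
    Matrix.det (Matrix.of fun i j : Fin (p + q) => G (e i) (Fin.append (fun k => e (s k)) v j))

/-- The derivation action of an endomorphism on tensors:
`(A · b)(v₁, …, v_k) = - ∑ b(v₁, …, A v_i, …, v_k)`. -/
def derivAction {k : ℕ} (A : V →ₗ[ℝ] V) (b : CovTensor k V) : CovTensor k V :=
  fun v => - ∑ i, b (Function.update v i (A (v i)))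

/-! ### The algebra of `G₂` -/

/-- `e` is a Cayley basis: it is orthonormal and
`φ = ∑_{i ∈ ℤ/7} e_i ∧ e_{i+1} ∧ e_{i+3}` (indices in `Fin 7` are added modulo `7`). -/
def IsCayleyFrame (G : V → V → ℝ) (φ : CovTensor 3 V) (e : Fin 7 → V) : Prop :=
  IsOrthoFrame G e ∧
    ∀ v : Fin 3 → V, φ v = ∑ i : Fin 7,
      Matrix.det (Matrix.of fun a b : Fin 3 => G (e (i + (![0, 1, 3] : Fin 3 → Fin 7) a)) (v b))

/-- A chosen Cayley basis. Two of them differ by an element of `G₂ ⊆ SO(7)`, and it is only used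
in expressions which do not depend on the choice. -/
def cayleyFrame (G : V → V → ℝ) (φ : CovTensor 3 V) : Fin 7 → V :=
  Classical.epsilon fun e : Fin 7 → V => IsCayleyFrame G φ e

/-- The Hodge star operator of a `G₂`-structure, `Vol = e₀ ∧ ⋯ ∧ e₆` in a Cayley basis. -/
def g2Star (p q : ℕ) (h : p + q = 7) (G : V → V → ℝ) (φ : CovTensor 3 V) (α : CovTensor p V) :
    CovTensor q V :=
  hodgeStar p q G (fun i => cayleyFrame G φ (Fin.cast h i)) α

/-- The four-form `*φ`. -/
def starPhi (G : V → V → ℝ) (φ : CovTensor 3 V) : CovTensor 4 V := g2Star 3 4 rfl G φ φ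

/-- The two-fold vector cross product: `⟨P(x, y), z⟩ = φ(x, y, z)`. -/
def vecCross (G : V → V → ℝ) (φ : CovTensor 3 V) (x y : V) : V :=
  sharp 7 G fun z => φ ![x, y, z]

/-- The bilinear form `r̄(α)(x, y) = (1/4) ⟨x ⌟ α, y ⌟ *φ⟩` of a tensor `α ∈ T* ⊗ Λ³ T*`. -/
def rBar (G : V → V → ℝ) (φ : CovTensor 3 V) (α : V → CovTensor 3 V) (x y : V) : ℝ :=
  (1 / 4) * formInner 7 3 G (α x) (contractVec y (starPhi G φ))

/-- The Lie algebra `𝔤₂`, as the space of those two-forms `b` with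
`∑_{j, k : φ(e_i, e_j, e_k) = 1} b(e_j, e_k) = 0` for all `i`. -/
def InG2Algebra (G : V → V → ℝ) (φ : CovTensor 3 V) (b : V →ₗ[ℝ] V →ₗ[ℝ] ℝ) : Prop :=
  (∀ x y, b x y = - b y x) ∧
  ∀ i : Fin 7, (∑ j : Fin 7, ∑ k : Fin 7,
    (open scoped Classical in
      if φ ![cayleyFrame G φ i, cayleyFrame G φ j, cayleyFrame G φ k] = 1 then
        b (cayleyFrame G φ j) (cayleyFrame G φ k) else 0)) = 0

/-- The orthogonal complement of `𝔤₂` in `Λ² T*`. -/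
def InG2Perp (G : V → V → ℝ) (φ : CovTensor 3 V) (c : V →ₗ[ℝ] V →ₗ[ℝ] ℝ) : Prop :=
  (∀ x y, c x y = - c y x) ∧
  ∀ b : V →ₗ[ℝ] V →ₗ[ℝ] ℝ, InG2Algebra G φ b →
    formInner 7 2 G (fun v => c (v 0) (v 1)) (fun v => b (v 0) (v 1)) = 0

/-- The space `𝒳` of covariant derivatives of `φ`: `T* ⊗ {v ⌟ *φ}`. -/
def InX (G : V → V → ℝ) (φ : CovTensor 3 V) (α : V → CovTensor 3 V) : Prop :=
  ∃ A : V →ₗ[ℝ] V, ∀ x, α x = contractVec (A x) (starPhi G φ)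

/-- The component `𝒳₄` of `𝒳`: it corresponds to `𝔤₂^⊥ ⊆ Λ² T*` under the isomorphism `r̄` of `𝒳`
onto the space of bilinear forms. -/
def InX4 (G : V → V → ℝ) (φ : CovTensor 3 V) (α : V → CovTensor 3 V) : Prop :=
  InX G φ α ∧ ∃ c : V →ₗ[ℝ] V →ₗ[ℝ] ℝ, InG2Perp G φ c ∧ ∀ x y, rBar G φ α x y = c x y

/-! ### The algebra of `SU(3)` -/

/-- The irreducible pieces of the space of intrinsic `SU(3)`-torsions:
`𝒲₁⁺, 𝒲₁⁻, 𝒲₂⁺, 𝒲₂⁻, 𝒲₃, 𝒲₄, 𝒲₅`. -/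
inductive SU3Component
  | w1p | w1m | w2p | w2m | w3 | w4 | w5

/-- The Kähler form `ω(x, y) = ⟨x, I y⟩`. -/
def kahlerForm (G : V → V → ℝ) (I : V → V) : CovTensor 2 V := fun v => G (v 0) (I (v 1))

/-- `T* ⊗ 𝔲(3)^⊥`, the space of covariant derivatives of the Kähler form. -/
def InW (I : V → V) (α : V →ₗ[ℝ] V →ₗ[ℝ] V →ₗ[ℝ] ℝ) : Prop :=
  ∀ x y z, α x y z = - α x z y ∧ α x y z = - α x (I y) (I z)

/-- The contraction `∑ α(e_i, e_i, z)`. -/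
def contract12 (G : V → V → ℝ) (α : V →ₗ[ℝ] V →ₗ[ℝ] V →ₗ[ℝ] ℝ) (z : V) : ℝ :=
  ∑ i, α (orthoFrame 6 G i) (orthoFrame 6 G i) z

/-- The Gray-Hervella space `𝒲₁`. -/
def InW1 (I : V → V) (α : V →ₗ[ℝ] V →ₗ[ℝ] V →ₗ[ℝ] ℝ) : Prop :=
  InW I α ∧ ∀ x z, α x x z = 0

/-- The Gray-Hervella space `𝒲₂`. -/
def InW2 (I : V → V) (α : V →ₗ[ℝ] V →ₗ[ℝ] V →ₗ[ℝ] ℝ) : Prop :=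
  InW I α ∧ ∀ x y z, α x y z + α y z x + α z x y = 0

/-- The Gray-Hervella space `𝒲₃`. -/
def InW3 (G : V → V → ℝ) (I : V → V) (α : V →ₗ[ℝ] V →ₗ[ℝ] V →ₗ[ℝ] ℝ) : Prop :=
  InW I α ∧ (∀ x y z, α x y z = α (I x) (I y) z) ∧ ∀ z, contract12 G α z = 0

/-- The Gray-Hervella space `𝒲₄` in real dimension six. -/
def InW4 (G : V → V → ℝ) (I : V → V) (α : V →ₗ[ℝ] V →ₗ[ℝ] V →ₗ[ℝ] ℝ) : Prop :=
  InW I α ∧ ∀ x y z, α x y z = (1 / 4) *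
    (G x y * contract12 G α z - G x z * contract12 G α y
      - G x (I y) * contract12 G α (I z) + G x (I z) * contract12 G α (I y))

/-- The bilinear form `r(α)(x, y) = (1/2) ⟨x ⌟ α, y ⌟ ψ₊⟩`. -/
def rForm (G : V → V → ℝ) (ψp : CovTensor 3 V) (α : V →ₗ[ℝ] V →ₗ[ℝ] V →ₗ[ℝ] ℝ) (x y : V) : ℝ :=
  (1 / 2) * formInner 6 2 G (fun v => α x (v 0) (v 1)) (contractVec y ψp)

/-- The pieces of `T* ⊗ 𝔲(3)^⊥`; `𝒲_i^±` consists of the `α ∈ 𝒲_i`, `i = 1, 2`, for which `r(α)` is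
symmetric, resp. skew-symmetric. The piece `𝒲₅` lies in `T* ⊗ ℝ`, hence has no part here. -/
def InComponent (G : V → V → ℝ) (I : V → V) (ψp : CovTensor 3 V)
    (α : V →ₗ[ℝ] V →ₗ[ℝ] V →ₗ[ℝ] ℝ) : SU3Component → Prop
  | .w1p => InW1 I α ∧ ∀ x y, rForm G ψp α x y = rForm G ψp α y x
  | .w1m => InW1 I α ∧ ∀ x y, rForm G ψp α x y = - rForm G ψp α y x
  | .w2p => InW2 I α ∧ ∀ x y, rForm G ψp α x y = rForm G ψp α y x
  | .w2m => InW2 I α ∧ ∀ x y, rForm G ψp α x y = - rForm G ψp α y x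
  | .w3 => InW3 G I α
  | .w4 => InW4 G I α
  | .w5 => α = 0

/-- The Lie algebra `𝔰𝔬(V)`. -/
def InSO (G : V → V → ℝ) (A : V →ₗ[ℝ] V) : Prop := ∀ x y, G (A x) y = - G x (A y)

/-- The Lie algebra `𝔲(3)`, the stabilizer of `ω` in `𝔰𝔬(6)`. -/
def InU3 (G : V → V → ℝ) (I : V → V) (A : V →ₗ[ℝ] V) : Prop :=
  InSO G A ∧ derivAction A (kahlerForm G I) = 0

/-- The Lie algebra `𝔰𝔲(3)`, the stabilizer of `ω`, `ψ₊`, `ψ₋` in `𝔰𝔬(6)`. -/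
def InSU3 (G : V → V → ℝ) (I : V → V) (ψp ψm : CovTensor 3 V) (A : V →ₗ[ℝ] V) : Prop :=
  InU3 G I A ∧ derivAction A ψp = 0 ∧ derivAction A ψm = 0

/-- The orthogonal complement of a space `𝔤` of skew-symmetric endomorphisms in `𝔰𝔬(V)`, for the
scalar product `- tr (A ∘ B)`. -/
def InPerp (G : V → V → ℝ) (𝔤 : (V →ₗ[ℝ] V) → Prop) (A : V →ₗ[ℝ] V) : Prop :=
  InSO G A ∧ ∀ B : V →ₗ[ℝ] V, 𝔤 B → LinearMap.trace ℝ V (A ∘ₗ B) = 0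

end LinearAlgebra

/-! ## Riemannian geometry in charts

Tensor fields on an `n`-manifold `N` are fields of evaluation functions. The tangent space at `p` is
identified, as in Mathlib, with the model space through the preferred chart at `p`, whose
derivative at `p` is the identity. -/

section Geometry

variable {n : ℕ} {N : Type*} [TopologicalSpace N] [ChartedSpace (EuclideanSpace ℝ (Fin n)) N]

/-- The coordinate vector field with constant coordinates `w` in the preferred chart at `p`, at the
point with coordinates `u`. -/
def coordField (p : N) (u w : EuclideanSpace ℝ (Fin n)) :
    TangentSpace (𝓡 n) ((extChartAt (𝓡 n) p).symm u) :=
  mfderiv 𝓘(ℝ, EuclideanSpace ℝ (Fin n)) (𝓡 n) (extChartAt (𝓡 n) p).symm u w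

/-- The expression of a tensor field in the preferred chart at `p`: its value on the coordinate
fields with constant coordinates `w`, at the point with coordinates `u`. -/
def chartTensor {k : ℕ} (T : ∀ x : N, CovTensor k (TangentSpace (𝓡 n) x)) (p : N)
    (u : EuclideanSpace ℝ (Fin n)) (w : Fin k → EuclideanSpace ℝ (Fin n)) : ℝ :=
  T ((extChartAt (𝓡 n) p).symm u) (fun i => coordField p u (w i))

/-- Smoothness of a tensor field, in charts. -/
def SmoothTensor {k : ℕ} (T : ∀ x : N, CovTensor k (TangentSpace (𝓡 n) x)) : Prop :=
  ∀ (p : N) (w : Fin k → EuclideanSpace ℝ (Fin n)),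
    ContDiffOn ℝ ∞ (fun u => chartTensor T p u w) (extChartAt (𝓡 n) p).target

/-- The partial derivative at `p`, in the preferred chart at `p`, of the coefficients of a tensor
field: `v (T(w₁, …, w_k))` for fields `w_i` with constant coordinates. -/
def chartDeriv {k : ℕ} (T : ∀ x : N, CovTensor k (TangentSpace (𝓡 n) x)) (p : N)
    (v : TangentSpace (𝓡 n) p) (w : Fin k → TangentSpace (𝓡 n) p) : ℝ :=
  fderiv ℝ (fun u : EuclideanSpace ℝ (Fin n) => chartTensor T p u w) (extChartAt (𝓡 n) p p) v

/-- The exterior derivative of a differential form,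
`dT(w₀, …, w_k) = ∑ (-1)^i w_i (T(w₀, …, ŵ_i, …, w_k))` for coordinate fields. -/
def exteriorDeriv {k : ℕ} (T : ∀ x : N, CovTensor k (TangentSpace (𝓡 n) x)) (p : N) :
    CovTensor (k + 1) (TangentSpace (𝓡 n) p) :=
  fun w => ∑ i : Fin (k + 1), (-1 : ℝ) ^ (i : ℕ) * chartDeriv T p (w i) (i.removeNth w)

/-- The Christoffel symbol `Γ(v, w) = ∇_v w` at `p` of the Levi-Civita connection of `G`, for fields
with constant coordinates in the preferred chart at `p`:
`2 ⟨Γ(v, w), z⟩ = v⟨w, z⟩ + w⟨v, z⟩ - z⟨v, w⟩`. -/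
def christoffel (G : ∀ x : N, TangentSpace (𝓡 n) x → TangentSpace (𝓡 n) x → ℝ) (p : N)
    (v w : TangentSpace (𝓡 n) p) : TangentSpace (𝓡 n) p :=
  sharp n (G p) fun z => (1 / 2) *
    (chartDeriv (fun x (a : Fin 2 → TangentSpace (𝓡 n) x) => G x (a 0) (a 1)) p v ![w, z]
      + chartDeriv (fun x (a : Fin 2 → TangentSpace (𝓡 n) x) => G x (a 0) (a 1)) p w ![v, z]
      - chartDeriv (fun x (a : Fin 2 → TangentSpace (𝓡 n) x) => G x (a 0) (a 1)) p z ![v, w])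

/-- The Levi-Civita covariant derivative `∇_v T` of a covariant tensor field:
`(∇_v T)(w₁, …, w_k) = v (T(w₁, …, w_k)) - ∑ T(w₁, …, ∇_v w_i, …, w_k)`. -/
def covDeriv {k : ℕ} (G : ∀ x : N, TangentSpace (𝓡 n) x → TangentSpace (𝓡 n) x → ℝ)
    (T : ∀ x : N, CovTensor k (TangentSpace (𝓡 n) x)) (p : N) (v : TangentSpace (𝓡 n) p) :
    CovTensor k (TangentSpace (𝓡 n) p) :=
  fun w => chartDeriv T p v w - ∑ i, T p (Function.update w i (christoffel G p v (w i)))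

/-- The differential `df` of a real function, as a one-form. -/
def differential (f : N → ℝ) (p : N) (v : TangentSpace (𝓡 n) p) : ℝ :=
  mfderiv (𝓡 n) 𝓘(ℝ, ℝ) f p v

/-- The Levi-Civita covariant derivative `∇_v Z` of a vector field `Z` along a map `f : M → N`, for
`v ∈ T_m M`: the derivative of the coordinates of `Z` plus `Γ(f_* v, Z)`. -/
def covDerivAlong {k : ℕ} {M : Type*} [TopologicalSpace M]
    [ChartedSpace (EuclideanSpace ℝ (Fin k)) M]
    (G : ∀ x : N, TangentSpace (𝓡 n) x → TangentSpace (𝓡 n) x → ℝ) (f : M → N)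
    (Z : ∀ q : M, TangentSpace (𝓡 n) (f q)) (m : M) (v : TangentSpace (𝓡 k) m) :
    TangentSpace (𝓡 n) (f m) :=
  (show TangentSpace (𝓡 n) (f m) from fderiv ℝ (fun u : EuclideanSpace ℝ (Fin k) =>
      (mfderiv (𝓡 n) 𝓘(ℝ, EuclideanSpace ℝ (Fin n)) (extChartAt (𝓡 n) (f m))
        (f ((extChartAt (𝓡 k) m).symm u)) (Z ((extChartAt (𝓡 k) m).symm u)) :
        EuclideanSpace ℝ (Fin n)))
    (extChartAt (𝓡 k) m m) v)
  + christoffel G (f m) (mfderiv (𝓡 k) (𝓡 n) f m v) (Z m)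

end Geometry

/-! ### `G₂`-structures -/

/-- The evaluation functions of a Riemannian metric. -/
abbrev metricField {n : ℕ} {N : Type*} [TopologicalSpace N]
    [ChartedSpace (EuclideanSpace ℝ (Fin n)) N] [IsManifold (𝓡 n) ∞ N]
    (g : Bundle.ContMDiffRiemannianMetric (𝓡 n) ∞ (EuclideanSpace ℝ (Fin n))
      (fun x : N => TangentSpace (𝓡 n) x)) (x : N) (v w : TangentSpace (𝓡 n) x) : ℝ :=
  g.inner x v w

/-- A seven-dimensional Riemannian manifold with a `G₂`-structure: a Riemannian metric and a smooth
three-form which at each point is `∑ e_i ∧ e_{i+1} ∧ e_{i+3}` in some orthonormal basis. -/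
structure G2Structure (N : Type*) [TopologicalSpace N]
    [ChartedSpace (EuclideanSpace ℝ (Fin 7)) N] [IsManifold (𝓡 7) ∞ N] where
  /-- The Riemannian metric. -/
  metric : Bundle.ContMDiffRiemannianMetric (𝓡 7) ∞ (EuclideanSpace ℝ (Fin 7))
    (fun x : N => TangentSpace (𝓡 7) x)
  /-- The fundamental three-form. -/
  form : ∀ x : N, TangentSpace (𝓡 7) x [⋀^Fin 3]→ₗ[ℝ] ℝ
  smooth_form : SmoothTensor (fun x v => form x v)
  exists_cayleyFrame : ∀ x : N, ∃ e : Fin 7 → TangentSpace (𝓡 7) x,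
    IsCayleyFrame (metricField metric x) (fun v => form x v) e

namespace G2Structure

variable {N : Type*} [TopologicalSpace N] [ChartedSpace (EuclideanSpace ℝ (Fin 7)) N]
  [IsManifold (𝓡 7) ∞ N] (S : G2Structure N)

/-- The metric `⟨·, ·⟩`. -/
abbrev G (x : N) (v w : TangentSpace (𝓡 7) x) : ℝ := metricField S.metric x v w

/-- The three-form `φ` as a tensor field. -/
abbrev phi (x : N) : CovTensor 3 (TangentSpace (𝓡 7) x) := fun v => S.form x v

/-- The four-form `*φ`. -/
def star (x : N) : CovTensor 4 (TangentSpace (𝓡 7) x) := starPhi (S.G x) (S.phi x)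

/-- The vector cross product `P`. -/
def P (x : N) (v w : TangentSpace (𝓡 7) x) : TangentSpace (𝓡 7) x :=
  vecCross (S.G x) (S.phi x) v w

/-- The `G₂`-structure is of type `𝒳₄`: the covariant derivative of `φ` lies in `𝒳₄`. -/
def IsTypeX4 : Prop :=
  ∀ x : N, InX4 (S.G x) (S.phi x) (fun v => covDeriv S.G S.phi x v)

/-- The one-form `p d* φ = *(*dφ ∧ φ)`. -/
def pCoderiv (x : N) (v : TangentSpace (𝓡 7) x) : ℝ :=
  g2Star 6 1 rfl (S.G x) (S.phi x)
    (wedge (g2Star 4 3 rfl (S.G x) (S.phi x) (exteriorDeriv S.phi x)) (S.phi x)) ![v]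

/-- The vector field `p_φ` with `⟨p_φ, ·⟩ = p d* φ`. -/
def pVec (x : N) : TangentSpace (𝓡 7) x := sharp 7 (S.G x) (S.pCoderiv x)

end G2Structure

/-! ### `SU(3)`-structures and their types -/

/-- The tensors of a special almost Hermitian structure on a six-manifold: metric, almost complex
structure, and real and imaginary parts of the complex volume form. -/
structure SU3Tensors (M : Type*) [TopologicalSpace M]
    [ChartedSpace (EuclideanSpace ℝ (Fin 6)) M] where
  /-- The metric. -/
  G : ∀ x : M, TangentSpace (𝓡 6) x → TangentSpace (𝓡 6) x → ℝ
  /-- The almost complex structure. -/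
  I : ∀ x : M, TangentSpace (𝓡 6) x → TangentSpace (𝓡 6) x
  /-- The real part `ψ₊`. -/
  psiPlus : ∀ x : M, CovTensor 3 (TangentSpace (𝓡 6) x)
  /-- The imaginary part `ψ₋`. -/
  psiMinus : ∀ x : M, CovTensor 3 (TangentSpace (𝓡 6) x)

namespace SU3Tensors

variable {M : Type*} [TopologicalSpace M] [ChartedSpace (EuclideanSpace ℝ (Fin 6)) M]
  (Q : SU3Tensors M)

/-- The Kähler form `ω`. -/
def omega (x : M) : CovTensor 2 (TangentSpace (𝓡 6) x) := kahlerForm (Q.G x) (Q.I x)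

/-- `ζ ∈ T* ⊗ 𝔰𝔲(3)^⊥` is the intrinsic torsion at `x`, i.e. the connection `∇ + ζ` makes `ω`, `ψ₊`
and `ψ₋` parallel at `x`, where `∇` is the Levi-Civita connection. -/
def IsIntrinsicTorsion (x : M)
    (ζ : TangentSpace (𝓡 6) x →ₗ[ℝ] TangentSpace (𝓡 6) x →ₗ[ℝ] TangentSpace (𝓡 6) x) : Prop :=
  ∀ v : TangentSpace (𝓡 6) x,
    InPerp (Q.G x) (InSU3 (Q.G x) (Q.I x) (Q.psiPlus x) (Q.psiMinus x)) (ζ v) ∧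
    covDeriv Q.G Q.omega x v + derivAction (ζ v) (Q.omega x) = 0 ∧
    covDeriv Q.G Q.psiPlus x v + derivAction (ζ v) (Q.psiPlus x) = 0 ∧
    covDeriv Q.G Q.psiMinus x v + derivAction (ζ v) (Q.psiMinus x) = 0

/-- The structure is of type `∑_{c ∈ C} 𝒲_c`: at each point the intrinsic torsion lies in the sum of
the corresponding modules. Writing `ζ = η + ξ` with `η ∈ T* ⊗ ℝ = 𝒲₅` and
`ξ ∈ T* ⊗ 𝔲(3)^⊥ = 𝒲₁ + 𝒲₂ + 𝒲₃ + 𝒲₄`, the components of `ξ` are identified with those of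
`∇ω = - ξ ω`, and the component `η` vanishes iff `ζ` takes its values in `𝔲(3)^⊥`. -/
def HasType (C : Set SU3Component) : Prop :=
  ∀ x : M, ∃ (ζ : TangentSpace (𝓡 6) x →ₗ[ℝ] TangentSpace (𝓡 6) x →ₗ[ℝ] TangentSpace (𝓡 6) x)
    (a : SU3Component → (TangentSpace (𝓡 6) x →ₗ[ℝ] TangentSpace (𝓡 6) x →ₗ[ℝ]
      TangentSpace (𝓡 6) x →ₗ[ℝ] ℝ)),
    Q.IsIntrinsicTorsion x ζ ∧
    (∀ c, InComponent (Q.G x) (Q.I x) (Q.psiPlus x) (a c) c) ∧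
    (∀ c, c ∉ C → a c = 0) ∧
    (∀ u v w, covDeriv Q.G Q.omega x u ![v, w] =
      (a .w1p + a .w1m + a .w2p + a .w2m + a .w3 + a .w4) u v w) ∧
    (SU3Component.w5 ∉ C → ∀ v, InPerp (Q.G x) (InU3 (Q.G x) (Q.I x)) (ζ v))

end SU3Tensors

/-! ### Hypersurfaces of manifolds with a `G₂`-structure -/

namespace G2Structure

variable {N : Type*} [TopologicalSpace N] [ChartedSpace (EuclideanSpace ℝ (Fin 7)) N]
  [IsManifold (𝓡 7) ∞ N] (S : G2Structure N)
  {M : Type*} [TopologicalSpace M] [ChartedSpace (EuclideanSpace ℝ (Fin 6)) M]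

/-- `ι : M → N` is a smooth immersion with smooth unit normal vector field `ν`. -/
structure IsHypersurface (ι : M → N) (ν : ∀ m : M, TangentSpace (𝓡 7) (ι m)) : Prop where
  smooth : ContMDiff (𝓡 6) (𝓡 7) ∞ ι
  immersion : ∀ m, Function.Injective (mfderiv (𝓡 6) (𝓡 7) ι m)
  smooth_normal : ContMDiff (𝓡 6) (𝓡 7).tangent ∞
    (fun m => (⟨ι m, ν m⟩ : TangentBundle (𝓡 7) N))
  normal : ∀ (m : M) (v : TangentSpace (𝓡 6) m),
    S.G (ι m) (ν m) (mfderiv (𝓡 6) (𝓡 7) ι m v) = 0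
  unit : ∀ m, S.G (ι m) (ν m) (ν m) = 1

/-- The pull-back of a tensor field on `N` along `ι`, at `m`. -/
def pullback {k : ℕ} (ι : M → N) (m : M) (T : CovTensor k (TangentSpace (𝓡 7) (ι m))) :
    CovTensor k (TangentSpace (𝓡 6) m) :=
  fun v => T (fun i => mfderiv (𝓡 6) (𝓡 7) ι m (v i))

/-- The induced metric. -/
def inducedMetric (ι : M → N) (m : M) (v w : TangentSpace (𝓡 6) m) : ℝ :=
  S.G (ι m) (mfderiv (𝓡 6) (𝓡 7) ι m v) (mfderiv (𝓡 6) (𝓡 7) ι m w)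

/-- The induced `SU(3)`-structure: the almost complex structure is given by
`ι_*(I x) = P(ν, ι_* x)`, and the complex volume form by
`ψ₊ = cos θ ι*φ - sin θ ι*(ν ⌟ *φ)` and `ψ₋ = sin θ ι*φ + cos θ ι*(ν ⌟ *φ)`. -/
def inducedSU3 (ι : M → N) (ν : ∀ m : M, TangentSpace (𝓡 7) (ι m)) (θ : M → ℝ) :
    SU3Tensors M where
  G := S.inducedMetric ι
  I m x := Function.invFun (mfderiv (𝓡 6) (𝓡 7) ι m)
    (S.P (ι m) (ν m) (mfderiv (𝓡 6) (𝓡 7) ι m x))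
  psiPlus m := Real.cos (θ m) • pullback ι m (S.phi (ι m))
    - Real.sin (θ m) • pullback ι m (contractVec (ν m) (S.star (ι m)))
  psiMinus m := Real.sin (θ m) • pullback ι m (S.phi (ι m))
    + Real.cos (θ m) • pullback ι m (contractVec (ν m) (S.star (ι m)))

/-- The shape tensor `II(X, Y)`, the normal component of `∇_X (ι_* Y)`, where `∇` is the Levi-Civita
connection of `N` and `Y` is extended to a field with constant coordinates in the preferred chart
at `m`. -/
def shapeTensor (ι : M → N) (ν : ∀ m : M, TangentSpace (𝓡 7) (ι m)) (m : M)
    (X Y : TangentSpace (𝓡 6) m) : TangentSpace (𝓡 7) (ι m) :=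
  S.G (ι m) (covDerivAlong S.G ι (fun q => mfderiv (𝓡 6) (𝓡 7) ι q
    (mfderiv 𝓘(ℝ, EuclideanSpace ℝ (Fin 6)) (𝓡 6) (extChartAt (𝓡 6) m).symm
      (extChartAt (𝓡 6) m q) Y)) m X) (ν m) • ν m

/-- The second fundamental form `B(X, Y) = ⟨II(X, Y), ν⟩`. -/
def secondForm (ι : M → N) (ν : ∀ m : M, TangentSpace (𝓡 7) (ι m)) (m : M)
    (X Y : TangentSpace (𝓡 6) m) : ℝ :=
  S.G (ι m) (S.shapeTensor ι ν m X Y) (ν m)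

/-- The mean curvature vector `H = (1/6) tr II`. -/
def meanCurvature (ι : M → N) (ν : ∀ m : M, TangentSpace (𝓡 7) (ι m)) (m : M) :
    TangentSpace (𝓡 7) (ι m) :=
  (1 / 6 : ℝ) • ∑ i, S.shapeTensor ι ν m (orthoFrame 6 (S.inducedMetric ι m) i)
    (orthoFrame 6 (S.inducedMetric ι m) i)

/-- `h = ⟨H, ν⟩`. -/
def meanCurvatureLength (ι : M → N) (ν : ∀ m : M, TangentSpace (𝓡 7) (ι m)) (m : M) : ℝ :=
  S.G (ι m) (S.meanCurvature ι ν m) (ν m)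

end G2Structure

end

/-! A Cayley basis makes `P` a vector cross product, and the double product identity `P(x, P(x, y))
= ⟨x, y⟩ x - ⟨x, x⟩ y` determines `*φ` as `crossFourForm`. Since `𝔤₂^⊥` consists of the two-forms `z
⌟ φ`, type `𝒳₄` means that `∇_x φ = P(z, x) ⌟ *φ` for a vector `z` at each point. Alternation gives
`dφ = 3 z ∧ φ`, hence `p_φ = -12 z`, and `p_φ` is tangent exactly when `z` is.

On the tangent space of `M` the restriction of `φ` is the real part of a complex volume form; let
`Q` be its cross product. For any such form `ψ`, contraction `R ↦ ψ ∘ R` identifies the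
endomorphisms with `T* ⊗ 𝔲(3)^⊥`, and `r` is the inverse. Under it `𝒲₁⁺`, `𝒲₁⁻` are the real
multiples of `1` and of `I`; `𝒲₂⁺`, `𝒲₂⁻` the complex linear endomorphisms that are symmetric and
trace-free, resp. skew with `tr (I R) = 0`; `𝒲₃`, `𝒲₄` the antilinear symmetric, resp. skew ones. If
`∇_v ω = R v ⌟ ψ₊` and `b(v)` measures how `∇_v` turns the phase of `ψ₊ + i ψ₋`, the intrinsic
torsion is `-(1/2) Q'(I R v) + (b(v)/3) I`, where `Q'` is the cross product of `ψ₊`, and its `𝒲₅`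
part is `b` (`isTorsionAt_iff`, `inPerp_inU3_iff`).

The Gauss and Weingarten formulas give `∇_v ω = (A v - I Q(z, v)) ⌟ φ` with the symmetric shape
operator `A`. In the phase `θ` this reads `R = cos θ A - sin θ I A + Q'(I z, ·)` and `b(v) = ⟨z, I
v⟩ + dθ(v)`. Split `A = h + A_c + A_a` into a multiple of the identity, a trace-free complex linear
and an antilinear part. The components of `R`, from `𝒲₁⁺` to `𝒲₄`, are then `h cos θ`, `-h sin θ I`,
`cos θ A_c`, `-sin θ I A_c`, `(cos θ - sin θ I) A_a` and `Q'(I z, ·)`. Each of the ten conditions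
says that some of these, or `b`, vanish; `𝒲₄` is always allowed, so the last component of `R` never
matters.

The load is carried by `isCrossProduct_of_cayleyFrame`, `IsCrossProduct.cross_cross`,
`exists_vec_of_inX4`, `G2Structure.IsTypeX4.exists_vec`, `hasTypeAt_iff_of_symmetric`, the three
covariant derivatives ending with `covDeriv_pullback_star`, and `hasType_inducedSU3_iff`, which
joins algebra and geometry. -/

noncomputable section

/-! ### Scalar products and orthonormal frames. -/

section EuclideanAlgebra

variable {V : Type*} [AddCommGroup V] [Module ℝ V]

/-- `g` is a scalar product on the `n`-dimensional space `V`. -/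
structure IsScalarProduct (n : ℕ) (g : V →ₗ[ℝ] V →ₗ[ℝ] ℝ) : Prop where
  symm : ∀ x y, g x y = g y x
  pos : ∀ x, x ≠ 0 → 0 < g x x
  finite : Module.Finite ℝ V
  finrank : Module.finrank ℝ V = n

namespace IsScalarProduct

variable {n : ℕ} {g : V →ₗ[ℝ] V →ₗ[ℝ] ℝ} (hg : IsScalarProduct n g)
include hg

theorem eq_zero_of_self {x : V} (h : g x x = 0) : x = 0 := by
  by_contra hx
  exact (hg.pos x hx).ne' h

theorem eq_of_forall {x y : V} (h : ∀ z, g x z = g y z) : x = y := by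
  refine sub_eq_zero.1 (hg.eq_zero_of_self ?_)
  simp only [map_sub, LinearMap.sub_apply, h, sub_self]

theorem exists_isOrthoFrame : ∃ e : Fin n → V, IsOrthoFrame (fun x y => g x y) e := by
  let core : InnerProductSpace.Core ℝ V :=
    { inner := fun x y => g x y
      conj_inner_symm := fun x y => by simpa using hg.symm y x
      re_inner_nonneg := fun x => by
        by_cases hx : x = 0
        · simp [hx]
        · simpa using (hg.pos x hx).le
      definite := fun x hx => hg.eq_zero_of_self hx
      add_left := fun x y z => by simp
      smul_left := fun x y r => by simp }
  let : NormedAddCommGroup V := core.toNormedAddCommGroup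
  let : InnerProductSpace ℝ V := InnerProductSpace.ofCore core.toCore
  have := hg.finite
  let b := (stdOrthonormalBasis ℝ V).reindex (finCongr hg.finrank)
  exact ⟨b, fun i j => orthonormal_iff_ite.1 b.orthonormal i j⟩

/-- `orthoFrame` is an epsilon choice, so it means something only because an orthonormal frame
exists. -/
theorem isOrthoFrame_orthoFrame :
    IsOrthoFrame (fun x y => g x y) (orthoFrame n (fun x y => g x y)) :=
  Classical.epsilon_spec hg.exists_isOrthoFrame

variable {e : Fin n → V} (he : IsOrthoFrame (fun x y => g x y) e)
include he

omit hg in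
theorem linearIndependent : LinearIndependent ℝ e := by
  rw [Fintype.linearIndependent_iff]
  intro c hc i
  have h : g (∑ j, c j • e j) (e i) = 0 := by rw [hc]; simp
  have he' : ∀ j, g (e j) (e i) = if j = i then 1 else 0 := fun j => he j i
  simpa [map_sum, LinearMap.sum_apply, he'] using h

/-- The basis given by an orthonormal frame. -/
theorem exists_basis : ∃ b : Module.Basis (Fin n) ℝ V, ⇑b = e := by
  have := hg.finite
  -- A linearly independent family of the right size is turned into a basis under the assumption of
  -- a nonempty index type, so dimension zero is treated apart.
  have : Nonempty (Fin n) ∨ IsEmpty (Fin n) := (isEmpty_or_nonempty _).symm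
  rcases this with h | h
  · exact ⟨basisOfLinearIndependentOfCardEqFinrank (linearIndependent he)
      (by simp [hg.finrank]), by simp⟩
  · have hn : n = 0 := by
      rcases n with _ | n
      · rfl
      · exact (h.false 0).elim
    subst hn
    have : Subsingleton V := Module.finrank_zero_iff.1 hg.finrank
    exact ⟨Module.Basis.empty V, funext fun i => i.elim0⟩

theorem sum_smul (x : V) : ∑ i, g x (e i) • e i = x := by
  obtain ⟨b, hb⟩ := hg.exists_basis he
  refine hg.eq_of_forall fun z => ?_
  suffices h : g (∑ i, g x (e i) • e i) = g x by rw [h]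
  refine b.ext fun j => ?_
  have he' : ∀ i, g (e i) (e j) = if i = j then 1 else 0 := fun i => he i j
  simp [map_sum, LinearMap.sum_apply, hb, he']

/-- Contraction of a linear form with the metric. -/
theorem sum_mul (f : V →ₗ[ℝ] ℝ) (x : V) : ∑ i, g x (e i) * f (e i) = f x := by
  conv_rhs => rw [← hg.sum_smul he x]
  simp [map_sum]

theorem sum_mul' (f : V →ₗ[ℝ] ℝ) (x : V) : ∑ i, g (e i) x * f (e i) = f x := by
  rw [← hg.sum_mul he f x]
  simp only [hg.symm x]

theorem sum_mul_self (x y : V) : ∑ i, g x (e i) * g y (e i) = g x y := by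
  rw [hg.sum_mul he (g y) x, hg.symm]

theorem sharp_frame (f : V →ₗ[ℝ] ℝ) (x : V) : g (∑ i, f (e i) • e i) x = f x := by
  rw [← hg.sum_mul' he f x]
  simp [map_sum, LinearMap.sum_apply, mul_comm]

theorem trace_eq (A : V →ₗ[ℝ] V) : LinearMap.trace ℝ V A = ∑ i, g (A (e i)) (e i) := by
  obtain ⟨b, hb⟩ := hg.exists_basis he
  rw [LinearMap.trace_eq_matrix_trace ℝ b, Matrix.trace]
  refine Finset.sum_congr rfl fun i _ => ?_
  rw [Matrix.diag_apply, LinearMap.toMatrix_apply, hb]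
  have h : g (A (e i)) (e i) = g (∑ j, b.repr (A (e i)) j • b j) (e i) := by rw [b.sum_repr]
  rw [h]
  have he' : ∀ j, g (e j) (e i) = if j = i then 1 else 0 := fun j => he j i
  simp [map_sum, LinearMap.sum_apply, hb, he']

/-- The trace of a bilinear form does not depend on the orthonormal frame. -/
theorem sum_bilin_eq {e' : Fin n → V} (he' : IsOrthoFrame (fun x y => g x y) e')
    (T : V →ₗ[ℝ] V →ₗ[ℝ] ℝ) : ∑ i, T (e i) (e i) = ∑ i, T (e' i) (e' i) := by
  have h : ∀ i, T (e i) (e i) = ∑ j, g (e i) (e' j) * T (e i) (e' j) := fun i =>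
    (hg.sum_mul he' (T (e i)) (e i)).symm
  have h' : ∀ j, T (e' j) (e' j) = ∑ i, g (e i) (e' j) * T (e i) (e' j) := fun j =>
    (hg.sum_mul' he (T.flip (e' j)) (e' j)).symm
  simp only [h, h']
  exact Finset.sum_comm

end IsScalarProduct

theorem IsScalarProduct.sharp_apply {n : ℕ} {g : V →ₗ[ℝ] V →ₗ[ℝ] ℝ} (hg : IsScalarProduct n g)
    (f : V →ₗ[ℝ] ℝ) (x : V) : g (sharp n (fun x y => g x y) f) x = f x :=
  hg.sharp_frame hg.isOrthoFrame_orthoFrame f x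

/-- Summation over the functions on `Fin (k + 1)`, by their first value. -/
theorem sum_fin_succ_fun {ι R : Type*} [Fintype ι] [AddCommMonoid R] {k : ℕ}
    (f : (Fin (k + 1) → ι) → R) : ∑ s, f s = ∑ i, ∑ s : Fin k → ι, f (Fin.cons i s) := by
  rw [← Fintype.sum_prod_type']
  exact (Fintype.sum_equiv (Fin.consEquiv fun _ => ι) _ _ fun x => rfl).symm

theorem sum_fin_one_fun {ι R : Type*} [Fintype ι] [AddCommMonoid R] (f : (Fin 1 → ι) → R) :
    ∑ s, f s = ∑ i, f ![i] := by
  rw [sum_fin_succ_fun]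
  simp only [Fintype.sum_unique]
  rfl

theorem sum_fin_two_fun {ι R : Type*} [Fintype ι] [AddCommMonoid R] (f : (Fin 2 → ι) → R) :
    ∑ s, f s = ∑ i, ∑ j, f ![i, j] := by
  rw [sum_fin_succ_fun]
  simp only [sum_fin_one_fun]
  rfl

theorem sum_fin_three_fun {ι R : Type*} [Fintype ι] [AddCommMonoid R] (f : (Fin 3 → ι) → R) :
    ∑ s, f s = ∑ i, ∑ j, ∑ k, f ![i, j, k] := by
  rw [sum_fin_succ_fun]
  simp only [sum_fin_two_fun]
  rfl

theorem sum_fin_four_fun {ι R : Type*} [Fintype ι] [AddCommMonoid R] (f : (Fin 4 → ι) → R) :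
    ∑ s, f s = ∑ i, ∑ j, ∑ k, ∑ l, f ![i, j, k, l] := by
  rw [sum_fin_succ_fun]
  simp only [sum_fin_three_fun]
  rfl

end EuclideanAlgebra
end

noncomputable section

/-! ### Identities of a seven-dimensional vector cross product. -/

section CrossProduct

variable {V : Type*} [AddCommGroup V] [Module ℝ V]

/-- `P` is a vector cross product on the seven-dimensional Euclidean space `(V, g)`, with associated
three-form `φ`. -/
structure IsCrossProduct (g : V →ₗ[ℝ] V →ₗ[ℝ] ℝ) (φ : V →ₗ[ℝ] V →ₗ[ℝ] V →ₗ[ℝ] ℝ)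
    (P : V →ₗ[ℝ] V →ₗ[ℝ] V) : Prop where
  scalar : IsScalarProduct 7 g
  skew12 : ∀ x y z, φ x y z = - φ y x z
  skew23 : ∀ x y z, φ x y z = - φ x z y
  cross : ∀ x y z, g (P x y) z = φ x y z
  double : ∀ x y, P x (P x y) = g x y • x - g x x • y

/-- The four-form `⟨x, z⟩⟨y, t⟩ - ⟨x, t⟩⟨y, z⟩ - ⟨P(x, y), P(z, t)⟩` of a vector cross product. -/
def crossFourForm (g : V →ₗ[ℝ] V →ₗ[ℝ] ℝ) (P : V →ₗ[ℝ] V →ₗ[ℝ] V) (x y z t : V) : ℝ :=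
  g x z * g y t - g x t * g y z - g (P x y) (P z t)

namespace IsCrossProduct

variable {g : V →ₗ[ℝ] V →ₗ[ℝ] ℝ} {φ : V →ₗ[ℝ] V →ₗ[ℝ] V →ₗ[ℝ] ℝ} {P : V →ₗ[ℝ] V →ₗ[ℝ] V}
  (h : IsCrossProduct g φ P)
include h

theorem symm (x y : V) : g x y = g y x := h.scalar.symm x y

theorem rot (x y z : V) : φ x y z = φ y z x := by
  rw [h.skew12, h.skew23, neg_neg]

theorem skew13 (x y z : V) : φ x y z = - φ z y x := by
  rw [h.rot, h.skew12]

theorem self12 (x y : V) : φ x x y = 0 := by linarith [h.skew12 x x y]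

theorem self13 (x y : V) : φ x y x = 0 := by linarith [h.skew13 x y x]

theorem cross' (x y z : V) : g z (P x y) = φ x y z := by rw [h.symm, h.cross]

theorem cross_skew (x y : V) : P x y = - P y x :=
  h.scalar.eq_of_forall fun z => by
    rw [h.cross, h.skew12, map_neg, LinearMap.neg_apply, h.cross]

theorem double_apply (x y w : V) : φ x (P x y) w = g x y * g x w - g x x * g y w := by
  rw [← h.cross, h.double]
  simp

/-- Polarisation of the double cross product identity, evaluated at `a + x`. -/
theorem polar (a x y w : V) : φ a (P x y) w + φ x (P a y) w =
    - 2 * g a x * g y w + g a y * g x w + g x y * g a w := by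
  have h1 := h.double_apply (a + x) y w
  have h2 := h.double_apply a y w
  have h3 := h.double_apply x y w
  simp only [map_add, LinearMap.add_apply] at h1
  rw [h.symm x a] at h1
  linear_combination h1 - h2 - h3

theorem polar_cross (p q r s t : V) : φ p (P q r) (P s t) + φ q (P p r) (P s t) =
    - 2 * g p q * φ s t r + g p r * φ s t q + g q r * φ s t p := by
  rw [h.polar, h.cross', h.cross', h.cross']

/-- By `polar_cross`, `φ(p, P(q, r), P(s, t))` is skew in `p`, `q` up to terms `g φ`. Write `F` for
the left side and `G = φ(a, P(b, y), P(x, c))`. Three exchanges (`e1`, `e2`, `e3`) evaluate `F + G`,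
three more (`e4`, `e5`, `e6`) evaluate `G - F`; the difference is `2 F`. -/
theorem cross_cross (a x y b c : V) : φ a (P x y) (P b c) =
    - g a x * φ b c y + g a y * φ b c x + g b x * φ a c y - g b y * φ a c x
      - g c x * φ a b y + g c y * φ a b x + g a b * φ c x y - g a c * φ b x y := by
  have e1 := h.polar_cross a x y b c
  have e2 := h.polar_cross x b c a y
  have e3 := h.polar_cross b a y x c
  have e4 := h.polar_cross a y b c x
  have e5 := h.polar_cross y c x a b
  have e6 := h.polar_cross c a b y x
  rw [h.rot b c a, h.rot c a b] at e1
  rw [h.skew23 a y c, h.skew23 a y b, h.skew23 a y x, h.skew23 x (P b c), h.skew23 b (P x c),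
    h.symm x b, h.symm x c] at e2
  rw [h.skew12 x c y, h.skew13 x c a, h.skew13 x c b, h.symm b a] at e3
  rw [h.rot c x b, h.rot x b c, h.rot c x a, h.rot x a c, h.symm y b] at e4
  rw [h.symm y c, h.symm y x, h.skew23 y (P c x), h.skew23 c (P y x)] at e5
  rw [h.symm c a, h.symm c b, h.skew13 y x b, h.skew13 y x a, h.skew13 y x c] at e6
  have s1 : φ a (P b y) (P x c) = φ a (P y b) (P c x) := by
    rw [h.cross_skew b y, h.cross_skew x c]; simp
  have s2 : φ a (P c b) (P y x) = - φ a (P x y) (P b c) := by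
    rw [h.skew23, h.cross_skew y x, h.cross_skew c b]; simp
  linear_combination (1 / 2) * (e1 + e2 + e3) - (1 / 2) * (e4 + e5 + e6) - (1 / 2) * s1 + (1 / 2) * s2

/-- `cross_cross` for the four-form: once a cross product stands in its first slot, the four-form
reduces to products `g φ`. In type `𝒳₄` every `∇φ` has this shape. -/
theorem fourForm_cross (x y a b c : V) : crossFourForm g P (P x y) a b c =
    - (g x a * φ y b c - g y a * φ x b c + g x b * φ a y c - g y b * φ a x c
      + g x c * φ a b y - g y c * φ a b x) := by
  have e := h.cross_cross a x y b c
  have e' := h.skew12 (P x y) a (P b c)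
  rw [crossFourForm, h.cross, h.cross, h.cross, e', e, h.rot x y b, h.rot x y c, h.skew12 x b c,
    h.skew12 y b c, h.skew23 a y c, h.skew23 a x c, h.skew13 c x y, h.skew13 b x y, h.symm x a,
    h.symm x b, h.symm x c, h.symm y a, h.symm y b, h.symm y c, h.skew13 y x c, h.skew13 y x b]
  linear_combination g a c * h.rot y b x - g a b * h.rot y c x - g a x * h.skew23 b c y
    + g a y * h.skew23 b c x

theorem fourForm_skew12 (x y z t : V) :
    crossFourForm g P x y z t = - crossFourForm g P y x z t := by
  rw [crossFourForm, crossFourForm, h.cross_skew x y]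
  simp only [map_neg, LinearMap.neg_apply]
  ring

theorem fourForm_skew34 (x y z t : V) :
    crossFourForm g P x y z t = - crossFourForm g P x y t z := by
  rw [crossFourForm, crossFourForm, h.cross_skew z t]
  simp only [map_neg]
  ring

/-- This exchange is exactly the identity `polar`; the other two adjacent ones follow from the
skewness of `P`, and together they make the form alternating. -/
theorem fourForm_skew23 (x y z t : V) :
    crossFourForm g P x y z t = - crossFourForm g P x z y t := by
  have e := h.polar y z t x
  rw [crossFourForm, crossFourForm, h.cross, h.cross, h.rot x y, h.rot x z, h.symm x z, h.symm x t,
    h.symm x y, h.symm z y]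
  linear_combination - e

end IsCrossProduct

end CrossProduct
end

noncomputable section

/-! ### Volume forms, Hodge stars and the combinatorics of the Cayley basis. -/

section VolumeForm

variable {V : Type*} [AddCommGroup V] [Module ℝ V]

/-- The volume form `e₁ ∧ ⋯ ∧ e_n` of a frame. -/
def frameVolume {n : ℕ} (g : V →ₗ[ℝ] V →ₗ[ℝ] ℝ) (e : Fin n → V) : V [⋀^Fin n]→ₗ[ℝ] ℝ :=
  Matrix.detRowAlternating.compLinearMap (LinearMap.pi fun i => g (e i))

theorem frameVolume_apply {n : ℕ} (g : V →ₗ[ℝ] V →ₗ[ℝ] ℝ) (e : Fin n → V) (v : Fin n → V) :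
    frameVolume g e v = Matrix.det (Matrix.of fun i j => g (e i) (v j)) := by
  rw [← Matrix.det_transpose]
  rfl

theorem hodgeStar_eq (p q : ℕ) (g : V →ₗ[ℝ] V →ₗ[ℝ] ℝ) (e : Fin (p + q) → V)
    (α : CovTensor p V) (v : Fin q → V) :
    hodgeStar p q (fun x y => g x y) e α v = (1 / (p.factorial : ℝ)) *
      ∑ s : Fin p → Fin (p + q), α (fun i => e (s i)) *
        frameVolume g e (Fin.append (fun k => e (s k)) v) := by
  simp only [hodgeStar, frameVolume_apply]

theorem alternating_append_perm {p q : ℕ} (A : V [⋀^Fin (p + q)]→ₗ[ℝ] ℝ) (u : Fin p → V)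
    (v : Fin q → V) (σ : Equiv.Perm (Fin p)) :
    A (Fin.append (u ∘ σ) v) = ((Equiv.Perm.sign σ : ℤ) : ℝ) * A (Fin.append u v) := by
  let τ : Equiv.Perm (Fin (p + q)) :=
    (finSumFinEquiv.symm.trans (Equiv.Perm.sumCongr σ 1)).trans finSumFinEquiv
  have hτ : Fin.append (u ∘ σ) v = Fin.append u v ∘ τ := by
    funext i
    refine Fin.addCases (fun i => ?_) (fun i => ?_) i
    · simp [τ]
    · simp [τ]
  have hs : Equiv.Perm.sign τ = Equiv.Perm.sign σ := by
    simp only [τ, Equiv.Perm.sign_symm_trans_trans, Equiv.Perm.sign_sumCongr, Equiv.Perm.sign_one,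
      mul_one]
  rw [hτ, A.map_perm, hs]
  simp [Units.smul_def]

/-- Contraction of a monomial with a skew-symmetric function of the indices. -/
theorem sum_det_mul {p n : ℕ} (t : Fin p → Fin n) (A : (Fin p → Fin n) → ℝ)
    (hA : ∀ σ : Equiv.Perm (Fin p), A (t ∘ σ) = ((Equiv.Perm.sign σ : ℤ) : ℝ) * A t) :
    ∑ s : Fin p → Fin n,
      Matrix.det (Matrix.of fun a b : Fin p => if t a = s b then (1 : ℝ) else 0) * A s =
      p.factorial * A t := by
  have h1 : ∀ s : Fin p → Fin n,
      Matrix.det (Matrix.of fun a b : Fin p => if t a = s b then (1 : ℝ) else 0) * A s =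
        ∑ σ : Equiv.Perm (Fin p),
          if t ∘ σ = s then ((Equiv.Perm.sign σ : ℤ) : ℝ) * A s else 0 := by
    intro s
    rw [Matrix.det_apply', Finset.sum_mul]
    refine Finset.sum_congr rfl fun σ _ => ?_
    simp only [Matrix.of_apply, Finset.prod_ite_zero, Finset.prod_const_one]
    by_cases h : t ∘ σ = s
    · have h' : ∀ i, t (σ i) = s i := fun i => congrFun h i
      simp [h, h']
    · have h' : ¬ ∀ i, t (σ i) = s i := fun h' => h (funext h')
      simp [h, h']
  simp only [h1]
  rw [Finset.sum_comm]
  simp only [Finset.sum_ite_eq, Finset.mem_univ, if_true, hA, ← mul_assoc, ← Int.cast_mul,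
    ← Units.val_mul, Int.units_mul_self]
  simp [Fintype.card_perm]

end VolumeForm

/-- The sign of the sequence of values of a list, zero if there are repetitions. -/
def listSign : List (Fin 7) → ℤ
  | [] => 1
  | a :: l => l.foldr (fun b r => if a < b then r else if a = b then 0 else -r) (listSign l)

theorem listSign_nil : listSign [] = 1 := rfl

/-- The fold in `listSign` is suited to evaluation; the product form here matches the sign of a
permutation as a product over pairs. -/
theorem listSign_cons (a : Fin 7) (l : List (Fin 7)) : listSign (a :: l) =
    (l.map fun b => if a < b then 1 else if a = b then 0 else -1).prod * listSign l := by
  rw [listSign]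
  generalize listSign l = r
  induction l with
  | nil => simp
  | cons b l ih =>
    rw [List.foldr_cons, ih, List.map_cons, List.prod_cons]
    split_ifs <;> simp

/-- Replaces determinants of orthonormal vectors by computable integers. For injective `w` the
matrix is a permutation matrix, otherwise two columns coincide and the list has a repetition. -/
theorem det_indicator (w : Fin 7 → Fin 7) :
    Matrix.det (Matrix.of fun i j => if i = w j then (1 : ℝ) else 0) =
      listSign [w 0, w 1, w 2, w 3, w 4, w 5, w 6] := by
  by_cases hw : Function.Injective w
  · let σ : Equiv.Perm (Fin 7) := Equiv.ofBijective w (Finite.injective_iff_bijective.1 hw)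
    have h1 : (Matrix.of fun i j => if i = w j then (1 : ℝ) else 0) =
        (σ⁻¹).permMatrix ℝ := by
      ext i j
      have : i = w j ↔ σ⁻¹ i = j := by
        rw [Equiv.Perm.inv_eq_iff_eq]
        rfl
      simp [Equiv.Perm.permMatrix, PEquiv.toMatrix_apply, this, Equiv.toPEquiv_apply, eq_comm]
    rw [h1, Matrix.det_permutation, Equiv.Perm.sign_inv, Equiv.Perm.sign_eq_prod_prod_Ioi]
    have h2 : ∀ i j : Fin 7, i < j → ((if σ i < σ j then 1 else -1 : ℤˣ) : ℤ) =
        if w i < w j then 1 else if w i = w j then 0 else -1 := by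
      intro i j hij
      have : w i ≠ w j := fun h => hij.ne (hw h)
      rw [if_neg this]
      have h3 : ∀ k, σ k = w k := fun k => rfl
      rw [h3, h3]
      split_ifs <;> rfl
    have h4 : ((∏ i, ∏ j ∈ Finset.Ioi i, (if σ i < σ j then 1 else -1 : ℤˣ) : ℤˣ) : ℤ) =
        ∏ i, ∏ j ∈ Finset.Ioi i, if w i < w j then 1 else if w i = w j then 0 else -1 := by
      push_cast
      refine Finset.prod_congr rfl fun i _ => Finset.prod_congr rfl fun j hj => ?_
      rw [← h2 i j (Finset.mem_Ioi.1 hj)]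
    have h5 : ∀ F : Fin 7 → Fin 7 → ℤ, ∏ i, ∏ j ∈ Finset.Ioi i, F i j =
        (F 0 1 * (F 0 2 * (F 0 3 * (F 0 4 * (F 0 5 * F 0 6))))) *
        ((F 1 2 * (F 1 3 * (F 1 4 * (F 1 5 * F 1 6)))) *
        ((F 2 3 * (F 2 4 * (F 2 5 * F 2 6))) *
        ((F 3 4 * (F 3 5 * F 3 6)) * ((F 4 5 * F 4 6) * F 5 6)))) := by
      intro F
      have h0 : Finset.Ioi (0 : Fin 7) = {1, 2, 3, 4, 5, 6} := by decide
      have h1 : Finset.Ioi (1 : Fin 7) = {2, 3, 4, 5, 6} := by decide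
      have h2 : Finset.Ioi (2 : Fin 7) = {3, 4, 5, 6} := by decide
      have h3 : Finset.Ioi (3 : Fin 7) = {4, 5, 6} := by decide
      have h4 : Finset.Ioi (4 : Fin 7) = {5, 6} := by decide
      have h5 : Finset.Ioi (5 : Fin 7) = {6} := by decide
      have h6 : Finset.Ioi (6 : Fin 7) = ∅ := by decide
      rw [Fin.prod_univ_seven, h0, h1, h2, h3, h4, h5, h6]
      simp
      ring
    rw [h4, h5]
    simp only [listSign_cons, List.map_cons, List.map_nil, List.prod_cons, List.prod_nil,
      listSign_nil, mul_one, mul_assoc]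
  · obtain ⟨i, j, hij, hne⟩ : ∃ i j, w i = w j ∧ i ≠ j := by
      simpa [Function.Injective] using hw
    rw [Matrix.det_zero_of_column_eq hne (by intro k; simp [hij])]
    have h0 : ∀ a : Fin 7, ∀ l : List (Fin 7), a ∈ l → listSign (a :: l) = 0 := by
      intro a l ha
      rw [listSign_cons, List.prod_eq_zero, zero_mul]
      exact List.mem_map.2 ⟨a, ha, by simp⟩
    have h1 : ∀ l : List (Fin 7), ¬ l.Nodup → listSign l = 0 := by
      intro l
      induction l with
      | nil => simp
      | cons a l ih =>
        intro hl
        by_cases ha : a ∈ l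
        · exact h0 a l ha
        · rw [listSign_cons, ih (fun h => hl (List.nodup_cons.2 ⟨ha, h⟩)), mul_zero]
    have h2 : [w 0, w 1, w 2, w 3, w 4, w 5, w 6] = List.ofFn w := by simp [List.ofFn_succ]
    rw [h2, h1 _ (fun h => hw (List.nodup_ofFn.1 h)), Int.cast_zero]

/-- Passes between the index types `Fin (3 + 4)`, `Fin (4 + 1 + 1 + 1)` and `Fin 7`. -/
theorem frameVolume_congr {V : Type*} [AddCommGroup V] [Module ℝ V] (g : V →ₗ[ℝ] V →ₗ[ℝ] ℝ)
    {n m : ℕ} (h : n = m) {e v : Fin m → V} {e' v' : Fin n → V}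
    (he : ∀ i, e' i = e (Fin.cast h i)) (hv : ∀ i, v' i = v (Fin.cast h i)) :
    frameVolume g e' v' = frameVolume g e v := by
  subst h
  have he' : e' = e := funext he
  have hv' : v' = v := funext hv
  rw [he', hv']

theorem frameVolume_frame {V : Type*} [AddCommGroup V] [Module ℝ V] {g : V →ₗ[ℝ] V →ₗ[ℝ] ℝ}
    {e : Fin 7 → V} (he : IsOrthoFrame (fun x y => g x y) e) (w : Fin 7 → Fin 7) :
    frameVolume g e (fun j => e (w j)) = listSign [w 0, w 1, w 2, w 3, w 4, w 5, w 6] := by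
  have h1 : (Matrix.of fun i j => g (e i) (e (w j))) =
      Matrix.of (fun i j => if i = w j then (1 : ℝ) else 0) := by
    ext i j
    exact he _ _
  rw [frameVolume_apply, h1]
  exact det_indicator w

/-- The coefficients `φ(e_a, e_b, e_c)` in a Cayley basis. -/
def cayleyCoeff (a b c : Fin 7) : ℤ :=
  -- The pairs are the differences seen from each of the three entries of `(i, i + 1, i + 3)`, read
  -- cyclically; the second line lists them with `b` and `c` exchanged.
  if (b - a = 1 ∧ c - a = 3) ∨ (b - a = 2 ∧ c - a = 6) ∨ (b - a = 4 ∧ c - a = 5) then 1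
  else if (b - a = 3 ∧ c - a = 1) ∨ (b - a = 6 ∧ c - a = 2) ∨ (b - a = 5 ∧ c - a = 4) then -1
  else 0

theorem cayleyCoeff_det : ∀ a b c : Fin 7, (∑ i : Fin 7,
    ((if i = a then 1 else 0) * (if i + 1 = b then 1 else 0) * (if i + 3 = c then 1 else 0)
    - (if i = a then 1 else 0) * (if i + 1 = c then 1 else 0) * (if i + 3 = b then 1 else 0)
    - (if i = b then 1 else 0) * (if i + 1 = a then 1 else 0) * (if i + 3 = c then 1 else 0)
    + (if i = b then 1 else 0) * (if i + 1 = c then 1 else 0) * (if i + 3 = a then 1 else 0)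
    + (if i = c then 1 else 0) * (if i + 1 = a then 1 else 0) * (if i + 3 = b then 1 else 0)
    - (if i = c then 1 else 0) * (if i + 1 = b then 1 else 0) * (if i + 3 = a then 1 else 0) : ℤ))
      = cayleyCoeff a b c := by
  decide +kernel

/-- The polarised double product identity on basis vectors. Here and in `cayleyCoeff_star` the claim
ranges over `7⁴` index tuples and is decided by computation; multilinearity extends it to all
vectors. -/
theorem cayleyCoeff_polar : ∀ a x y w : Fin 7,
    ((∑ k, cayleyCoeff x y k * cayleyCoeff w a k) + ∑ k, cayleyCoeff a y k * cayleyCoeff w x k) =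
      - 2 * (if a = x then 1 else 0) * (if y = w then 1 else 0)
        + (if a = y then 1 else 0) * (if x = w then 1 else 0)
        + (if x = y then 1 else 0) * (if a = w then 1 else 0) := by
  decide +kernel

theorem cayleyCoeff_star : ∀ a b c d : Fin 7,
    (∑ i : Fin 7, listSign [i, i + 1, i + 3, a, b, c, d]) =
      (if a = c then 1 else 0) * (if b = d then 1 else 0)
        - (if a = d then 1 else 0) * (if b = c then 1 else 0)
        - ∑ k, cayleyCoeff a b k * cayleyCoeff c d k := by
  decide +kernel

end

noncomputable section

/-! ### From a Cayley basis to a cross product and to `*φ`. -/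

section CayleyAlgebra

variable {V : Type*} [AddCommGroup V] [Module ℝ V]

theorem update_three_zero {α : Type*} (x y z w : α) :
    Function.update ![x, y, z] 0 w = ![w, y, z] := by
  ext i
  fin_cases i <;> rfl

theorem update_three_one {α : Type*} (x y z w : α) :
    Function.update ![x, y, z] 1 w = ![x, w, z] := by
  ext i
  fin_cases i <;> rfl

theorem update_three_two {α : Type*} (x y z w : α) :
    Function.update ![x, y, z] 2 w = ![x, y, w] := by
  ext i
  fin_cases i <;> rfl

/-- The trilinear map of an alternating three-form. -/
def triForm (Φ : V [⋀^Fin 3]→ₗ[ℝ] ℝ) : V →ₗ[ℝ] V →ₗ[ℝ] V →ₗ[ℝ] ℝ :=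
  LinearMap.mk₂ ℝ (fun x y =>
      { toFun := fun z => Φ ![x, y, z]
        map_add' := fun z z' => by
          have h := Φ.map_update_add ![x, y, 0] 2 z z'
          simpa only [update_three_two] using h
        map_smul' := fun c z => by
          have h := Φ.map_update_smul ![x, y, 0] 2 c z
          simpa only [update_three_two, RingHom.id_apply] using h })
    (fun x x' y => LinearMap.ext fun z => by
      have h := Φ.map_update_add ![0, y, z] 0 x x'
      simp only [update_three_zero] at h
      exact h)
    (fun c x y => LinearMap.ext fun z => by
      have h := Φ.map_update_smul ![0, y, z] 0 c x
      simp only [update_three_zero] at h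
      exact h)
    (fun x y y' => LinearMap.ext fun z => by
      have h := Φ.map_update_add ![x, 0, z] 1 y y'
      simp only [update_three_one] at h
      exact h)
    (fun c x y => LinearMap.ext fun z => by
      have h := Φ.map_update_smul ![x, 0, z] 1 c y
      simp only [update_three_one] at h
      exact h)

theorem triForm_apply (Φ : V [⋀^Fin 3]→ₗ[ℝ] ℝ) (x y z : V) : triForm Φ x y z = Φ ![x, y, z] := rfl

theorem triForm_skew12 (Φ : V [⋀^Fin 3]→ₗ[ℝ] ℝ) (x y z : V) :
    triForm Φ x y z = - triForm Φ y x z := by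
  have h := Φ.map_swap ![y, x, z] (i := 0) (j := 1) (by decide)
  rw [triForm_apply, triForm_apply, ← h]
  congr 1
  ext i
  fin_cases i <;> rfl

theorem triForm_skew23 (Φ : V [⋀^Fin 3]→ₗ[ℝ] ℝ) (x y z : V) :
    triForm Φ x y z = - triForm Φ x z y := by
  have h := Φ.map_swap ![x, z, y] (i := 1) (j := 2) (by decide)
  rw [triForm_apply, triForm_apply, ← h]
  congr 1
  ext i
  fin_cases i <;> rfl

/-- The bilinear map `P` with `⟨P(x, y), z⟩ = Φ(x, y, z)`. -/
def crossMap (g : V →ₗ[ℝ] V →ₗ[ℝ] ℝ) (Φ : V [⋀^Fin 3]→ₗ[ℝ] ℝ) : V →ₗ[ℝ] V →ₗ[ℝ] V :=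
  LinearMap.mk₂ ℝ (fun x y => sharp 7 (fun x y => g x y) (triForm Φ x y))
    (fun x x' y => by simp [sharp, add_smul, Finset.sum_add_distrib])
    (fun c x y => by simp [sharp, mul_smul, Finset.smul_sum])
    (fun x y y' => by simp [sharp, add_smul, Finset.sum_add_distrib])
    (fun c x y => by simp [sharp, mul_smul, Finset.smul_sum])

theorem crossMap_apply {g : V →ₗ[ℝ] V →ₗ[ℝ] ℝ} (hg : IsScalarProduct 7 g)
    (Φ : V [⋀^Fin 3]→ₗ[ℝ] ℝ) (x y z : V) : g (crossMap g Φ x y) z = triForm Φ x y z :=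
  hg.sharp_apply (triForm Φ x y) z

variable {g : V →ₗ[ℝ] V →ₗ[ℝ] ℝ} (hg : IsScalarProduct 7 g) {Φ : V [⋀^Fin 3]→ₗ[ℝ] ℝ}
  {f : Fin 7 → V} (hf : IsCayleyFrame (fun x y => g x y) (fun v => Φ v) f)

include hf in
theorem triForm_frame (a b c : Fin 7) : triForm Φ (f a) (f b) (f c) = cayleyCoeff a b c := by
  have h1 : ∀ i j, g (f i) (f j) = if i = j then 1 else 0 := hf.1
  rw [triForm_apply]
  refine (hf.2 _).trans ?_
  rw [← cayleyCoeff_det]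
  push_cast
  refine Finset.sum_congr rfl fun i _ => ?_
  rw [Matrix.det_fin_three]
  simp [h1]

include hg hf in
theorem crossMap_frame (a b : Fin 7) : crossMap g Φ (f a) (f b) = ∑ k, (cayleyCoeff a b k : ℝ) • f k := by
  conv_lhs => rw [← hg.sum_smul hf.1 (crossMap g Φ (f a) (f b))]
  simp only [crossMap_apply hg, triForm_frame hf]

/-- The four-form of a vector cross product as a multilinear map. -/
def crossFourMultilinear (g : V →ₗ[ℝ] V →ₗ[ℝ] ℝ) (P : V →ₗ[ℝ] V →ₗ[ℝ] V) :
    MultilinearMap ℝ (fun _ : Fin 4 => V) ℝ where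
  toFun v := crossFourForm g P (v 0) (v 1) (v 2) (v 3)
  map_update_add' {inst} m i x y := by
    cases Subsingleton.elim inst (instDecidableEqFin 4)
    fin_cases i <;> simp [crossFourForm] <;> ring
  map_update_smul' {inst} m i c x := by
    cases Subsingleton.elim inst (instDecidableEqFin 4)
    fin_cases i <;> simp [crossFourForm] <;> ring

/-- The defect of the polarised double cross product identity. -/
def crossDefect (g : V →ₗ[ℝ] V →ₗ[ℝ] ℝ) (φ : V →ₗ[ℝ] V →ₗ[ℝ] V →ₗ[ℝ] ℝ)
    (P : V →ₗ[ℝ] V →ₗ[ℝ] V) : MultilinearMap ℝ (fun _ : Fin 4 => V) ℝ where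
  toFun v := φ (v 3) (v 0) (P (v 1) (v 2)) + φ (v 3) (v 1) (P (v 0) (v 2))
    - (- 2 * g (v 0) (v 1) * g (v 2) (v 3) + g (v 0) (v 2) * g (v 1) (v 3)
      + g (v 1) (v 2) * g (v 0) (v 3))
  map_update_add' {inst} m i x y := by
    cases Subsingleton.elim inst (instDecidableEqFin 4)
    fin_cases i <;> simp <;> ring
  map_update_smul' {inst} m i c x := by
    cases Subsingleton.elim inst (instDecidableEqFin 4)
    fin_cases i <;> simp <;> ring

include hg hf in
-- The defect of the polarised identity is multilinear and vanishes on the Cayley basis by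
-- `cayleyCoeff_polar`.
theorem isCrossProduct_of_cayleyFrame : IsCrossProduct g (triForm Φ) (crossMap g Φ) := by
  have hz : crossDefect g (triForm Φ) (crossMap g Φ) = 0 := by
    obtain ⟨b, hb⟩ := hg.exists_basis hf.1
    have h1 : ∀ i j, g (f i) (f j) = if i = j then 1 else 0 := hf.1
    refine Module.Basis.ext_multilinear (fun _ => b) fun v => ?_
    have h2 := congrArg (Int.cast : ℤ → ℝ) (cayleyCoeff_polar (v 0) (v 1) (v 2) (v 3))
    push_cast at h2
    simp only [crossDefect, MultilinearMap.coe_mk, hb, crossMap_frame hg hf, map_sum, map_smul,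
      triForm_frame hf, h1, smul_eq_mul, zero_apply, h2, sub_self]
  refine ⟨hg, triForm_skew12 Φ, triForm_skew23 Φ, crossMap_apply hg Φ, fun x y => ?_⟩
  refine hg.eq_of_forall fun w => ?_
  -- On the diagonal the polarised identity is twice the double product identity.
  have h1 := congrArg (fun F => F ![x, x, y, w]) hz
  simp only [crossDefect, MultilinearMap.coe_mk, zero_apply, Matrix.cons_val] at h1
  have h2 := triForm_skew12 Φ w x (crossMap g Φ x y)
  have h3 := triForm_skew23 Φ x w (crossMap g Φ x y)
  rw [crossMap_apply hg]
  simp only [map_sub, map_smul, LinearMap.sub_apply, LinearMap.smul_apply, smul_eq_mul]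
  linarith

/-- The Hodge star of a sum of monomials in an orthonormal frame. -/
theorem hodgeStar_sum_monomial {ι : Type*} [Fintype ι] {p q : ℕ} {e : Fin (p + q) → V}
    (he : IsOrthoFrame (fun x y => g x y) e) (t : ι → Fin p → Fin (p + q)) {α : CovTensor p V}
    (hα : ∀ v, α v = ∑ i, Matrix.det (Matrix.of fun a b => g (e (t i a)) (v b)))
    (v : Fin q → V) : hodgeStar p q (fun x y => g x y) e α v =
      ∑ i, frameVolume g e (Fin.append (fun k => e (t i k)) v) := by
  have h1 : ∀ i j, g (e i) (e j) = if i = j then 1 else 0 := he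
  rw [hodgeStar_eq]
  simp only [hα, h1, Finset.sum_mul]
  rw [Finset.sum_comm, Finset.mul_sum]
  refine Finset.sum_congr rfl fun i _ => ?_
  -- Each monomial is met once for every ordering of its indices, which cancels `1 / p!`.
  rw [sum_det_mul (t i) (fun s => frameVolume g e (Fin.append (fun k => e (s k)) v))]
  · rw [one_div, inv_mul_cancel_left₀ (by positivity)]
  · intro σ
    exact alternating_append_perm (frameVolume g e) (fun k => e (t i k)) v σ

/-- Insertion of three vectors into an alternating form. -/
def insertThree {q : ℕ} (A : V [⋀^Fin (q + 1 + 1 + 1)]→ₗ[ℝ] ℝ) (a b c : V) : V [⋀^Fin q]→ₗ[ℝ] ℝ :=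
  ((A.curryLeft a).curryLeft b).curryLeft c

theorem insertThree_apply {q : ℕ} (A : V [⋀^Fin (q + 1 + 1 + 1)]→ₗ[ℝ] ℝ) (a b c : V)
    (v : Fin q → V) : insertThree A a b c v =
      A (Matrix.vecCons a (Matrix.vecCons b (Matrix.vecCons c v))) := rfl

include hf in
theorem insertThree_frame (w : Fin 4 → Fin 7) (i : Fin 7) :
    insertThree (frameVolume (n := 4 + 1 + 1 + 1) g f) (f i) (f (i + 1)) (f (i + 3))
      (fun j => f (w j)) = listSign [i, i + 1, i + 3, w 0, w 1, w 2, w 3] := by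
  obtain ⟨u, hu⟩ : ∃ u : Fin 7 → Fin 7, u = Matrix.vecCons i (Matrix.vecCons (i + 1)
      (Matrix.vecCons (i + 3) w)) := ⟨_, rfl⟩
  have h4 := frameVolume_frame hf.1 u
  have h6 : [u 0, u 1, u 2, u 3, u 4, u 5, u 6] =
      [i, i + 1, i + 3, w 0, w 1, w 2, w 3] := by
    subst hu
    rfl
  rw [h6] at h4
  refine Eq.trans ?_ h4
  rw [insertThree_apply]
  refine frameVolume_congr g (show 4 + 1 + 1 + 1 = 7 from rfl) (fun k => rfl) fun k => ?_
  subst hu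
  fin_cases k <;> rfl

theorem append_eq_insertThree (f : Fin 7 → V) (v : Fin 4 → V) (i : Fin 7) :
    frameVolume (n := 3 + 4) g f
      (Fin.append (fun k => f (i + (![0, 1, 3] : Fin 3 → Fin 7) k)) v) =
    insertThree (frameVolume (n := 4 + 1 + 1 + 1) g f) (f i) (f (i + 1)) (f (i + 3)) v := by
  rw [insertThree_apply]
  refine frameVolume_congr g (show 3 + 4 = 4 + 1 + 1 + 1 from rfl) (fun k => rfl) fun k => ?_
  fin_cases k
  · exact congrArg f (add_zero i)
  all_goals rfl

include hf in
theorem sum_insertThree_frame (w : Fin 4 → Fin 7) :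
    ∑ i : Fin 7, insertThree (frameVolume (n := 4 + 1 + 1 + 1) g f) (f i) (f (i + 1)) (f (i + 3))
      (fun j => f (w j)) = (((if w 0 = w 2 then 1 else 0) * (if w 1 = w 3 then 1 else 0)
        - (if w 0 = w 3 then 1 else 0) * (if w 1 = w 2 then 1 else 0)
        - ∑ k, cayleyCoeff (w 0) (w 1) k * cayleyCoeff (w 2) (w 3) k : ℤ) : ℝ) := by
  rw [← cayleyCoeff_star, Int.cast_sum]
  exact Finset.sum_congr rfl fun i _ => insertThree_frame hf w i

include hg hf in
theorem crossFourForm_frame (w : Fin 4 → Fin 7) :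
    crossFourForm g (crossMap g Φ) (f (w 0)) (f (w 1)) (f (w 2)) (f (w 3)) =
      (((if w 0 = w 2 then 1 else 0) * (if w 1 = w 3 then 1 else 0)
        - (if w 0 = w 3 then 1 else 0) * (if w 1 = w 2 then 1 else 0)
        - ∑ k, cayleyCoeff (w 0) (w 1) k * cayleyCoeff (w 2) (w 3) k : ℤ) : ℝ) := by
  have h1 : ∀ i j, g (f i) (f j) = if i = j then 1 else 0 := hf.1
  push_cast
  simp only [crossFourForm, h1]
  congr 1
  rw [crossMap_frame hg hf, crossMap_frame hg hf]
  simp [map_sum, LinearMap.sum_apply, h1, mul_comm]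

/-- Both sides are multilinear in `v`, so agreement on a basis suffices; together with the frame
values this identifies `*φ` with the four-form of the cross product. -/
theorem sum_insertThree_ext {f : Fin 7 → V} (b : Module.Basis (Fin 7) ℝ V) (hb : ⇑b = f)
    (A : V [⋀^Fin (4 + 1 + 1 + 1)]→ₗ[ℝ] ℝ) (T : MultilinearMap ℝ (fun _ : Fin 4 => V) ℝ)
    (hA : ∀ w : Fin 4 → Fin 7, ∑ i : Fin 7, insertThree A (f i) (f (i + 1)) (f (i + 3))
      (fun j => f (w j)) = T fun j => f (w j)) (v : Fin 4 → V) :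
    ∑ i : Fin 7, insertThree A (f i) (f (i + 1)) (f (i + 3)) v = T v := by
  have h : (∑ i : Fin 7, ((insertThree A (f i) (f (i + 1)) (f (i + 3))).toMultilinearMap) :
      MultilinearMap ℝ (fun _ : Fin 4 => V) ℝ) = T := by
    refine Module.Basis.ext_multilinear (fun _ => b) fun w => ?_
    rw [hb, sum_apply]
    exact hA w
  have h5 := congrArg (fun F => F v) h
  simp only [sum_apply, AlternatingMap.coe_multilinearMap] at h5
  exact h5

include hg hf in
theorem sum_insertThree (v : Fin 4 → V) :
    ∑ i : Fin 7, insertThree (frameVolume (n := 4 + 1 + 1 + 1) g f) (f i) (f (i + 1)) (f (i + 3)) v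
      = crossFourForm g (crossMap g Φ) (v 0) (v 1) (v 2) (v 3) := by
  obtain ⟨b, hb⟩ := hg.exists_basis hf.1
  exact sum_insertThree_ext b hb (frameVolume (n := 4 + 1 + 1 + 1) g f)
    (crossFourMultilinear g (crossMap g Φ))
    (fun w => (sum_insertThree_frame hf w).trans (crossFourForm_frame hg hf w).symm) v

include hf in
theorem triForm_monomials (v : Fin 3 → V) : Φ v = ∑ i : Fin 7,
    Matrix.det (Matrix.of fun a b : Fin 3 =>
      g (f (i + (![0, 1, 3] : Fin 3 → Fin 7) a)) (v b)) := hf.2 v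

/-- The volume form enters only through a function `vol` with the same values, so that no
determinant is expanded. -/
theorem hodgeStar_three_four {t : Fin 7 → Fin 3 → Fin 7} {α : CovTensor 3 V}
    (he : IsOrthoFrame (fun x y => g x y) f)
    (hα : ∀ v, α v = ∑ i, Matrix.det (Matrix.of fun a b => g (f (t i a)) (v b)))
    {vol : (Fin (3 + 4) → V) → ℝ} (hvol : ∀ v, frameVolume (n := 3 + 4) g f v = vol v)
    (v : Fin 4 → V) : hodgeStar 3 4 (fun x y => g x y) f α v =
      ∑ i, vol (Fin.append (fun k => f (t i k)) v) := by
  simp only [← hvol]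
  exact hodgeStar_sum_monomial (p := 3) (q := 4) (e := f) he t hα v

include hg hf in
/-- The Hodge dual of the three-form of a vector cross product. -/
theorem hodgeStar_triForm (v : Fin 4 → V) :
    hodgeStar 3 4 (fun x y => g x y) f (fun v => Φ v) v =
      crossFourForm g (crossMap g Φ) (v 0) (v 1) (v 2) (v 3) := by
  obtain ⟨vol, hvol⟩ : ∃ vol : (Fin (3 + 4) → V) → ℝ,
    ∀ v, frameVolume (n := 3 + 4) g f v = vol v := ⟨_, fun _ => rfl⟩
  rw [hodgeStar_three_four hf.1 (α := fun v => Φ v) (triForm_monomials hf) hvol v]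
  refine (Finset.sum_congr rfl fun i _ => ?_).trans (sum_insertThree hg hf v)
  rw [← hvol]
  exact append_eq_insertThree f v i

end CayleyAlgebra
end

noncomputable section

/-! ### Contractions of `φ` and `*φ`, and the one-form `*(*dφ ∧ φ)`. -/

section Contractions

variable {V : Type*} [AddCommGroup V] [Module ℝ V]

theorem sum_fin_six_fun {ι R : Type*} [Fintype ι] [AddCommMonoid R] (f : (Fin 6 → ι) → R) :
    ∑ s, f s = ∑ i, ∑ j, ∑ k, ∑ l, ∑ m, ∑ n, f ![i, j, k, l, m, n] := by
  rw [sum_fin_succ_fun]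
  refine Finset.sum_congr rfl fun i _ => ?_
  rw [sum_fin_succ_fun]
  refine Finset.sum_congr rfl fun j _ => ?_
  rw [sum_fin_four_fun]
  rfl

/-- The value of an alternating form of degree seven on seven vectors. -/
def altSeven (A : V [⋀^Fin 7]→ₗ[ℝ] ℝ) (a b c d x y z : V) : ℝ := A ![a, b, c, d, x, y, z]

section AltSeven

variable (A : V [⋀^Fin 7]→ₗ[ℝ] ℝ) (a b c d x y z : V)

theorem altSeven_swap12 : altSeven A a b c d x y z = - altSeven A b a c d x y z := by
  rw [altSeven, altSeven, ← A.map_swap _ (i := 0) (j := 1) (by decide)]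
  congr 1
  funext i
  fin_cases i <;> rfl

theorem altSeven_swap23 : altSeven A a b c d x y z = - altSeven A a c b d x y z := by
  rw [altSeven, altSeven, ← A.map_swap _ (i := 1) (j := 2) (by decide)]
  congr 1
  funext i
  fin_cases i <;> rfl

theorem altSeven_swap34 : altSeven A a b c d x y z = - altSeven A a b d c x y z := by
  rw [altSeven, altSeven, ← A.map_swap _ (i := 2) (j := 3) (by decide)]
  congr 1
  funext i
  fin_cases i <;> rfl

theorem altSeven_swap45 : altSeven A a b c d x y z = - altSeven A a b c x d y z := by
  rw [altSeven, altSeven, ← A.map_swap _ (i := 3) (j := 4) (by decide)]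
  congr 1
  funext i
  fin_cases i <;> rfl

theorem altSeven_swap56 : altSeven A a b c d x y z = - altSeven A a b c d y x z := by
  rw [altSeven, altSeven, ← A.map_swap _ (i := 4) (j := 5) (by decide)]
  congr 1
  funext i
  fin_cases i <;> rfl

/-- Exchanging two blocks of three takes nine transpositions, an odd number. -/
theorem altSeven_swap_triples :
    altSeven A a b c d x y z = - altSeven A d x y a b c z := by
  rw [altSeven_swap34 A a b c d, altSeven_swap23 A a b d c, altSeven_swap12 A a d b c,
    altSeven_swap45 A d a b c, altSeven_swap34 A d a b x, altSeven_swap23 A d a x b,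
    altSeven_swap56 A d x a b, altSeven_swap45 A d x a b, altSeven_swap34 A d x a y]
  ring

/-- An alternating form of degree seven as a linear form in its first argument. -/
def altSevenLin : V →ₗ[ℝ] ℝ where
  toFun a := altSeven A a b c d x y z
  map_add' a a' := by
    simp only [altSeven]
    exact AlternatingMap.map_vecCons_add A a a' (m := ![b, c, d, x, y, z])
  map_smul' r a := by
    simp only [altSeven]
    exact AlternatingMap.map_vecCons_smul A (m := ![b, c, d, x, y, z]) r a

theorem altSevenLin_apply : altSevenLin A b c d x y z a = altSeven A a b c d x y z := rfl

end AltSeven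

theorem frameVolume_four_three (g : V →ₗ[ℝ] V →ₗ[ℝ] ℝ) (f : Fin 7 → V) (a b c d : V)
    (w : Fin 3 → V) : frameVolume (n := 4 + 3) g f (Fin.append ![a, b, c, d] w) =
      altSeven (frameVolume g f) a b c d (w 0) (w 1) (w 2) := by
  refine frameVolume_congr g (show 4 + 3 = 7 from rfl) (fun k => rfl) fun k => ?_
  fin_cases k <;> rfl

theorem frameVolume_three_four (g : V →ₗ[ℝ] V →ₗ[ℝ] ℝ) (f : Fin 7 → V) (a b c : V)
    (w : Fin 4 → V) : frameVolume (n := 3 + 4) g f (Fin.append ![a, b, c] w) =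
      altSeven (frameVolume g f) a b c (w 0) (w 1) (w 2) (w 3) := by
  refine frameVolume_congr g (show 3 + 4 = 7 from rfl) (fun k => rfl) fun k => ?_
  fin_cases k <;> rfl

theorem frameVolume_six_one (g : V →ₗ[ℝ] V →ₗ[ℝ] ℝ) (f : Fin 7 → V) (a b c d x y : V)
    (w : Fin 1 → V) :
    frameVolume (n := 3 + 3 + 1) g f (Fin.append (m := 3 + 3) ![a, b, c, d, x, y] w) =
      altSeven (frameVolume g f) a b c d x y (w 0) := by
  refine frameVolume_congr g (show 3 + 3 + 1 = 7 from rfl) (fun k => rfl) fun k => ?_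
  fin_cases k <;> rfl

theorem hodgeStar_eq_of_volume {p q : ℕ} (g : V →ₗ[ℝ] V →ₗ[ℝ] ℝ) (e : Fin (p + q) → V)
    {vol : (Fin (p + q) → V) → ℝ} (hvol : ∀ v, frameVolume g e v = vol v)
    (α : CovTensor p V) (v : Fin q → V) :
    hodgeStar p q (fun x y => g x y) e α v = (1 / (p.factorial : ℝ)) *
      ∑ s : Fin p → Fin (p + q), α (fun i => e (s i)) * vol (Fin.append (fun k => e (s k)) v) := by
  rw [hodgeStar_eq]
  simp only [hvol]

theorem comp_three {α β : Type*} (f : α → β) (i j k : α) :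
    (fun l => f ((![i, j, k] : Fin 3 → α) l)) = ![f i, f j, f k] := by
  funext l
  fin_cases l <;> rfl

theorem comp_four {α β : Type*} (f : α → β) (i j k l : α) :
    (fun m => f ((![i, j, k, l] : Fin 4 → α) m)) = ![f i, f j, f k, f l] := by
  funext m
  fin_cases m <;> rfl

theorem comp_six {α β : Type*} (f : α → β) (a b c d x y : α) :
    (fun m => f ((![a, b, c, d, x, y] : Fin 6 → α) m)) = ![f a, f b, f c, f d, f x, f y] := by
  funext m
  fin_cases m <;> rfl

theorem hodgeStar_three_four_eq_sum (g : V →ₗ[ℝ] V →ₗ[ℝ] ℝ) (f : Fin 7 → V)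
    {X : V → V → V → V → V → V → V → ℝ}
    (hX : ∀ a b c d x y z, altSeven (frameVolume g f) a b c d x y z = X a b c d x y z)
    (α : CovTensor 3 V) (w : Fin 4 → V) :
    hodgeStar 3 4 (fun x y => g x y) f α w = (1 / (Nat.factorial 3 : ℝ)) *
      ∑ i, ∑ j, ∑ k, α ![f i, f j, f k] * X (f i) (f j) (f k) (w 0) (w 1) (w 2) (w 3) := by
  obtain ⟨vol, hvol⟩ : ∃ vol : (Fin (3 + 4) → V) → ℝ,
    ∀ v, frameVolume (n := 3 + 4) g f v = vol v := ⟨_, fun _ => rfl⟩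
  have h1 : ∀ a b c, vol (Fin.append ![a, b, c] w) = X a b c (w 0) (w 1) (w 2) (w 3) := by
    intro a b c
    rw [← hvol, frameVolume_three_four, hX]
  refine (hodgeStar_eq_of_volume (p := 3) (q := 4) g f hvol α w).trans ?_
  simp only [sum_fin_three_fun, comp_three, h1]

theorem hodgeStar_four_three_eq_sum (g : V →ₗ[ℝ] V →ₗ[ℝ] ℝ) (f : Fin 7 → V)
    {X : V → V → V → V → V → V → V → ℝ}
    (hX : ∀ a b c d x y z, altSeven (frameVolume g f) a b c d x y z = X a b c d x y z)
    (α : CovTensor 4 V) (w : Fin 3 → V) :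
    hodgeStar 4 3 (fun x y => g x y) f α w = (1 / (Nat.factorial 4 : ℝ)) *
      ∑ i, ∑ j, ∑ k, ∑ l, α ![f i, f j, f k, f l] *
        X (f i) (f j) (f k) (f l) (w 0) (w 1) (w 2) := by
  obtain ⟨vol, hvol⟩ : ∃ vol : (Fin (4 + 3) → V) → ℝ,
    ∀ v, frameVolume (n := 4 + 3) g f v = vol v := ⟨_, fun _ => rfl⟩
  have h1 : ∀ a b c d, vol (Fin.append ![a, b, c, d] w) = X a b c d (w 0) (w 1) (w 2) := by
    intro a b c d
    rw [← hvol, frameVolume_four_three, hX]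
  refine (hodgeStar_eq_of_volume (p := 4) (q := 3) g f hvol α w).trans ?_
  simp only [sum_fin_four_fun, comp_four, h1]

/-- The Hodge star of a wedge product. -/
theorem hodgeStar_wedge {p p' q : ℕ} (g : V →ₗ[ℝ] V →ₗ[ℝ] ℝ) (e : Fin (p + p' + q) → V)
    (α : CovTensor p V) (β : CovTensor p' V)
    {vol : (Fin (p + p' + q) → V) → ℝ} (hvol : ∀ v, frameVolume g e v = vol v) (v : Fin q → V) :
    hodgeStar (p + p') q (fun x y => g x y) e (wedge α β) v =
      (1 / ((p.factorial : ℝ) * (p'.factorial : ℝ))) * ∑ s : Fin (p + p') → Fin (p + p' + q),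
        α (fun i => e (s (Fin.castAdd p' i))) * β (fun j => e (s (Fin.natAdd p j))) *
          vol (Fin.append (fun k => e (s k)) v) := by
  simp only [← hvol]
  rw [hodgeStar_eq]
  simp only [wedge]
  -- Reindexing by `σ` moves a second sign of `σ` out of the volume form, which cancels the first.
  -- All `(p + p')!` terms of the wedge product therefore contribute equally.
  have h1 : ∀ σ : Equiv.Perm (Fin (p + p')), (∑ s : Fin (p + p') → Fin (p + p' + q),
      ((Equiv.Perm.sign σ : ℤ) : ℝ) * (α (fun i => e (s (σ (Fin.castAdd p' i)))) *
        β (fun j => e (s (σ (Fin.natAdd p j))))) *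
          frameVolume g e (Fin.append (fun k => e (s k)) v)) =
      ∑ s : Fin (p + p') → Fin (p + p' + q),
        α (fun i => e (s (Fin.castAdd p' i))) * β (fun j => e (s (Fin.natAdd p j))) *
          frameVolume g e (Fin.append (fun k => e (s k)) v) := by
    intro σ
    refine Fintype.sum_equiv (Equiv.arrowCongr σ.symm (Equiv.refl _)) _ _ fun s => ?_
    have h2 := alternating_append_perm (frameVolume g e) (fun k => e (s k)) v σ
    have h3 : ∀ k, (Equiv.arrowCongr σ.symm (Equiv.refl (Fin (p + p' + q)))) s k = s (σ k) :=
      fun k => rfl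
    simp only [h3]
    have h4 : (fun k => e (s (σ k))) = (fun k => e (s k)) ∘ σ := rfl
    rw [h4, h2]
    ring
  simp only [mul_assoc, Finset.sum_mul, Finset.mul_sum] at h1 ⊢
  rw [Finset.sum_comm]
  have h5 : (((p + p').factorial : ℕ) : ℝ) ≠ 0 := by positivity
  have h6 : ∀ σ : Equiv.Perm (Fin (p + p')), (∑ s : Fin (p + p') → Fin (p + p' + q),
      (1 / ((p + p').factorial : ℝ)) * ((1 / ((p.factorial : ℝ) * (p'.factorial : ℝ))) *
      (((Equiv.Perm.sign σ : ℤ) : ℝ) * (α (fun i => e (s (σ (Fin.castAdd p' i)))) *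
        (β (fun j => e (s (σ (Fin.natAdd p j)))) *
          frameVolume g e (Fin.append (fun k => e (s k)) v)))))) =
      (1 / ((p + p').factorial : ℝ)) * ∑ s : Fin (p + p') → Fin (p + p' + q),
        (1 / ((p.factorial : ℝ) * (p'.factorial : ℝ))) *
        (α (fun i => e (s (Fin.castAdd p' i))) * (β (fun j => e (s (Fin.natAdd p j))) *
          frameVolume g e (Fin.append (fun k => e (s k)) v))) := by
    intro σ
    have h7 := h1 σ
    rw [← Finset.mul_sum] at h7
    rw [← Finset.mul_sum, ← Finset.mul_sum, ← Finset.mul_sum, h7, ← Finset.mul_sum]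
  rw [Finset.sum_congr rfl fun σ _ => h6 σ, Finset.sum_const, Finset.card_univ, Fintype.card_perm,
    Fintype.card_fin, nsmul_eq_mul, ← mul_assoc, mul_one_div_cancel h5, one_mul]

theorem hodgeStar_wedge_three_three (g : V →ₗ[ℝ] V →ₗ[ℝ] ℝ) (f : Fin 7 → V)
    {X : V → V → V → V → V → V → V → ℝ}
    (hX : ∀ a b c d x y z, altSeven (frameVolume g f) a b c d x y z = X a b c d x y z)
    (α β : CovTensor 3 V) (v : V) :
    hodgeStar 6 1 (fun x y => g x y) f (wedge α β) ![v] =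
      (1 / ((Nat.factorial 3 : ℝ) * (Nat.factorial 3 : ℝ))) *
      ∑ a, ∑ b, ∑ c, ∑ d, ∑ x, ∑ y, α ![f a, f b, f c] * β ![f d, f x, f y] *
        X (f a) (f b) (f c) (f d) (f x) (f y) v := by
  obtain ⟨vol, hvol⟩ : ∃ vol : (Fin (3 + 3 + 1) → V) → ℝ,
    ∀ v, frameVolume (n := 3 + 3 + 1) g f v = vol v := ⟨_, fun _ => rfl⟩
  have h1 : ∀ a b c d x y, vol (Fin.append (m := 3 + 3) ![a, b, c, d, x, y] ![v]) = X a b c d x y v := by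
    intro a b c d x y
    rw [← hvol, frameVolume_six_one, hX]
    rfl
  have h5 : hodgeStar 6 1 (fun x y => g x y) f (wedge α β) ![v] =
      (1 / ((Nat.factorial 3 : ℝ) * (Nat.factorial 3 : ℝ))) * ∑ s : Fin 6 → Fin 7,
        α (fun i : Fin 3 => f (s (Fin.castAdd 3 i))) * β (fun j : Fin 3 => f (s (Fin.natAdd 3 j))) *
          vol (Fin.append (m := 3 + 3) (fun k => f (s k)) ![v]) :=
    hodgeStar_wedge (p := 3) (p' := 3) (q := 1) g f α β hvol ![v]
  rw [h5, sum_fin_six_fun]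
  congr 1
  refine Finset.sum_congr rfl fun a _ => Finset.sum_congr rfl fun b _ => Finset.sum_congr rfl
    fun c _ => Finset.sum_congr rfl fun d _ => Finset.sum_congr rfl fun x _ =>
    Finset.sum_congr rfl fun y _ => ?_
  have h2 : (fun j : Fin 3 => f ((![a, b, c, d, x, y] : Fin 6 → Fin 7) (Fin.castAdd 3 j))) =
      ![f a, f b, f c] := by
    funext m
    fin_cases m <;> rfl
  have h3 : (fun j : Fin 3 => f ((![a, b, c, d, x, y] : Fin 6 → Fin 7) (Fin.natAdd 3 j))) =
      ![f d, f x, f y] := by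
    funext m
    fin_cases m <;> rfl
  rw [h2, h3, comp_six, h1]

namespace IsCrossProduct

variable {g : V →ₗ[ℝ] V →ₗ[ℝ] ℝ} {φ : V →ₗ[ℝ] V →ₗ[ℝ] V →ₗ[ℝ] ℝ} {P : V →ₗ[ℝ] V →ₗ[ℝ] V}
  (h : IsCrossProduct g φ P) {e : Fin 7 → V} (he : IsOrthoFrame (fun x y => g x y) e)
include h he

/-- The alternating four-form vanishes on `(a, e_k, b, e_k)`, so each summand is `⟨a, b⟩ - ⟨a,
e_k⟩⟨b, e_k⟩`, and `7 - 1 = 6`. -/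
theorem sum_cross_cross (a b : V) : ∑ k, g (P a (e k)) (P b (e k)) = 6 * g a b := by
  have he' : ∀ i, g (e i) (e i) = 1 := fun i => (he i i).trans (if_pos rfl)
  have h1 : ∀ k, g (P a (e k)) (P b (e k)) = g a b - g a (e k) * g b (e k) := by
    intro k
    have h2 : crossFourForm g P a (e k) b (e k) = 0 := by
      have h3 := h.fourForm_skew23 a (e k) b (e k)
      have h4 := h.fourForm_skew34 a b (e k) (e k)
      linarith
    rw [crossFourForm, he', h.symm (e k) b] at h2
    linarith
  simp only [h1, Finset.sum_sub_distrib, h.scalar.sum_mul_self he]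
  simp
  ring

theorem sum_form_form (a b : V) : ∑ j, ∑ k, φ a (e j) (e k) * φ b (e j) (e k) = 6 * g a b := by
  rw [← h.sum_cross_cross he]
  refine Finset.sum_congr rfl fun j _ => ?_
  simp only [← h.cross]
  exact h.scalar.sum_mul_self he _ _

/-- The two metric terms of the four-form contribute `φ a x w` each, the cross product term `-6 φ a
x w`. -/
theorem sum_fourForm_form (a x w : V) :
    ∑ k, ∑ l, crossFourForm g P a x (e k) (e l) * φ (e k) (e l) w = - 4 * φ a x w := by
  have h1 : ∀ k l, crossFourForm g P a x (e k) (e l) * φ (e k) (e l) w =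
      g a (e k) * (g x (e l) * φ w (e k) (e l)) - g x (e k) * (g a (e l) * φ w (e k) (e l))
        - φ (P a x) (e k) (e l) * φ w (e k) (e l) := by
    intro k l
    rw [crossFourForm, h.cross' (e k) (e l) (P a x), ← h.rot, ← h.rot w]
    ring
  simp only [h1, Finset.sum_sub_distrib, ← Finset.mul_sum, h.scalar.sum_mul he,
    h.sum_form_form he, h.cross]
  have h2 : ∀ x a, ∑ i, g a (e i) * φ w (e i) x = φ w a x := fun x a =>
    h.scalar.sum_mul he (LinearMap.flip (φ w) x) a
  rw [h2, h2, h.rot w a x, h.rot w x a, h.skew12 x a]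
  ring

/-- Expanding one factor, its metric terms repeat the argument `e_j` in the other factor and vanish.
The cross product term gives `4 ⟨P(a, e_j), P(b, e_j)⟩` by `sum_fourForm_form`, and `4 · 6 = 24`. -/
theorem sum_fourForm_fourForm (a b : V) : ∑ j, ∑ k, ∑ l,
    crossFourForm g P a (e j) (e k) (e l) * crossFourForm g P b (e j) (e k) (e l) =
      24 * g a b := by
  have h0 : ∀ x y z, crossFourForm g P x y z y = 0 := by
    intro x y z
    have h3 := h.fourForm_skew23 x y z y
    have h4 := h.fourForm_skew34 x z y y
    linarith
  have h0' : ∀ x y z, crossFourForm g P x y y z = 0 := by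
    intro x y z
    rw [h.fourForm_skew34, h0, neg_zero]
  have hl : ∀ j y w, ∑ l, g w (e l) * crossFourForm g P a (e j) y (e l) =
      crossFourForm g P a (e j) y w := fun j y w => by
    have h1 : ∀ t, crossFourForm g P a (e j) y t =
        (g a y • g (e j) - g (e j) y • g a - g (P a (e j)) ∘ₗ P y) t := by
      intro t
      simp only [crossFourForm, LinearMap.sub_apply, LinearMap.smul_apply, LinearMap.comp_apply,
        smul_eq_mul]
      ring
    simp only [h1]
    exact h.scalar.sum_mul he _ w
  have hk : ∀ j y w, ∑ k, g w (e k) * crossFourForm g P a (e j) (e k) y =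
      crossFourForm g P a (e j) w y := fun j y w => by
    simp only [h.fourForm_skew34 a (e j) _ y, mul_neg, Finset.sum_neg_distrib, hl]
  have h1 : ∀ j, ∑ k, ∑ l,
      crossFourForm g P a (e j) (e k) (e l) * crossFourForm g P b (e j) (e k) (e l) =
      4 * g (P a (e j)) (P b (e j)) := by
    intro j
    have h2 : ∀ k l,
        crossFourForm g P a (e j) (e k) (e l) * crossFourForm g P b (e j) (e k) (e l) =
        g b (e k) * (g (e j) (e l) * crossFourForm g P a (e j) (e k) (e l))
        - g (e j) (e k) * (g b (e l) * crossFourForm g P a (e j) (e k) (e l))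
        - crossFourForm g P a (e j) (e k) (e l) * φ (e k) (e l) (P b (e j)) := by
      intro k l
      have h3 : crossFourForm g P b (e j) (e k) (e l) = g b (e k) * g (e j) (e l)
          - g b (e l) * g (e j) (e k) - φ (e k) (e l) (P b (e j)) := by
        rw [crossFourForm, h.cross']
      rw [h3]
      ring
    simp only [h2, Finset.sum_sub_distrib, ← Finset.mul_sum, hl, hk, h0, h0',
      h.sum_fourForm_form he, h.cross]
    simp
  simp only [h1, ← Finset.mul_sum, h.sum_cross_cross he]
  ring

end IsCrossProduct

section CodifferentialAlgebra

variable {g : V →ₗ[ℝ] V →ₗ[ℝ] ℝ} (hg : IsScalarProduct 7 g) {Φ : V [⋀^Fin 3]→ₗ[ℝ] ℝ}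
  {f : Fin 7 → V} (hf : IsCayleyFrame (fun x y => g x y) (fun v => Φ v) f)
include hg hf

theorem sum_triForm_altSeven {X : V → V → V → V → V → V → V → ℝ}
    (hX : ∀ a b c d x y z, altSeven (frameVolume g f) a b c d x y z = X a b c d x y z)
    (a b c d : V) :
    ∑ i, ∑ j, ∑ k, triForm Φ (f i) (f j) (f k) * X (f i) (f j) (f k) a b c d =
        6 * crossFourForm g (crossMap g Φ) a b c d := by
  have h1 := hodgeStar_triForm hg hf ![a, b, c, d]
  rw [hodgeStar_three_four_eq_sum g f hX] at h1
  have h2 : crossFourForm g (crossMap g Φ) a b c d = (1 / (Nat.factorial 3 : ℝ)) *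
      ∑ i, ∑ j, ∑ k, triForm Φ (f i) (f j) (f k) * X (f i) (f j) (f k) a b c d := h1.symm
  have h3 : (Nat.factorial 3 : ℝ) = 6 := by norm_num [Nat.factorial]
  rw [h2, h3, ← mul_assoc]
  norm_num

/-- Here `D = 3 z ∧ φ`. Contracting `z` into the volume form and moving it past three arguments
gives `-6 *φ(z, ·)` for the first of the four terms; by skewness the others agree with it, and `3 ·
4 · (-6) / 4! = -3`. -/
theorem hodgeStar_wedge_vec {z : V} {D : CovTensor 4 V}
    (hD : ∀ v, D v = 3 * (g z (v 0) * triForm Φ (v 1) (v 2) (v 3)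
      - g z (v 1) * triForm Φ (v 0) (v 2) (v 3) + g z (v 2) * triForm Φ (v 0) (v 1) (v 3)
      - g z (v 3) * triForm Φ (v 0) (v 1) (v 2))) (w : Fin 3 → V) :
    hodgeStar 4 3 (fun x y => g x y) f D w =
      - 3 * crossFourForm g (crossMap g Φ) z (w 0) (w 1) (w 2) := by
  obtain ⟨X, hX⟩ : ∃ X : V → V → V → V → V → V → V → ℝ, ∀ a b c d x y z,
    altSeven (frameVolume g f) a b c d x y z = X a b c d x y z :=
    ⟨_, fun _ _ _ _ _ _ _ => rfl⟩
  have x1 : ∀ i j k l x y z, X i j k l x y z = - X j i k l x y z := fun i j k l x y z => by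
    rw [← hX, ← hX, altSeven_swap12]
  have x2 : ∀ i j k l x y z, X i j k l x y z = - X i k j l x y z := fun i j k l x y z => by
    rw [← hX, ← hX, altSeven_swap23]
  have x3 : ∀ i j k l x y z, X i j k l x y z = - X i j l k x y z := fun i j k l x y z => by
    rw [← hX, ← hX, altSeven_swap34]
  have x4 : ∀ b c d x y z, ∃ L : V →ₗ[ℝ] ℝ, ∀ a, L a = X a b c d x y z := fun b c d x y z =>
    ⟨altSevenLin (frameVolume g f) b c d x y z, fun a => by rw [altSevenLin_apply, hX]⟩
  have hs := sum_triForm_altSeven hg hf hX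
  rw [hodgeStar_four_three_eq_sum g f hX]
  clear hX
  have h3 : ∀ i j k l : V, D ![i, j, k, l] * X i j k l (w 0) (w 1) (w 2) =
      3 * (g z i * triForm Φ j k l * X i j k l (w 0) (w 1) (w 2))
      - 3 * (g z j * triForm Φ i k l * X i j k l (w 0) (w 1) (w 2))
      + 3 * (g z k * triForm Φ i j l * X i j k l (w 0) (w 1) (w 2))
      - 3 * (g z l * triForm Φ i j k * X i j k l (w 0) (w 1) (w 2)) := by
    intro i j k l
    rw [hD]
    simp only [Matrix.cons_val]
    ring
  have t0 : ∑ i, ∑ j, ∑ k, ∑ l, g z (f i) * triForm Φ (f j) (f k) (f l) *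
      X (f i) (f j) (f k) (f l) (w 0) (w 1) (w 2) =
      - (6 * crossFourForm g (crossMap g Φ) z (w 0) (w 1) (w 2)) := by
    rw [← hs]
    rw [Finset.sum_comm, ← Finset.sum_neg_distrib]
    refine Finset.sum_congr rfl fun j _ => ?_
    rw [Finset.sum_comm, ← Finset.sum_neg_distrib]
    refine Finset.sum_congr rfl fun k _ => ?_
    rw [Finset.sum_comm, ← Finset.sum_neg_distrib]
    refine Finset.sum_congr rfl fun l _ => ?_
    obtain ⟨L, hL⟩ := x4 (f j) (f k) (f l) (w 0) (w 1) (w 2)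
    have h4 : ∀ i, g z (f i) * triForm Φ (f j) (f k) (f l) *
        X (f i) (f j) (f k) (f l) (w 0) (w 1) (w 2) =
        triForm Φ (f j) (f k) (f l) * (g z (f i) * L (f i)) := by
      intro i
      rw [hL]
      ring
    simp only [h4, ← Finset.mul_sum]
    rw [hg.sum_mul hf.1, hL, x1 z, x2 _ z, x3 _ _ z]
    ring
  have t1 : ∑ i, ∑ j, ∑ k, ∑ l, g z (f j) * triForm Φ (f i) (f k) (f l) *
      X (f i) (f j) (f k) (f l) (w 0) (w 1) (w 2) =
      6 * crossFourForm g (crossMap g Φ) z (w 0) (w 1) (w 2) := by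
    rw [← neg_eq_iff_eq_neg.2 t0, Finset.sum_comm]
    simp only [← Finset.sum_neg_distrib]
    refine Finset.sum_congr rfl fun i _ => Finset.sum_congr rfl fun j _ =>
      Finset.sum_congr rfl fun k _ => Finset.sum_congr rfl fun l _ => ?_
    rw [x1 (f j) (f i)]
    ring
  have t2 : ∑ i, ∑ j, ∑ k, ∑ l, g z (f k) * triForm Φ (f i) (f j) (f l) *
      X (f i) (f j) (f k) (f l) (w 0) (w 1) (w 2) =
      - (6 * crossFourForm g (crossMap g Φ) z (w 0) (w 1) (w 2)) := by
    rw [← t1]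
    simp only [← Finset.sum_neg_distrib]
    refine Finset.sum_congr rfl fun i _ => ?_
    rw [Finset.sum_comm]
    refine Finset.sum_congr rfl fun j _ =>
      Finset.sum_congr rfl fun k _ => Finset.sum_congr rfl fun l _ => ?_
    rw [x2 (f i) (f k) (f j)]
    ring
  have t3 : ∑ i, ∑ j, ∑ k, ∑ l, g z (f l) * triForm Φ (f i) (f j) (f k) *
      X (f i) (f j) (f k) (f l) (w 0) (w 1) (w 2) =
      6 * crossFourForm g (crossMap g Φ) z (w 0) (w 1) (w 2) := by
    rw [← neg_eq_iff_eq_neg.2 t2]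
    simp only [← Finset.sum_neg_distrib]
    refine Finset.sum_congr rfl fun i _ => Finset.sum_congr rfl fun j _ => ?_
    rw [Finset.sum_comm]
    refine Finset.sum_congr rfl fun k _ => Finset.sum_congr rfl fun l _ => ?_
    rw [x3 (f i) (f j) (f l) (f k)]
    ring
  simp only [h3, Finset.sum_add_distrib, Finset.sum_sub_distrib, ← Finset.mul_sum, t3, t2, t1, t0]
  have h5 : (Nat.factorial 4 : ℝ) = 24 := by norm_num [Nat.factorial]
  rw [h5]
  ring

/-- The one-form `*(*(3 z ∧ φ) ∧ φ)` is `- 12 z`. -/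
theorem hodgeStar_wedge_hodgeStar {z : V} {D : CovTensor 4 V}
    (hD : ∀ v, D v = 3 * (g z (v 0) * triForm Φ (v 1) (v 2) (v 3)
      - g z (v 1) * triForm Φ (v 0) (v 2) (v 3) + g z (v 2) * triForm Φ (v 0) (v 1) (v 3)
      - g z (v 3) * triForm Φ (v 0) (v 1) (v 2))) (v : V) :
    hodgeStar 6 1 (fun x y => g x y) f
      (wedge (hodgeStar 4 3 (fun x y => g x y) f D) (fun v => Φ v)) ![v] = - 12 * g z v := by
  have hc := isCrossProduct_of_cayleyFrame hg hf
  obtain ⟨X, hX⟩ : ∃ X : V → V → V → V → V → V → V → ℝ, ∀ a b c d x y z,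
    altSeven (frameVolume g f) a b c d x y z = X a b c d x y z :=
    ⟨_, fun _ _ _ _ _ _ _ => rfl⟩
  have hs := sum_triForm_altSeven hg hf hX
  have x1 : ∀ i j k l x y z, X i j k l x y z = - X l x y i j k z := fun i j k l x y z => by
    rw [← hX, ← hX, altSeven_swap_triples]
  have h1 := hodgeStar_wedge_three_three g f hX (hodgeStar 4 3 (fun x y => g x y) f D)
    (fun v => Φ v) v
  refine h1.trans ?_
  clear hX
  have h2 : ∀ a b c d x y : V, hodgeStar 4 3 (fun x y => g x y) f D ![a, b, c] *
      Φ ![d, x, y] * X a b c d x y v = 3 * crossFourForm g (crossMap g Φ) z a b c *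
        (triForm Φ d x y * X d x y a b c v) := by
    intro a b c d x y
    rw [hodgeStar_wedge_vec hg hf hD, x1, triForm_apply]
    simp only [Matrix.cons_val]
    ring
  -- Moving `v` to the front past three arguments produces the sign; the total is then `-18 · 24 /
  -- (3! · 3!) = -12`.
  have h9 : ∀ a b c, 3 * crossFourForm g (crossMap g Φ) z (f a) (f b) (f c) *
      (6 * crossFourForm g (crossMap g Φ) (f a) (f b) (f c) v) =
      - 18 * (crossFourForm g (crossMap g Φ) z (f a) (f b) (f c) *
        crossFourForm g (crossMap g Φ) v (f a) (f b) (f c)) := by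
    intro a b c
    rw [hc.fourForm_skew34 (f a) (f b) (f c) v, hc.fourForm_skew23 (f a) (f b) v (f c),
      hc.fourForm_skew12 (f a) v]
    ring
  simp only [h2, ← Finset.mul_sum, hs, h9, hc.sum_fourForm_fourForm hf.1]
  have h5 : (Nat.factorial 3 : ℝ) = 6 := by norm_num [Nat.factorial]
  rw [h5]
  ring

end CodifferentialAlgebra

end Contractions
end

noncomputable section

/-! ### The module `𝒳₄` and the complement of `𝔤₂`. -/

section TypeX4

variable {V : Type*} [AddCommGroup V] [Module ℝ V]
  {g : V →ₗ[ℝ] V →ₗ[ℝ] ℝ} {Φ : V [⋀^Fin 3]→ₗ[ℝ] ℝ}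

theorem isCayleyFrame_cayleyFrame
    (hex : ∃ f, IsCayleyFrame (fun x y => g x y) (fun v => Φ v) f) :
    IsCayleyFrame (fun x y => g x y) (fun v => Φ v)
      (cayleyFrame (fun x y => g x y) (fun v => Φ v)) :=
  Classical.epsilon_spec hex

variable (hg : IsScalarProduct 7 g)
  (hex : ∃ f, IsCayleyFrame (fun x y => g x y) (fun v => Φ v) f)
include hg hex

theorem isCrossProduct_crossMap : IsCrossProduct g (triForm Φ) (crossMap g Φ) :=
  isCrossProduct_of_cayleyFrame hg (isCayleyFrame_cayleyFrame hex)

theorem starPhi_apply (v : Fin 4 → V) : starPhi (fun x y => g x y) (fun v => Φ v) v =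
    crossFourForm g (crossMap g Φ) (v 0) (v 1) (v 2) (v 3) :=
  hodgeStar_triForm hg (isCayleyFrame_cayleyFrame hex) v

theorem contractVec_starPhi (x : V) (w : Fin 3 → V) :
    contractVec x (starPhi (fun x y => g x y) (fun v => Φ v)) w =
      crossFourForm g (crossMap g Φ) x (w 0) (w 1) (w 2) := by
  rw [contractVec, starPhi_apply hg hex]
  rfl

theorem g2Star_wedge_g2Star {z : V} {D : CovTensor 4 V}
    (hD : ∀ v, D v = 3 * (g z (v 0) * triForm Φ (v 1) (v 2) (v 3)
      - g z (v 1) * triForm Φ (v 0) (v 2) (v 3) + g z (v 2) * triForm Φ (v 0) (v 1) (v 3)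
      - g z (v 3) * triForm Φ (v 0) (v 1) (v 2))) (v : V) :
    g2Star 6 1 rfl (fun x y => g x y) (fun v => Φ v)
      (wedge (g2Star 4 3 rfl (fun x y => g x y) (fun v => Φ v) D) (fun v => Φ v)) ![v] =
        - 12 * g z v :=
  hodgeStar_wedge_hodgeStar hg (isCayleyFrame_cayleyFrame hex) hD v

/-- The contraction `24 ⟨a, b⟩` divided by `3!`. This explains the factor `1/4` in `rBar`: for `α x
= A x ⌟ *φ` it yields `⟨A x, y⟩`. -/
theorem formInner_contractVec_starPhi (a b : V) :
    formInner 7 3 (fun x y => g x y) (contractVec a (starPhi (fun x y => g x y) (fun v => Φ v)))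
      (contractVec b (starPhi (fun x y => g x y) (fun v => Φ v))) = 4 * g a b := by
  have h := (isCrossProduct_crossMap hg hex).sum_fourForm_fourForm hg.isOrthoFrame_orthoFrame a b
  simp only [formInner, sum_fin_three_fun, contractVec_starPhi hg hex, Matrix.cons_val,
    h]
  norm_num [Nat.factorial]
  ring

omit hex in
-- `formInner` uses the chosen orthonormal frame but `𝔤₂` is described by the Cayley frame; frame
-- independence of traces, applied in each index, reconciles them.
theorem formInner_two_eq {e : Fin 7 → V} (he : IsOrthoFrame (fun x y => g x y) e)
    (b c : V →ₗ[ℝ] V →ₗ[ℝ] ℝ) :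
    formInner 7 2 (fun x y => g x y) (fun v => b (v 0) (v 1)) (fun v => c (v 0) (v 1)) =
      (1 / 2) * ∑ i, ∑ j, b (e i) (e j) * c (e i) (e j) := by
  have ho := hg.isOrthoFrame_orthoFrame
  have h1 : ∀ x, ∑ j, b x (orthoFrame 7 (fun x y => g x y) j) *
      c x (orthoFrame 7 (fun x y => g x y) j) = ∑ j, b x (e j) * c x (e j) := fun x =>
    hg.sum_bilin_eq ho he ((LinearMap.mul ℝ ℝ).compl₁₂ (b x) (c x))
  have h2 : ∀ j, ∑ i, b (orthoFrame 7 (fun x y => g x y) i) (e j) *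
      c (orthoFrame 7 (fun x y => g x y) i) (e j) = ∑ i, b (e i) (e j) * c (e i) (e j) := fun j =>
    hg.sum_bilin_eq ho he ((LinearMap.mul ℝ ℝ).compl₁₂ (b.flip (e j)) (c.flip (e j)))
  simp only [formInner, sum_fin_two_fun, Matrix.cons_val, h1]
  rw [Finset.sum_comm]
  simp only [h2]
  rw [Finset.sum_comm]
  norm_num [Nat.factorial]

/-- The complement of `𝔤₂` in `Λ²` consists of the two-forms `z ⌟ φ`. -/
theorem exists_vec_of_inG2Perp {c : V →ₗ[ℝ] V →ₗ[ℝ] ℝ}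
    (hc : InG2Perp (fun x y => g x y) (fun v => Φ v) c) : ∃ z, ∀ x y, c x y = triForm Φ z x y := by
  have hP := isCrossProduct_crossMap hg hex
  have hf := isCayleyFrame_cayleyFrame hex
  set f := cayleyFrame (fun x y => g x y) (fun v => Φ v) with hfdef
  have hcoef : ∀ i j k, triForm Φ (f i) (f j) (f k) = cayleyCoeff i j k := triForm_frame hf
  -- The contraction of `b` with `e_i ⌟ φ`; a two-form lies in `𝔤₂` iff it vanishes for all `i`.
  let ℓ : (V →ₗ[ℝ] V →ₗ[ℝ] ℝ) → Fin 7 → ℝ := fun b i =>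
    ∑ j, ∑ k, triForm Φ (f i) (f j) (f k) * b (f j) (f k)
  -- The definition of `𝔤₂` sums over the pairs with `φ = 1` only. The pairs with `φ = -1` are their
  -- reversals and contribute the same by skewness.
  have hone : ∀ b : V →ₗ[ℝ] V →ₗ[ℝ] ℝ, (∀ x y, b x y = - b y x) → ∀ i,
      2 * (∑ j : Fin 7, ∑ k : Fin 7, (open scoped Classical in
        if Φ ![f i, f j, f k] = 1 then b (f j) (f k) else 0)) = ℓ b i := by
    intro b hb i
    have h1 : ∀ j k, triForm Φ (f i) (f j) (f k) * b (f j) (f k) =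
        (open scoped Classical in if Φ ![f i, f j, f k] = 1 then b (f j) (f k) else 0)
        + (open scoped Classical in if Φ ![f i, f k, f j] = 1 then b (f k) (f j) else 0) := by
      intro j k
      have h2 := hP.skew23 (f i) (f j) (f k)
      have h3 : cayleyCoeff i j k = 1 ∨ cayleyCoeff i j k = -1 ∨ cayleyCoeff i j k = 0 := by
        unfold cayleyCoeff
        split_ifs <;> simp
      rw [← triForm_apply, ← triForm_apply]
      have h4 : triForm Φ (f i) (f k) (f j) = - triForm Φ (f i) (f j) (f k) := by linarith
      rw [h4, hb (f k), hcoef]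
      rcases h3 with h3 | h3 | h3 <;> rw [h3] <;> norm_num
    simp only [ℓ, h1, Finset.sum_add_distrib]
    rw [Finset.sum_comm (f := fun j k => (open scoped Classical in
      if Φ ![f i, f k, f j] = 1 then b (f k) (f j) else 0)), two_mul]
  -- By `sum_form_form`, `ℓ (z ⌟ φ) = 6 z`; the factor `1/6` makes `c - z ⌟ φ` an element of `𝔤₂`.
  let z : V := ∑ i, ((1 / 6) * ℓ c i) • f i
  have hz : ∀ i, g (f i) z = (1 / 6) * ℓ c i := by
    intro i
    have h1 : ∀ j, g (f i) (f j) = if i = j then 1 else 0 := fun j => hf.1 i j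
    simp [z, map_sum, h1]
  let b : V →ₗ[ℝ] V →ₗ[ℝ] ℝ := c - triForm Φ z
  have hb : ∀ x y, b x y = c x y - triForm Φ z x y := fun x y => rfl
  have hbs : ∀ x y, b x y = - b y x := by
    intro x y
    rw [hb, hb, hc.1 x y, hP.skew23 z x y]
    ring
  have hℓ : ∀ i, ℓ b i = 0 := by
    intro i
    have h1 := hP.sum_form_form hf.1 (f i) z
    simp only [ℓ, hb, mul_sub, Finset.sum_sub_distrib, h1]
    rw [hz]
    simp only [ℓ]
    ring
  have hmem : InG2Algebra (fun x y => g x y) (fun v => Φ v) b := by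
    refine ⟨hbs, fun i => ?_⟩
    have h1 := hone b hbs i
    rw [hℓ] at h1
    linarith
  -- Both `c` and `z ⌟ φ` are orthogonal to `b = c - z ⌟ φ`, so `b` has norm zero.
  have h0 := hc.2 b hmem
  rw [formInner_two_eq hg hf.1] at h0
  have h1 : ∑ i, ∑ j, triForm Φ z (f i) (f j) * b (f i) (f j) = 0 := by
    have h2 : ∀ i j, triForm Φ z (f i) (f j) * b (f i) (f j) =
        ∑ m, g z (f m) * (triForm Φ (f m) (f i) (f j) * b (f i) (f j)) := by
      intro i j
      have h3 : triForm Φ z (f i) (f j) = ∑ m, g z (f m) * triForm Φ (f m) (f i) (f j) :=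
        (hg.sum_mul hf.1 (((triForm Φ).flip (f i)).flip (f j)) z).symm
      rw [h3, Finset.sum_mul]
      exact Finset.sum_congr rfl fun m _ => by ring
    simp only [h2]
    rw [Finset.sum_congr rfl fun i _ => Finset.sum_comm, Finset.sum_comm]
    simp only [← Finset.mul_sum]
    exact Finset.sum_eq_zero fun m _ => by
      have := hℓ m
      simp only [ℓ] at this
      rw [this, mul_zero]
  have h2 : ∑ i, ∑ j, b (f i) (f j) * b (f i) (f j) = 0 := by
    have h3 : ∀ i j, b (f i) (f j) * b (f i) (f j) = c (f i) (f j) * b (f i) (f j)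
        - triForm Φ z (f i) (f j) * b (f i) (f j) := by
      intro i j
      rw [← sub_mul, ← hb]
    simp only [h3, Finset.sum_sub_distrib, h1]
    linarith
  have h3 : ∀ i j, b (f i) (f j) = 0 := by
    intro i j
    have h4 := (Finset.sum_eq_zero_iff_of_nonneg fun i _ =>
      Finset.sum_nonneg fun j _ => mul_self_nonneg (b (f i) (f j))).1 h2 i (Finset.mem_univ _)
    have h5 := (Finset.sum_eq_zero_iff_of_nonneg fun j _ =>
      mul_self_nonneg (b (f i) (f j))).1 h4 j (Finset.mem_univ _)
    exact mul_self_eq_zero.1 h5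
  obtain ⟨B, hB⟩ := hg.exists_basis hf.1
  have h4 : b = 0 := by
    refine B.ext fun i => B.ext fun j => ?_
    rw [hB]
    exact h3 i j
  refine ⟨z, fun x y => ?_⟩
  have h5 : b x y = 0 := by rw [h4]; rfl
  rw [hb] at h5
  linarith

/-- Elements of `𝒳₄` are of the form `x ↦ P(z, x) ⌟ *φ`. -/
theorem exists_vec_of_inX4 {α : V → CovTensor 3 V}
    (hα : InX4 (fun x y => g x y) (fun v => Φ v) α) : ∃ z, ∀ x w, α x w =
      crossFourForm g (crossMap g Φ) (crossMap g Φ z x) (w 0) (w 1) (w 2) := by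
  obtain ⟨⟨A, hA⟩, c, hc, hr⟩ := hα
  obtain ⟨z, hz⟩ := exists_vec_of_inG2Perp hg hex hc
  refine ⟨z, fun x w => ?_⟩
  have h1 : A x = crossMap g Φ z x := by
    refine hg.eq_of_forall fun y => ?_
    have h2 := hr x y
    rw [rBar, hA, formInner_contractVec_starPhi hg hex, hz] at h2
    rw [crossMap_apply hg]
    linarith
  rw [hA, contractVec_starPhi hg hex, h1]

end TypeX4
end

noncomputable section

/-! ### Complex volume forms in real dimension six. -/

section SU3Algebra

variable {W : Type*} [AddCommGroup W] [Module ℝ W]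

/-- `ψ` is the real part of a complex volume form on the six-dimensional Hermitian space
`(W, g, I)`, and `⟨Q(x, y), z⟩ = ψ(x, y, z)`. -/
structure IsSU3Form (g : W →ₗ[ℝ] W →ₗ[ℝ] ℝ) (I : W →ₗ[ℝ] W) (ψ : W →ₗ[ℝ] W →ₗ[ℝ] W →ₗ[ℝ] ℝ)
    (Q : W →ₗ[ℝ] W →ₗ[ℝ] W) : Prop where
  scalar : IsScalarProduct 6 g
  square : ∀ x, I (I x) = - x
  orthogonal : ∀ x y, g (I x) (I y) = g x y
  skew12 : ∀ x y z, ψ x y z = - ψ y x z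
  skew23 : ∀ x y z, ψ x y z = - ψ x z y
  complex12 : ∀ x y z, ψ (I x) y z = ψ x (I y) z
  cross : ∀ x y z, g (Q x y) z = ψ x y z
  cross_cross : ∀ a b c d, g (Q a b) (Q c d) = g a c * g b d - g a d * g b c
    - g a (I c) * g b (I d) + g a (I d) * g b (I c)

/-- The six-form-valued wedge `t♭ ∧ ω`, evaluated. -/
def wedgeKahler (g : W →ₗ[ℝ] W →ₗ[ℝ] ℝ) (I : W →ₗ[ℝ] W) (t x y z : W) : ℝ :=
  g t x * g y (I z) + g t y * g z (I x) + g t z * g x (I y)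

namespace IsSU3Form

variable {g : W →ₗ[ℝ] W →ₗ[ℝ] ℝ} {I : W →ₗ[ℝ] W} {ψ : W →ₗ[ℝ] W →ₗ[ℝ] W →ₗ[ℝ] ℝ}
  {Q : W →ₗ[ℝ] W →ₗ[ℝ] W} (h : IsSU3Form g I ψ Q)
include h

theorem symm (x y : W) : g x y = g y x := h.scalar.symm x y

theorem skew_complex (x y : W) : g (I x) y = - g x (I y) := by
  rw [← h.orthogonal x (I y), h.square, map_neg, neg_neg]

theorem kahler_skew (x y : W) : g x (I y) = - g y (I x) := by
  rw [h.symm x, h.skew_complex]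

theorem skew13 (x y z : W) : ψ x y z = - ψ z y x := by
  rw [h.skew12, h.skew23, h.skew12, neg_neg]

theorem rot (x y z : W) : ψ x y z = ψ y z x := by
  rw [h.skew12, h.skew23, neg_neg]

theorem complex23 (x y z : W) : ψ x (I y) z = ψ x y (I z) := by
  rw [h.rot, h.complex12, ← h.rot]

theorem complex13 (x y z : W) : ψ (I x) y z = ψ x y (I z) := by
  rw [h.complex12, h.complex23]

theorem cross' (x y z : W) : g z (Q x y) = ψ x y z := by rw [h.symm, h.cross]

theorem complex_cross (x y : W) : I (Q x y) = - Q (I x) y :=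
  h.scalar.eq_of_forall fun z => by
    rw [h.skew_complex, h.cross, map_neg, LinearMap.neg_apply, h.cross, h.complex13]

theorem cross_complex (x y : W) : Q x (I y) = Q (I x) y :=
  h.scalar.eq_of_forall fun z => by rw [h.cross, h.cross, h.complex12]

/-- Rotation of the phase of the complex volume form. -/
theorem rotate {c s : ℝ} (hcs : c ^ 2 + s ^ 2 = 1) :
    IsSU3Form g I (c • ψ + s • ψ ∘ₗ I) (c • Q + s • Q ∘ₗ I) where
  scalar := h.scalar
  square := h.square
  orthogonal := h.orthogonal
  skew12 x y z := by
    simp only [LinearMap.add_apply, LinearMap.smul_apply, LinearMap.comp_apply, smul_eq_mul]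
    rw [h.skew12 x y z, h.complex12 x y z, h.skew12 x (I y) z]
    ring
  skew23 x y z := by
    simp only [LinearMap.add_apply, LinearMap.smul_apply, LinearMap.comp_apply, smul_eq_mul]
    rw [h.skew23 x y z, h.skew23 (I x) y z]
    ring
  complex12 x y z := by
    simp only [LinearMap.add_apply, LinearMap.smul_apply, LinearMap.comp_apply, smul_eq_mul]
    rw [h.complex12 x y z, h.complex12 (I x) y z]
  cross x y z := by
    simp only [LinearMap.add_apply, LinearMap.smul_apply, LinearMap.comp_apply, smul_eq_mul,
      map_add, map_smul, h.cross]
  cross_cross a b x y := by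
    simp only [LinearMap.add_apply, LinearMap.smul_apply, LinearMap.comp_apply, smul_eq_mul,
      map_add, map_smul, h.cross_cross, h.orthogonal, h.square, map_neg, h.skew_complex]
    linear_combination (g a x * g b y - g a y * g b x - g a (I x) * g b (I y)
      + g a (I y) * g b (I x)) * hcs

/-- The action of the skew endomorphism `Q t` on `ψ`, computed from the three pairings given by
`cross_cross`. Its factor `-2` is the origin of the `-1/2` in the intrinsic torsion. -/
theorem wedgeKahler_cross (t x y z : W) :
    ψ (Q t x) y z + ψ x (Q t y) z + ψ x y (Q t z) = - 2 * wedgeKahler g I (I t) x y z := by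
  rw [h.rot (Q t x), h.skew12 x (Q t y), h.rot (Q t y), ← h.cross, ← h.cross, ← h.cross x y,
    h.cross_cross, h.cross_cross, h.cross_cross, wedgeKahler, h.skew_complex, h.skew_complex,
    h.skew_complex, h.symm y t, h.symm z t, h.symm x t, h.symm z y, h.symm z x, h.symm y x,
    h.kahler_skew y t, h.kahler_skew z t, h.kahler_skew x t, h.kahler_skew z x,
    h.kahler_skew z y, h.kahler_skew y x]
  ring

end IsSU3Form

end SU3Algebra

/-! ### Hyperplanes of Euclidean spaces and the alternation of `∇φ`. -/

section HypersurfaceAlgebra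

variable {V : Type*} [AddCommGroup V] [Module ℝ V]

namespace IsScalarProduct

variable {k : ℕ} {g : V →ₗ[ℝ] V →ₗ[ℝ] ℝ} (hg : IsScalarProduct k g)
include hg

theorem exists_cross (φ : V →ₗ[ℝ] V →ₗ[ℝ] V →ₗ[ℝ] ℝ) :
    ∃ P : V →ₗ[ℝ] V →ₗ[ℝ] V, ∀ x y z, g (P x y) z = φ x y z := by
  refine ⟨LinearMap.mk₂ ℝ (fun x y => sharp k (fun x y => g x y) (φ x y))
    (fun x x' y => by simp [sharp, add_smul, Finset.sum_add_distrib])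
    (fun c x y => by simp [sharp, mul_smul, Finset.smul_sum])
    (fun x y y' => by simp [sharp, add_smul, Finset.sum_add_distrib])
    (fun c x y => by simp [sharp, mul_smul, Finset.smul_sum]), fun x y z => ?_⟩
  exact hg.sharp_apply (φ x y) z

theorem exists_endomorphism (b : V →ₗ[ℝ] V →ₗ[ℝ] ℝ) :
    ∃ A : V →ₗ[ℝ] V, ∀ x y, g (A x) y = b x y := by
  refine ⟨{ toFun := fun x => sharp k (fun x y => g x y) (b x)
            map_add' := fun x y => by simp [sharp, add_smul, Finset.sum_add_distrib]
            map_smul' := fun c x => by simp [sharp, mul_smul, Finset.smul_sum] }, fun x y => ?_⟩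
  exact hg.sharp_apply (b x) y

variable {W : Type*} [AddCommGroup W] [Module ℝ W] {L : W →ₗ[ℝ] V} {n : V}
  (hL : Function.Injective L) (hn : g n n = 1) (hnL : ∀ x, g n (L x) = 0)
include hL hn hnL

/-- A vector is the sum of its tangential and normal parts. -/
theorem exists_tangent (hW : Module.finrank ℝ W + 1 = k) (v : V) : ∃ w, v = L w + g n v • n := by
  have := hg.finite
  let U : Submodule ℝ V := LinearMap.ker (g n)
  have hle : LinearMap.range L ≤ U := by
    rintro _ ⟨x, rfl⟩
    exact hnL x
  have hsurj : Function.Surjective (g n) := fun t => ⟨t • n, by simp [hn]⟩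
  have h1 : Module.finrank ℝ (LinearMap.range L) = Module.finrank ℝ W :=
    LinearMap.finrank_range_of_inj hL
  have h2 := LinearMap.finrank_range_add_finrank_ker (g n)
  rw [LinearMap.range_eq_top.2 hsurj, finrank_top, Module.finrank_self, hg.finrank] at h2
  have heq : LinearMap.range L = U := by
    refine Submodule.eq_of_le_of_finrank_eq hle ?_
    have : Module.finrank ℝ U = Module.finrank ℝ (LinearMap.ker (g n)) := rfl
    omega
  have hv : v - g n v • n ∈ U := by
    simp [U, LinearMap.mem_ker, map_sub, hn]
  rw [← heq] at hv
  obtain ⟨w, hw⟩ := hv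
  exact ⟨w, by rw [hw]; abel⟩

omit hn hnL in
theorem pullback : IsScalarProduct (Module.finrank ℝ W) (g.compl₁₂ L L) where
  symm x y := hg.symm _ _
  pos x hx := hg.pos _ fun h0 => hx (hL (by rw [h0, map_zero]))
  finite := by
    have := hg.finite
    exact Module.Finite.of_injective L hL
  finrank := rfl

end IsScalarProduct

/-- The restriction of a trilinear form along a linear map. -/
def restrictTri {W : Type*} [AddCommGroup W] [Module ℝ W] (L : W →ₗ[ℝ] V)
    (φ : V →ₗ[ℝ] V →ₗ[ℝ] V →ₗ[ℝ] ℝ) : W →ₗ[ℝ] W →ₗ[ℝ] W →ₗ[ℝ] ℝ :=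
  LinearMap.mk₂ ℝ (fun x y => φ (L x) (L y) ∘ₗ L)
    (fun x x' y => by ext; simp) (fun c x y => by ext; simp) (fun x y y' => by ext; simp)
    (fun c x y => by ext; simp)

theorem restrictTri_apply {W : Type*} [AddCommGroup W] [Module ℝ W] (L : W →ₗ[ℝ] V)
    (φ : V →ₗ[ℝ] V →ₗ[ℝ] V →ₗ[ℝ] ℝ) (x y z : W) :
    restrictTri L φ x y z = φ (L x) (L y) (L z) := rfl

namespace IsCrossProduct

variable {g : V →ₗ[ℝ] V →ₗ[ℝ] ℝ} {φ : V →ₗ[ℝ] V →ₗ[ℝ] V →ₗ[ℝ] ℝ} {P : V →ₗ[ℝ] V →ₗ[ℝ] V}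
  (h : IsCrossProduct g φ P)
include h

/-- The alternation of the covariant derivative `v ↦ P(z, v) ⌟ *φ` is `3 z ∧ φ`. -/
theorem alternate_fourForm (z a b c d : V) :
    crossFourForm g P (P z a) b c d - crossFourForm g P (P z b) a c d
      + crossFourForm g P (P z c) a b d - crossFourForm g P (P z d) a b c =
    3 * (g z a * φ b c d - g z b * φ a c d + g z c * φ a b d - g z d * φ a b c) := by
  simp only [h.fourForm_cross, h.symm b a, h.symm c a, h.symm d a, h.symm c b, h.symm d b,
    h.symm d c, ← h.rot z a b, ← h.rot z a c, ← h.rot z b c, h.skew12 a z, h.skew12 b z,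
    h.skew12 c b d, h.skew12 d b c, ← h.rot a b c, h.skew12 b a d, h.skew23 a c b,
    h.skew23 a d c, h.skew23 b d c]
  ring

end IsCrossProduct

end HypersurfaceAlgebra
end

noncomputable section

/-! ### The structure on a hyperplane of a space with cross product. -/

section Hyperplane

variable {V W : Type*} [AddCommGroup V] [Module ℝ V] [AddCommGroup W] [Module ℝ W]

/-- `L` is an injection of the six-dimensional space `W` onto the hyperplane orthogonal to the unit
vector `n` of a seven-dimensional space with a cross product; `I` is the induced complex structure
and `Q` the tangential part of the cross product. -/
structure IsHyperplane (g : V →ₗ[ℝ] V →ₗ[ℝ] ℝ) (φ : V →ₗ[ℝ] V →ₗ[ℝ] V →ₗ[ℝ] ℝ)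
    (P : V →ₗ[ℝ] V →ₗ[ℝ] V) (L : W →ₗ[ℝ] V) (n : V) (I : W →ₗ[ℝ] W)
    (Q : W →ₗ[ℝ] W →ₗ[ℝ] W) : Prop where
  cross : IsCrossProduct g φ P
  injective : Function.Injective L
  finrank : Module.finrank ℝ W = 6
  unit : g n n = 1
  normal : ∀ x, g n (L x) = 0
  complex : ∀ x, L (I x) = P n (L x)
  tangent : ∀ x y, P (L x) (L y) = L (Q x y) - g (L x) (L (I y)) • n

variable {g : V →ₗ[ℝ] V →ₗ[ℝ] ℝ} {φ : V →ₗ[ℝ] V →ₗ[ℝ] V →ₗ[ℝ] ℝ} {P : V →ₗ[ℝ] V →ₗ[ℝ] V}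
  {L : W →ₗ[ℝ] V} {n : V}

/-- `I` and `Q` are obtained by dualising the restrictions of `n ⌟ φ` and `φ`. `P(n, ·)` has no
normal part, while the normal part of `P(x, y)` is `φ(x, y, n) n`, minus the Kähler form times `n`.
-/
theorem IsCrossProduct.exists_isHyperplane (h : IsCrossProduct g φ P)
    (hL : Function.Injective L) (hW : Module.finrank ℝ W = 6) (hn : g n n = 1)
    (hnL : ∀ x, g n (L x) = 0) : ∃ I Q, IsHyperplane g φ P L n I Q := by
  have hdec := h.scalar.exists_tangent hL hn hnL (by rw [hW])
  have hs : IsScalarProduct 6 (g.compl₁₂ L L) := by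
    have := h.scalar.pullback hL
    rwa [hW] at this
  obtain ⟨I, hI⟩ := hs.exists_endomorphism ((φ n).compl₁₂ L L)
  obtain ⟨Q, hQ⟩ := hs.exists_cross (restrictTri L φ)
  simp only [LinearMap.compl₁₂_apply, restrictTri_apply] at hI hQ
  have hI' : ∀ x, L (I x) = P n (L x) := fun x => by
    refine h.scalar.eq_of_forall fun v => ?_
    obtain ⟨w, hw⟩ := hdec v
    rw [hw, map_add, map_add, map_smul, map_smul, hI, h.cross, h.cross, h.self13, h.symm _ n, hnL]
  refine ⟨I, Q, h, hL, hW, hn, hnL, hI', fun x y => ?_⟩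
  refine h.scalar.eq_of_forall fun v => ?_
  obtain ⟨w, hw⟩ := hdec v
  have h1 : g (L x) (L (I y)) = - φ (L x) (L y) n := by
    rw [hI', h.cross', h.skew13, h.skew12, h.skew23 (L y)]
  generalize g n v = t at hw
  rw [hw, h1]
  simp only [map_add, map_smul, h.cross, map_sub, LinearMap.sub_apply, LinearMap.smul_apply, hQ,
    hnL, hn, smul_eq_mul, h.symm (L (Q x y)) n]
  ring

namespace IsHyperplane

variable {I : W →ₗ[ℝ] W} {Q : W →ₗ[ℝ] W →ₗ[ℝ] W} (h : IsHyperplane g φ P L n I Q)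
include h

theorem scalar : IsScalarProduct 6 (g.compl₁₂ L L) := by
  have := h.cross.scalar.pullback h.injective
  rwa [h.finrank] at this

theorem normal' (x : W) : g (L x) n = 0 := by rw [h.cross.symm, h.normal]

theorem form_normal (x y : W) : φ n (L x) (L y) = - g (L x) (L (I y)) := by
  rw [h.complex, h.cross.cross', h.cross.skew23]

theorem square (x : W) : I (I x) = - x := h.injective <| by
  rw [h.complex, h.complex, h.cross.double, h.normal, h.unit, map_neg, zero_smul, one_smul,
    zero_sub]

theorem orthogonal (x y : W) : g (L (I x)) (L (I y)) = g (L x) (L y) := by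
  rw [h.complex x, h.cross.cross, h.form_normal, h.square, map_neg, map_neg, neg_neg]

theorem kahler_skew (x y : W) : g (L x) (L (I y)) = - g (L y) (L (I x)) := by
  rw [← h.orthogonal, h.square, map_neg, map_neg, h.cross.symm]

theorem cross_tangent (x y z : W) : g (L (Q x y)) (L z) = φ (L x) (L y) (L z) := by
  have h1 := h.cross.cross (L x) (L y) (L z)
  rw [h.tangent] at h1
  simpa [h.normal] using h1

/-- `I x` is the cross product of `n` and `x`, so `fourForm_cross` applies, and every form with the
argument `n` becomes the Kähler form. -/
theorem fourForm_complex (x a b c : W) : crossFourForm g P (L (I x)) (L a) (L b) (L c) =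
    - (g (L x) (L a) * g (L b) (L (I c)) + g (L x) (L b) * g (L c) (L (I a))
      + g (L x) (L c) * g (L a) (L (I b))) := by
  rw [h.complex, h.cross.fourForm_cross, h.normal, h.normal, h.normal, h.cross.skew12 (L a) n,
    ← h.cross.rot n, h.form_normal, h.form_normal, h.form_normal, h.kahler_skew a c]
  ring

/-- `fourForm_complex` at `-I x`. The outcome is `-(1/2) ω ∧ ω`, the restriction of `*φ` to the
hyperplane. -/
theorem fourForm_tangent (x a b c : W) : crossFourForm g P (L x) (L a) (L b) (L c) =
    g (L x) (L (I b)) * g (L a) (L (I c)) - g (L x) (L (I a)) * g (L b) (L (I c))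
      - g (L x) (L (I c)) * g (L a) (L (I b)) := by
  have h1 := h.fourForm_complex (- I x) a b c
  rw [map_neg, h.square, neg_neg] at h1
  rw [h1, map_neg, map_neg, LinearMap.neg_apply, LinearMap.neg_apply, LinearMap.neg_apply,
    h.cross.symm (L (I x)), h.cross.symm (L (I x)), h.cross.symm (L (I x)), h.kahler_skew a x,
    h.kahler_skew b x, h.kahler_skew c x, h.kahler_skew c a]
  ring

/-- Complex bilinearity of the restricted `φ` comes from polarising with `n`. The formula for `⟨Q(a,
b), Q(c, d)⟩` comes from comparing the definition of the four-form with its value in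
`fourForm_tangent`. -/
theorem isSU3Form : IsSU3Form (g.compl₁₂ L L) I (restrictTri L φ) Q where
  scalar := h.scalar
  square := h.square
  orthogonal := h.orthogonal
  skew12 x y z := h.cross.skew12 _ _ _
  skew23 x y z := h.cross.skew23 _ _ _
  complex12 x y z := by
    rw [restrictTri_apply, restrictTri_apply, h.complex, h.complex]
    have h1 := h.cross.polar (L y) n (L x) (L z)
    have h2 := h.cross.polar (L x) n (L y) (L z)
    simp only [h.normal, h.normal', h.cross.cross_skew (L y) (L x), map_neg,
      LinearMap.neg_apply] at h1 h2
    linarith [h.cross.skew12 (L y) (P n (L x)) (L z)]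
  cross x y z := h.cross_tangent x y z
  cross_cross a b c d := by
    simp only [LinearMap.compl₁₂_apply]
    have h1 := h.fourForm_tangent a b c d
    rw [crossFourForm, h.tangent, h.tangent] at h1
    simp only [map_sub, map_smul, LinearMap.sub_apply, LinearMap.smul_apply, h.normal, h.normal',
      h.unit, smul_eq_mul] at h1
    linarith

omit h in
theorem fourForm_sub_smul (p q a b c : V) (t : ℝ) : crossFourForm g P (p - t • q) a b c =
    crossFourForm g P p a b c - t * crossFourForm g P q a b c := by
  simp only [crossFourForm, map_sub, map_smul, LinearMap.sub_apply, LinearMap.smul_apply,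
    smul_eq_mul]
  ring

theorem fourForm_normal (a b c : W) : crossFourForm g P n (L a) (L b) (L c) =
    - φ (L (I a)) (L b) (L c) := by
  rw [crossFourForm, h.normal, h.normal, ← h.complex, h.cross.cross', ← h.cross.rot]
  ring

theorem fourForm_normal' (a b c : W) : crossFourForm g P (L a) n (L b) (L c) =
    φ (L (I a)) (L b) (L c) := by
  rw [h.cross.fourForm_skew12, h.fourForm_normal, neg_neg]

theorem form_cross (t x y w : W) : φ (L t) (L x) (L (Q y w)) =
    g (L t) (L y) * g (L x) (L w) - g (L t) (L w) * g (L x) (L y)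
      - g (L t) (L (I y)) * g (L x) (L (I w)) + g (L t) (L (I w)) * g (L x) (L (I y)) := by
  rw [← h.cross_tangent]
  exact h.isSU3Form.cross_cross t x y w

/-- The derivative of the Kähler form. -/
theorem kahler_derivative (z v s x y : W) :
    - crossFourForm g P (P (L z) (L v)) n (L x) (L y) + φ (L s) (L x) (L y) =
      restrictTri L φ (s - I (Q z v)) x y := by
  have h1 : crossFourForm g P n n (L x) (L y) = 0 := by
    linarith [h.cross.fourForm_skew12 n n (L x) (L y)]
  -- For tangent `z`, `P(z, v) = Q(z, v) - ω(z, v) n`; the normal part drops out because the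
  -- four-form already contains `n`.
  rw [h.tangent, fourForm_sub_smul, h1, h.fourForm_normal', restrictTri_apply, map_sub, map_sub,
    LinearMap.sub_apply, LinearMap.sub_apply]
  ring

/-- The derivative of the restriction of `φ`. -/
theorem form_derivative (z v s x y w : W) :
    crossFourForm g P (P (L z) (L v)) (L x) (L y) (L w) + g (L s) (L x) * φ n (L y) (L w)
      + g (L s) (L y) * φ (L x) n (L w) + g (L s) (L w) * φ (L x) (L y) n =
    g (L z) (L (I v)) * restrictTri L φ (I x) y w
      - wedgeKahler (g.compl₁₂ L L) I (s - I (Q z v)) x y w := by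
  -- The tangential part of `P(z, v)` and the terms in `s` produce the `♭ ∧ ω` terms; the normal
  -- part survives through `n ⌟ *φ` and produces the term with `φ(I ·, ·, ·)`.
  have h1 := h.fourForm_complex (- I (Q z v)) x y w
  simp only [map_neg, h.square, neg_neg, LinearMap.neg_apply] at h1
  rw [h.tangent, fourForm_sub_smul, h1, h.fourForm_normal, restrictTri_apply, wedgeKahler,
    h.cross.skew12 (L x) n, ← h.cross.rot n, h.form_normal, h.form_normal, h.form_normal]
  simp only [LinearMap.compl₁₂_apply, map_sub, LinearMap.sub_apply, h.kahler_skew w x]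
  ring

/-- The derivative of the restriction of `n ⌟ *φ`. -/
theorem form_derivative' (z v s x y w : W) :
    - (crossFourForm g P (P (L z) (L v)) (P n (L x)) (L y) (L w)
      + crossFourForm g P (P (L z) (L v)) n (L x) (P (L y) (L w)) - φ (L s) (L x) (P (L y) (L w))
      + g (L s) (L y) * φ (P n (L x)) n (L w) + g (L s) (L w) * φ (P n (L x)) (L y) n) =
    g (L z) (L (I v)) * restrictTri L φ x y w
      - wedgeKahler (g.compl₁₂ L L) I (I (s - I (Q z v))) x y w := by
  have h1 := h.fourForm_complex (- I (Q z v)) (I x) y w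
  -- `P(y, w)` is not tangent. Its normal part disappears here, where `n` is already an argument,
  -- but not from `φ(s, x, P(y, w))`, where `h6` records it.
  have h2 : crossFourForm g P (P (L z) (L v)) n (L x) (P (L y) (L w)) =
      φ (L (I (Q z v))) (L x) (L (Q y w)) := by
    have h3 : crossFourForm g P n n (L x) (P (L y) (L w)) = 0 := by
      linarith [h.cross.fourForm_skew12 n n (L x) (P (L y) (L w))]
    have h4 : crossFourForm g P (L (Q z v)) n (L x) n = 0 := by
      linarith [h.cross.fourForm_skew34 (L (Q z v)) n (L x) n,
        h.cross.fourForm_skew23 (L (Q z v)) n n (L x)]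
    have h5 : crossFourForm g P (L (Q z v)) n (L x) (P (L y) (L w)) =
        crossFourForm g P (L (Q z v)) n (L x) (L (Q y w)) := by
      rw [crossFourForm, crossFourForm] at *
      rw [h.tangent y w]
      simp only [map_sub, map_smul, smul_eq_mul]
      linear_combination - g (L y) (L (I w)) * h4
    rw [h.tangent z v, fourForm_sub_smul, h3, h5, h.fourForm_normal']
    ring
  have h6 : φ (L s) (L x) (P (L y) (L w)) = φ (L s) (L x) (L (Q y w))
      + g (L y) (L (I w)) * g (L s) (L (I x)) := by
    rw [h.tangent y w, map_sub, map_smul, ← h.cross.rot n, h.form_normal]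
    simp
  rw [h2, h6, ← h.complex, h.tangent z v, fourForm_sub_smul, h.fourForm_normal, h.square,
    restrictTri_apply, wedgeKahler, h.cross.skew12 (L (I x)) n, ← h.cross.rot n, h.form_normal,
    h.form_normal, h.form_cross, h.form_cross]
  simp only [map_neg, h.square, neg_neg, LinearMap.neg_apply, h.orthogonal] at h1
  rw [h1]
  have h7 : ∀ a b, g (L (I a)) (L b) = - g (L a) (L (I b)) := fun a b => by
    rw [h.cross.symm, h.kahler_skew]
  simp only [LinearMap.compl₁₂_apply, map_sub, map_neg, LinearMap.sub_apply, h.square, h7,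
    h.kahler_skew w x, h.cross.symm (L w) (L x), neg_neg, LinearMap.neg_apply]
  ring

end IsHyperplane
end Hyperplane
end

noncomputable section

/-! ### `T* ⊗ 𝔲(3)^⊥` as a space of endomorphisms. -/

section SU3Torsion

variable {W : Type*} [AddCommGroup W] [Module ℝ W]

namespace IsSU3Form

variable {g : W →ₗ[ℝ] W →ₗ[ℝ] ℝ} {I : W →ₗ[ℝ] W} {ψ : W →ₗ[ℝ] W →ₗ[ℝ] W →ₗ[ℝ] ℝ}
  {Q : W →ₗ[ℝ] W →ₗ[ℝ] W} (h : IsSU3Form g I ψ Q)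
include h

theorem kahler_self (x : W) : g x (I x) = 0 := by linarith [h.kahler_skew x x]


variable {e : Fin 6 → W} (he : IsOrthoFrame (fun x y => g x y) e)
include he

/-- The inner sum is `⟨Q(y, e_i), Q(t, e_i)⟩`. Of the six directions `e_i`, those along `y` and `I
y` are lost, so the constant is `6 - 1 - 1`. -/
theorem sum_form_form (y t : W) : ∑ i, ∑ j, ψ y (e i) (e j) * ψ t (e i) (e j) = 4 * g y t := by
  have h1 : ∀ i, ∑ j, ψ y (e i) (e j) * ψ t (e i) (e j) =
      g y t - g y (e i) * g t (e i) - g (I y) (e i) * g (I t) (e i) := by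
    intro i
    have h2 := h.scalar.sum_mul_self he (Q y (e i)) (Q t (e i))
    simp only [h.cross] at h2
    have h3 : g (e i) (e i) = 1 := by simpa using he i i
    rw [h2, ← h.cross y (e i) (Q t (e i)), h.cross_cross, h.kahler_self, h3, h.symm (e i) t, h.kahler_skew (e i) t,
      h.skew_complex, h.skew_complex]
    ring
  simp only [h1, Finset.sum_sub_distrib, h.scalar.sum_mul_self he, h.orthogonal,
    Finset.sum_const, Finset.card_univ, Fintype.card_fin, nsmul_eq_mul]
  push_cast
  ring

theorem sum_sum_mul (β : W →ₗ[ℝ] W →ₗ[ℝ] ℝ) (u v : W) :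
    ∑ i, ∑ j, β (e i) (e j) * (g u (e i) * g v (e j)) = β u v := by
  have h1 : ∀ i, ∑ j, β (e i) (e j) * (g u (e i) * g v (e j)) = g u (e i) * β (e i) v := by
    intro i
    rw [← h.scalar.sum_mul he (β (e i)) v, Finset.mul_sum]
    exact Finset.sum_congr rfl fun j _ => by ring
  simp only [h1]
  exact h.scalar.sum_mul he (β.flip v) u

/-- A two-form of type `(2, 0) + (0, 2)` is of the form `t ⌟ ψ`. -/
theorem form_sum_smul_cross {β : W →ₗ[ℝ] W →ₗ[ℝ] ℝ} (hskew : ∀ x y, β x y = - β y x)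
    (hI : ∀ x y, β x y = - β (I x) (I y)) (u v : W) :
    ψ ((1 / 4 : ℝ) • ∑ i, ∑ j, β (e i) (e j) • Q (e i) (e j)) u v = β u v := by
  have h1 : ∀ i j, β (e i) (e j) * ψ (Q (e i) (e j)) u v =
      β (e i) (e j) * (g u (e i) * g v (e j)) - β (e i) (e j) * (g v (e i) * g u (e j))
      - β (e i) (e j) * (g (I u) (e i) * g (I v) (e j))
      + β (e i) (e j) * (g (I v) (e i) * g (I u) (e j)) := by
    intro i j
    rw [h.rot, ← h.cross u v, h.cross_cross, h.skew_complex, h.skew_complex, h.skew_complex,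
      h.skew_complex, h.kahler_skew u, h.kahler_skew v, h.kahler_skew u, h.kahler_skew v]
    ring
  simp only [map_smul, map_sum, LinearMap.smul_apply, LinearMap.sum_apply, smul_eq_mul, h1,
    Finset.sum_add_distrib, Finset.sum_sub_distrib, h.sum_sum_mul he]
  -- Skewness and the behaviour under `I` make the four contractions equal to `β u v`, whence the
  -- factor `1/4`.
  rw [← neg_eq_iff_eq_neg.2 (hI u v), ← neg_eq_iff_eq_neg.2 (hI v u), hskew v u]
  ring

omit he in
theorem exists_form_eq {β : W →ₗ[ℝ] W →ₗ[ℝ] ℝ} (hskew : ∀ x y, β x y = - β y x)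
    (hI : ∀ x y, β x y = - β (I x) (I y)) : ∃ t, ∀ x y, β x y = ψ t x y :=
  ⟨_, fun x y => (h.form_sum_smul_cross h.scalar.isOrthoFrame_orthoFrame hskew hI x y).symm⟩

omit he in
theorem form_injective {s t : W} (hst : ∀ x y, ψ s x y = ψ t x y) : s = t := by
  refine h.scalar.eq_of_forall fun z => ?_
  have h1 := h.sum_form_form h.scalar.isOrthoFrame_orthoFrame s z
  have h2 := h.sum_form_form h.scalar.isOrthoFrame_orthoFrame t z
  simp only [hst] at h1
  linarith

omit he in
/-- The elements of `T* ⊗ 𝔲(3)^⊥` are the contractions of `ψ` with endomorphisms. -/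
theorem exists_lift {α : W →ₗ[ℝ] W →ₗ[ℝ] W →ₗ[ℝ] ℝ} (hα : InW (fun x => I x) α) :
    ∃ R : W →ₗ[ℝ] W, α = ψ ∘ₗ R := by
  have h1 : ∀ x, ∃ t, ∀ u v, α x u v = ψ t u v := fun x =>
    h.exists_form_eq (fun u v => (hα x u v).1) (fun u v => (hα x u v).2)
  choose R hR using h1
  refine ⟨{ toFun := R, map_add' := fun x y => ?_, map_smul' := fun c x => ?_ },
    LinearMap.ext fun x => LinearMap.ext fun u => LinearMap.ext fun v => hR x u v⟩
  · refine h.form_injective fun u v => ?_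
    simp [← hR]
  · refine h.form_injective fun u v => ?_
    simp [← hR]

omit he in
theorem inW_lift (R : W →ₗ[ℝ] W) : InW (fun x => I x) (ψ ∘ₗ R) := fun x y z => by
  refine ⟨h.skew23 _ _ _, ?_⟩
  simp only [LinearMap.comp_apply]
  rw [h.complex23, h.square, map_neg, neg_neg]

omit he in
theorem lift_injective {R R' : W →ₗ[ℝ] W} (hR : ψ ∘ₗ R = ψ ∘ₗ R') : R = R' :=
  LinearMap.ext fun x => h.form_injective fun u v => by
    have := congrArg (fun α => α x u v) hR
    exact this

omit he in
-- The contraction `4 ⟨R x, y⟩` is cancelled by the `1/2` of `rForm` and the `1/2!` of `formInner`,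
-- so `r` inverts `R ↦ ψ ∘ R`; symmetry of `r` becomes symmetry of `R`.
theorem rForm_lift (R : W →ₗ[ℝ] W) (x y : W) :
    rForm (fun x y => g x y) (fun v => ψ (v 0) (v 1) (v 2)) (ψ ∘ₗ R) x y = g (R x) y := by
  have h1 := h.sum_form_form h.scalar.isOrthoFrame_orthoFrame (R x) y
  simp only [rForm, formInner, sum_fin_two_fun, contractVec, LinearMap.comp_apply]
  have h2 : ∀ a b c : W, ∀ f : Fin 2 → W, f 0 = b → f 1 = c →
      ψ ((Fin.cons a f : Fin 3 → W) 0) ((Fin.cons a f : Fin 3 → W) 1)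
        ((Fin.cons a f : Fin 3 → W) 2) = ψ a b c := by
    rintro a b c f rfl rfl
    rfl
  simp only [Matrix.cons_val]
  rw [Finset.sum_congr rfl fun i _ => Finset.sum_congr rfl fun j _ => by
    rw [h2 y (orthoFrame 6 (fun x y => g x y) i) (orthoFrame 6 (fun x y => g x y) j) _ rfl rfl], h1]
  norm_num [Nat.factorial]
  ring

/-- The trace of `ψ ∘ R` over its first two arguments only depends on the skew part of `R`. -/
theorem sum_lift (R : W →ₗ[ℝ] W) (z : W) : 2 * ∑ i, ψ (R (e i)) (e i) z =
    - ∑ i, ∑ j, (g (R (e i)) (e j) - g (R (e j)) (e i)) * ψ z (e i) (e j) := by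
  have h1 : ∀ i, ψ (R (e i)) (e i) z = - ∑ j, g (R (e i)) (e j) * ψ z (e i) (e j) := by
    intro i
    have h2 := h.scalar.sum_mul he (ψ z (e i)) (R (e i))
    rw [h2, h.skew13]
  have h2 : ∑ i, ∑ j, g (R (e j)) (e i) * ψ z (e i) (e j) =
      - ∑ i, ∑ j, g (R (e i)) (e j) * ψ z (e i) (e j) := by
    rw [Finset.sum_comm, ← Finset.sum_neg_distrib]
    refine Finset.sum_congr rfl fun i _ => ?_
    rw [← Finset.sum_neg_distrib]
    refine Finset.sum_congr rfl fun j _ => ?_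
    rw [h.skew23]
    ring
  simp only [h1, sub_mul, Finset.sum_sub_distrib, Finset.sum_neg_distrib, h2]
  ring

theorem sum_complex (T : W →ₗ[ℝ] ℝ) (x : W) : ∑ i, g x (I (e i)) * T (e i) = - T (I x) := by
  rw [← h.scalar.sum_mul he T (I x), ← Finset.sum_neg_distrib]
  exact Finset.sum_congr rfl fun i _ => by rw [h.skew_complex]; ring

theorem trace_comp_complex (R : W →ₗ[ℝ] W) :
    LinearMap.trace ℝ W (I ∘ₗ R) = - ∑ i, g (R (e i)) (I (e i)) := by
  rw [h.scalar.trace_eq he, ← Finset.sum_neg_distrib]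
  exact Finset.sum_congr rfl fun i _ => by rw [LinearMap.comp_apply, h.skew_complex]

omit he in
/-- An endomorphism `R` with `ψ ∘ R` totally skew is a complex multiple of the identity. -/
theorem eq_of_lift_skew {R : W →ₗ[ℝ] W} (hR : ∀ x z, ψ (R x) x z = 0) : ∃ a b : ℝ,
    6 * a = LinearMap.trace ℝ W R ∧ 6 * b = - LinearMap.trace ℝ W (I ∘ₗ R) ∧
    ∀ x, R x = a • x + b • I x := by
  have he := h.scalar.isOrthoFrame_orthoFrame
  set e := orthoFrame 6 (fun x y => g x y) with hedef
  have h1 : ∀ x y, Q (R x) y + Q (R y) x = 0 := by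
    intro x y
    refine h.scalar.eq_of_forall fun z => ?_
    have h2 := hR (x + y) z
    simp only [map_add, LinearMap.add_apply, hR] at h2
    rw [map_add, LinearMap.add_apply, h.cross, h.cross, map_zero, LinearMap.zero_apply]
    linarith
  -- Pairing `Q(R x, e_i) + Q(R e_i, x) = 0` with `Q(w, e_i)` and summing over `i`.
  have h2 : ∀ x w, 5 * g (R x) w + g (R (I x)) (I w) =
      (∑ i, g (R (e i)) (e i)) * g x w - (∑ i, g (R (e i)) (I (e i))) * g x (I w) := by
    intro x w
    have h3 : ∀ i, g (R x) w * g (e i) (e i) - g (R x) (e i) * g w (e i)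
        + g (I (R x)) (e i) * g (- I w) (e i)
        + g x (e i) * g (R (e i)) w - g (R (e i)) (e i) * g x w
        + g (I x) (e i) * g (R (e i)) (I w) + g (R (e i)) (I (e i)) * g x (I w) = 0 := by
      intro i
      have h4 : g (Q (R x) (e i) + Q (R (e i)) x) (Q w (e i)) = 0 := by rw [h1]; simp
      rw [map_add, LinearMap.add_apply, h.cross_cross, h.cross_cross, h.kahler_self,
        h.symm (e i) w, h.kahler_skew (e i) w, h.kahler_skew x (e i), h.kahler_skew (R x) (e i),
        h.symm _ (I (R x)), h.symm _ (I x)] at h4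
      rw [map_neg, LinearMap.neg_apply, h.skew_complex w]
      linarith
    have h4 := Finset.sum_congr (rfl : (Finset.univ : Finset (Fin 6)) = Finset.univ)
      fun i _ => h3 i
    have h5 : ∀ i, g (e i) (e i) = 1 := fun i => by simpa using he i i
    simp only [Finset.sum_add_distrib, Finset.sum_sub_distrib, h5, h.scalar.sum_mul_self he,
      Finset.sum_const, Finset.card_univ, Fintype.card_fin, nsmul_eq_mul, ← Finset.sum_mul]
      at h4
    have h6 := h.scalar.sum_mul he ((g.flip w) ∘ₗ R) x
    have h7 := h.scalar.sum_mul he ((g.flip (I w)) ∘ₗ R) (I x)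
    simp only [LinearMap.comp_apply, LinearMap.flip_apply] at h6 h7
    rw [h6, h7, map_neg, h.orthogonal] at h4
    norm_num at h4
    linarith
  refine ⟨(∑ i, g (R (e i)) (e i)) / 6, (∑ i, g (R (e i)) (I (e i))) / 6, ?_, ?_, fun x => ?_⟩
  · rw [h.scalar.trace_eq he]
    ring
  · rw [h.trace_comp_complex he]
    ring
  refine h.scalar.eq_of_forall fun w => ?_
  have h3 := h2 x w
  -- The right side of `h2` is unchanged under `(x, w) ↦ (I x, I w)`, so the two equations determine
  -- `⟨R x, w⟩`.
  have h4 := h2 (I x) (I w)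
  rw [h.square, h.square, map_neg, map_neg, map_neg, LinearMap.neg_apply, h.orthogonal,
    map_neg, h.skew_complex] at h4
  simp only [map_add, map_smul, LinearMap.add_apply, LinearMap.smul_apply, smul_eq_mul,
    h.skew_complex]
  linarith

end IsSU3Form

end SU3Torsion
end

noncomputable section

/-! ### The Gray-Hervella modules in terms of endomorphisms. -/

section SU3Parts

variable {W : Type*} [AddCommGroup W] [Module ℝ W]

/-- The endomorphisms `R` for which `ψ ∘ R` lies in a given component of `T* ⊗ 𝔲(3)^⊥`. -/
def IsPart (g : W →ₗ[ℝ] W →ₗ[ℝ] ℝ) (I R : W →ₗ[ℝ] W) : SU3Component → Prop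
  | .w1p => ∃ a : ℝ, ∀ x, R x = a • x
  | .w1m => ∃ a : ℝ, ∀ x, R x = a • I x
  | .w2p => (∀ x, R (I x) = I (R x)) ∧ (∀ x y, g (R x) y = g x (R y)) ∧ LinearMap.trace ℝ W R = 0
  | .w2m => (∀ x, R (I x) = I (R x)) ∧ (∀ x y, g (R x) y = - g x (R y)) ∧
      LinearMap.trace ℝ W (I ∘ₗ R) = 0
  | .w3 => (∀ x, R (I x) = - I (R x)) ∧ ∀ x y, g (R x) y = g x (R y)
  | .w4 => (∀ x, R (I x) = - I (R x)) ∧ ∀ x y, g (R x) y = - g x (R y)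
  | .w5 => R = 0

/-- The cyclic sum of `ψ ∘ R`. -/
def cyclicLift (ψ : W →ₗ[ℝ] W →ₗ[ℝ] W →ₗ[ℝ] ℝ) (R : W →ₗ[ℝ] W) : W →ₗ[ℝ] W →ₗ[ℝ] W →ₗ[ℝ] ℝ :=
  LinearMap.mk₂ ℝ (fun x y => ψ (R x) y + (ψ (R y)).flip x + (ψ.flip x).flip y ∘ₗ R)
    (fun x x' y => by ext; simp; ring) (fun c x y => by ext; simp)
    (fun x y y' => by ext; simp; ring) (fun c x y => by ext; simp)

theorem cyclicLift_apply (ψ : W →ₗ[ℝ] W →ₗ[ℝ] W →ₗ[ℝ] ℝ) (R : W →ₗ[ℝ] W) (x y z : W) :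
    cyclicLift ψ R x y z = ψ (R x) y z + ψ (R y) z x + ψ (R z) x y := rfl

namespace IsSU3Form

variable {g : W →ₗ[ℝ] W →ₗ[ℝ] ℝ} {I : W →ₗ[ℝ] W} {ψ : W →ₗ[ℝ] W →ₗ[ℝ] W →ₗ[ℝ] ℝ}
  {Q : W →ₗ[ℝ] W →ₗ[ℝ] W} (h : IsSU3Form g I ψ Q)
include h

theorem trace_complex_complex : LinearMap.trace ℝ W (I ∘ₗ I) = - 6 := by
  have h1 : I ∘ₗ I = - LinearMap.id := LinearMap.ext fun x => by simp [h.square]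
  have := h.scalar.finite
  rw [h1, map_neg, LinearMap.trace_id, h.scalar.finrank]
  norm_num

theorem trace_id : LinearMap.trace ℝ W LinearMap.id = 6 := by
  have := h.scalar.finite
  rw [LinearMap.trace_id, h.scalar.finrank]
  norm_num

theorem exists_form_eq_skew_part {R : W →ₗ[ℝ] W} (hI : ∀ x, R (I x) = - I (R x)) :
    ∃ t, ∀ x y, g (R x) y - g (R y) x = ψ t x y := by
  let β : W →ₗ[ℝ] W →ₗ[ℝ] ℝ := g ∘ₗ R - (g ∘ₗ R).flip
  have hβ : ∀ x y, β x y = g (R x) y - g (R y) x := fun x y => rfl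
  obtain ⟨t, ht⟩ := h.exists_form_eq (β := β) (fun x y => by rw [hβ, hβ]; ring) fun x y => by
    rw [hβ, hβ, hI, hI, map_neg, map_neg, LinearMap.neg_apply, LinearMap.neg_apply, h.orthogonal,
      h.orthogonal]
    ring
  exact ⟨t, fun x y => ht x y⟩

/-- The trace of `ψ ∘ R` vanishes iff `R` is symmetric, for complex antilinear `R`. -/
theorem sum_lift_eq_zero_iff {R : W →ₗ[ℝ] W} (hI : ∀ x, R (I x) = - I (R x))
    {e : Fin 6 → W} (he : IsOrthoFrame (fun x y => g x y) e) :
    (∀ z, ∑ i, ψ (R (e i)) (e i) z = 0) ↔ ∀ x y, g (R x) y = g x (R y) := by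
  constructor
  · intro h0
    obtain ⟨t, ht⟩ := h.exists_form_eq_skew_part hI
    have h1 := h.sum_lift he R t
    simp only [ht, h0, h.sum_form_form he] at h1
    have h2 : t = 0 := h.scalar.eq_zero_of_self (by linarith)
    intro x y
    have h3 := ht x y
    rw [h2, map_zero, LinearMap.zero_apply, LinearMap.zero_apply] at h3
    rw [h.symm x]
    linarith
  · intro hs z
    have h1 := h.sum_lift he R z
    have h2 : ∀ i j, g (R (e i)) (e j) - g (R (e j)) (e i) = 0 := fun i j => by
      rw [hs, h.symm, sub_self]
    simp only [h2, zero_mul, Finset.sum_const_zero, neg_zero] at h1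
    linarith

omit h in
theorem contract12_lift (R : W →ₗ[ℝ] W) (z : W) : contract12 (fun x y => g x y) (ψ ∘ₗ R) z =
    ∑ i, ψ (R (orthoFrame 6 (fun x y => g x y) i)) (orthoFrame 6 (fun x y => g x y) i) z := rfl

theorem inW1_lift_iff (R : W →ₗ[ℝ] W) :
    InW1 (fun x => I x) (ψ ∘ₗ R) ↔ ∃ a b : ℝ, ∀ x, R x = a • x + b • I x := by
  constructor
  · rintro ⟨-, h1⟩
    obtain ⟨a, b, -, -, hab⟩ := h.eq_of_lift_skew h1
    exact ⟨a, b, hab⟩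
  · rintro ⟨a, b, hab⟩
    refine ⟨h.inW_lift R, fun x z => ?_⟩
    have h1 : ψ x x z = 0 := by linarith [h.skew12 x x z]
    have h2 : ψ (I x) x z = 0 := by linarith [h.skew12 (I x) x z, h.complex12 x x z]
    simp [hab, h1, h2]

theorem sum_three_lift {e : Fin 6 → W} (he : IsOrthoFrame (fun x y => g x y) e)
    (R T : W →ₗ[ℝ] W) : ∑ k, ∑ i, ∑ j, ψ (R (e k)) (e i) (e j) * ψ (T (e k)) (e i) (e j) =
      4 * ∑ k, g (R (e k)) (T (e k)) := by
  simp only [h.sum_form_form he, Finset.mul_sum]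

/-- When `ψ ∘ T` is invariant under cyclic rotation the three summands of the cyclic lift pair
equally with it, each giving `4 ∑ ⟨R e_k, T e_k⟩`. With `T = 1` and `T = I` this extracts `tr R` and
`tr (I R)`. -/
theorem sum_cyclicLift {e : Fin 6 → W} (he : IsOrthoFrame (fun x y => g x y) e)
    (R : W →ₗ[ℝ] W) {T : W →ₗ[ℝ] W} (hT : ∀ x y z, ψ (T x) y z = ψ (T y) z x) :
    ∑ k, ∑ i, ∑ j, cyclicLift ψ R (e k) (e i) (e j) * ψ (T (e k)) (e i) (e j) =
      12 * ∑ k, g (R (e k)) (T (e k)) := by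
  have h3 : ∀ k i j, cyclicLift ψ R (e k) (e i) (e j) * ψ (T (e k)) (e i) (e j) =
      ψ (R (e k)) (e i) (e j) * ψ (T (e k)) (e i) (e j)
      + ψ (R (e i)) (e j) (e k) * ψ (T (e i)) (e j) (e k)
      + ψ (R (e j)) (e k) (e i) * ψ (T (e j)) (e k) (e i) := by
    intro k i j
    rw [cyclicLift_apply, hT (e j), hT (e k)]
    ring
  have h5 := h.sum_three_lift he R T
  have h6 : ∑ k, ∑ i, ∑ j, ψ (R (e i)) (e j) (e k) * ψ (T (e i)) (e j) (e k) =
      4 * ∑ k, g (R (e k)) (T (e k)) := by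
    rw [Finset.sum_comm, ← h5]
    exact Finset.sum_congr rfl fun i _ => Finset.sum_comm
  have h7 : ∑ k, ∑ i, ∑ j, ψ (R (e j)) (e k) (e i) * ψ (T (e j)) (e k) (e i) =
      4 * ∑ k, g (R (e k)) (T (e k)) := by
    rw [Finset.sum_congr rfl fun k _ => Finset.sum_comm, Finset.sum_comm, ← h5]
  simp only [h3, Finset.sum_add_distrib, h5, h6, h7]
  ring

theorem rot_complex (x y z : W) : ψ (I x) y z = ψ (I y) z x := by
  rw [h.complex12, h.rot x (I y)]

/-- The cyclic sum of `ψ ∘ R` vanishes for trace-free complex linear `R`. -/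
theorem cyclicLift_eq_zero {R : W →ₗ[ℝ] W} (hI : ∀ x, R (I x) = I (R x))
    (h0 : LinearMap.trace ℝ W R = 0) (h1 : LinearMap.trace ℝ W (I ∘ₗ R) = 0) :
    cyclicLift ψ R = 0 := by
  have he := h.scalar.isOrthoFrame_orthoFrame
  set e := orthoFrame 6 (fun x y => g x y) with hedef
  -- For complex linear `R` the cyclic sum is again of the form `ψ ∘ R'`. As it is totally skew, `R'
  -- = a + b I`, and pairing with `1` and `I` identifies `a` and `b` with traces of `R`, which
  -- vanish.
  have hW : InW (fun x => I x) (cyclicLift ψ R) := by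
    intro x y z
    simp only [cyclicLift_apply, hI]
    refine ⟨?_, ?_⟩
    · rw [h.skew23 (R x) y z, h.skew23 (R y) z x, h.skew23 (R z) x y]
      ring
    · rw [h.complex23 (R x), h.square, h.complex13 (R y), h.complex23 (R y), h.complex13 (R z),
        h.square]
      have h2 := h.complex23 (R y) z (I x)
      simp only [h.square, map_neg] at h2 ⊢
      ring
  obtain ⟨R', hR'⟩ := h.exists_lift hW
  have hxx : ∀ x z, ψ (R' x) x z = 0 := by
    intro x z
    have h2 : cyclicLift ψ R x x z = 0 := by
      rw [cyclicLift_apply, h.skew23 (R x) z x, h.skew12 (R z)]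
      linarith [h.skew23 (R z) x x, h.skew12 (R z) x x]
    rw [hR'] at h2
    exact h2
  obtain ⟨a, b, ha, hb, hab⟩ := h.eq_of_lift_skew hxx
  have hT : ∀ T : W →ₗ[ℝ] W, (∀ x y z, ψ (T x) y z = ψ (T y) z x) →
      ∑ k, g (R (e k)) (T (e k)) = 0 → ∑ k, g (R' (e k)) (T (e k)) = 0 := by
    intro T hT hz
    have h2 := h.sum_cyclicLift he R hT
    have h3 := h.sum_three_lift he R' T
    rw [hR', hz] at h2
    simp only [LinearMap.comp_apply] at h2
    linarith
  have h2 := hT LinearMap.id h.rot (by rw [← h0, h.scalar.trace_eq he]; rfl)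
  have h3 := hT I h.rot_complex
    (by rw [h.trace_comp_complex he] at h1; linarith)
  have ha' : a = 0 := by
    rw [h.scalar.trace_eq he] at ha
    simp only [LinearMap.id_apply] at h2
    linarith
  have hb' : b = 0 := by
    rw [h.trace_comp_complex he] at hb
    linarith
  rw [hR']
  refine LinearMap.ext fun x => ?_
  rw [LinearMap.comp_apply, hab, ha', hb']
  simp

/-- The traces of `R` follow from pairing the vanishing cyclic sum with `ψ` and `ψ ∘ I`; the
converse is `cyclicLift_eq_zero`. -/
theorem inW2_lift_iff (R : W →ₗ[ℝ] W) : InW2 (fun x => I x) (ψ ∘ₗ R) ↔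
    (∀ x, R (I x) = I (R x)) ∧ LinearMap.trace ℝ W R = 0 ∧ LinearMap.trace ℝ W (I ∘ₗ R) = 0 := by
  constructor
  · rintro ⟨-, h1⟩
    simp only [LinearMap.comp_apply] at h1
    have hII : ∀ t y z, ψ t (I y) (I z) = - ψ t y z := fun t y z => by
      rw [h.complex23, h.square, map_neg]
    -- The cyclic identity at `(x, y, z)` and at the three triples with two entries multiplied by
    -- `I` isolates the terms containing `R x` and `R (I x)`.
    have hA : ∀ x y z, ψ (R (I x)) (I y) z = - ψ (R x) y z := by
      intro x y z
      have e1 := h1 x y z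
      have e2 := h1 (I x) y (I z)
      have e3 := h1 (I x) (I y) z
      have e4 := h1 x (I y) (I z)
      rw [hII] at e2 e3 e4
      rw [h.complex23 (R (I y)) z x] at e4
      rw [← h.complex23 (R (I x)) y z] at e2
      rw [← h.complex23 (R (I z)) x y] at e4
      linarith
    refine ⟨fun x => h.form_injective fun y z => ?_, ?_, ?_⟩
    · have h2 := hA x (- I y) z
      simp only [map_neg, h.square, neg_neg, LinearMap.neg_apply] at h2
      rw [h2, h.complex12]
    · have h2 := h.sum_cyclicLift h.scalar.isOrthoFrame_orthoFrame R (T := LinearMap.id) h.rot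
      simp only [cyclicLift_apply, h1, zero_mul, Finset.sum_const_zero, LinearMap.id_apply] at h2
      rw [h.scalar.trace_eq h.scalar.isOrthoFrame_orthoFrame]
      linarith
    · have h2 := h.sum_cyclicLift h.scalar.isOrthoFrame_orthoFrame R h.rot_complex
      simp only [cyclicLift_apply, h1, zero_mul, Finset.sum_const_zero] at h2
      rw [h.trace_comp_complex h.scalar.isOrthoFrame_orthoFrame]
      linarith
  · rintro ⟨hI, h0, h1⟩
    refine ⟨h.inW_lift R, fun x y z => ?_⟩
    have h2 := congrArg (fun α => α x y z) (h.cyclicLift_eq_zero hI h0 h1)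
    exact h2

/-- Invariance under `I` in the first two slots amounts to antilinearity of `R`; for antilinear `R`
the skew part of `R` is some `t ⌟ ψ`, and the contraction detects precisely this `t`. -/
theorem inW3_lift_iff (R : W →ₗ[ℝ] W) : InW3 (fun x y => g x y) (fun x => I x) (ψ ∘ₗ R) ↔
    (∀ x, R (I x) = - I (R x)) ∧ ∀ x y, g (R x) y = g x (R y) := by
  have key : (∀ x y z, (ψ ∘ₗ R) x y z = (ψ ∘ₗ R) (I x) (I y) z) ↔
      ∀ x, R (I x) = - I (R x) := by
    simp only [LinearMap.comp_apply]
    constructor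
    · intro h1 x
      refine h.form_injective fun y z => ?_
      have h2 := h1 x (I y) z
      rw [h.square, map_neg, LinearMap.neg_apply, ← h.complex12] at h2
      rw [map_neg, LinearMap.neg_apply, LinearMap.neg_apply]
      linarith
    · intro h1 x y z
      rw [h1, map_neg, LinearMap.neg_apply, LinearMap.neg_apply, h.complex12, h.square, map_neg,
        LinearMap.neg_apply, neg_neg]
  constructor
  · rintro ⟨-, h1, h2⟩
    have hI := key.1 h1
    exact ⟨hI, (h.sum_lift_eq_zero_iff hI h.scalar.isOrthoFrame_orthoFrame).1 h2⟩
  · rintro ⟨hI, hs⟩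
    exact ⟨h.inW_lift R, key.2 hI,
      (h.sum_lift_eq_zero_iff hI h.scalar.isOrthoFrame_orthoFrame).2 hs⟩

/-- If `t` is dual to the contraction, the defining formula of `𝒲₄` is `R x = (1/4) Q(x, t)`.
Conversely an antilinear skew `R` gives a two-form of type `(2, 0) + (0, 2)`, so `R = Q t` for some
`t`, and the contraction of `ψ ∘ R` is `-4 t`. -/
theorem inW4_lift_iff (R : W →ₗ[ℝ] W) : InW4 (fun x y => g x y) (fun x => I x) (ψ ∘ₗ R) ↔
    (∀ x, R (I x) = - I (R x)) ∧ ∀ x y, g (R x) y = - g x (R y) := by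
  have he := h.scalar.isOrthoFrame_orthoFrame
  constructor
  · rintro ⟨-, h1⟩
    obtain ⟨t, ht⟩ : ∃ t, ∀ z, contract12 (fun x y => g x y) (ψ ∘ₗ R) z = g t z := by
      refine ⟨∑ i, Q (R (orthoFrame 6 (fun x y => g x y) i)) (orthoFrame 6 (fun x y => g x y) i),
        fun z => ?_⟩
      rw [contract12_lift, map_sum, LinearMap.sum_apply]
      simp only [h.cross]
    have hR : ∀ x, R x = (1 / 4 : ℝ) • Q x t := by
      intro x
      refine h.form_injective fun y z => ?_
      have h2 := h1 x y z
      rw [ht, ht, ht, ht] at h2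
      rw [LinearMap.comp_apply] at h2
      rw [h2, map_smul, LinearMap.smul_apply, LinearMap.smul_apply, h.rot (Q x t), ← h.cross' y z,
        h.cross_cross, smul_eq_mul]
    refine ⟨fun x => ?_, fun x y => ?_⟩
    · rw [hR, hR, map_smul, h.complex_cross, smul_neg, neg_neg]
    · rw [hR, hR, map_smul, map_smul, LinearMap.smul_apply, h.cross, h.cross', h.skew13, smul_neg]
  · rintro ⟨hI, hs⟩
    obtain ⟨t, ht⟩ := h.exists_form_eq (β := g ∘ₗ R)
      (fun x y => by rw [LinearMap.comp_apply, LinearMap.comp_apply, hs, h.symm])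
      (fun x y => by
        rw [LinearMap.comp_apply, LinearMap.comp_apply, hI, map_neg, LinearMap.neg_apply,
          h.orthogonal, neg_neg])
    have hR : ∀ x y z, ψ (R x) y z = g t y * g x z - g t z * g x y
        - g t (I y) * g x (I z) + g t (I z) * g x (I y) := by
      intro x y z
      have h2 := ht x (Q y z)
      rw [LinearMap.comp_apply, h.cross', ← h.cross t x, h.cross_cross, ← h.rot (R x)] at h2
      exact h2
    have hc : ∀ z, contract12 (fun x y => g x y) (ψ ∘ₗ R) z = - 4 * g t z := by
      intro z
      rw [contract12_lift]
      have h5 : ∀ i, g (orthoFrame 6 (fun x y => g x y) i) (orthoFrame 6 (fun x y => g x y) i) =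
        1 := fun i => by simpa using he i i
      have h6 := h.scalar.sum_mul' he (g t) z
      have h7 := h.sum_complex he (g.flip (I z)) t
      simp only [LinearMap.flip_apply, h.orthogonal] at h7
      simp only [hR, h5, h.kahler_self, Finset.sum_add_distrib, Finset.sum_sub_distrib, h7, mul_zero,
        mul_one, Finset.sum_const, Finset.card_univ, Fintype.card_fin, nsmul_eq_mul,
        mul_comm (g t _) (g _ z), h6]
      norm_num
      ring
    refine ⟨h.inW_lift R, fun x y z => ?_⟩
    rw [hc, hc, hc, hc, LinearMap.comp_apply, hR]
    ring

/-- The components of `T* ⊗ 𝔲(3)^⊥` in terms of endomorphisms. -/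
theorem isPart_of_inComponent {α : W →ₗ[ℝ] W →ₗ[ℝ] W →ₗ[ℝ] ℝ} {c : SU3Component}
    (hα : InComponent (fun x y => g x y) (fun x => I x) (fun v => ψ (v 0) (v 1) (v 2)) α c) :
    ∃ R, α = ψ ∘ₗ R ∧ IsPart g I R c := by
  have hskew : ∀ (R : W →ₗ[ℝ] W) (a b : ℝ), (∀ x, R x = a • x + b • I x) → ∀ x y,
      g (R x) y = a * g x y - b * g x (I y) := by
    intro R a b hab x y
    rw [hab, map_add, map_smul, map_smul, LinearMap.add_apply, LinearMap.smul_apply,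
      LinearMap.smul_apply, h.skew_complex, smul_eq_mul, smul_eq_mul]
    ring
  cases c with
  | w1p =>
    obtain ⟨h1, h2⟩ := hα
    obtain ⟨R, rfl⟩ := h.exists_lift h1.1
    obtain ⟨a, b, hab⟩ := (h.inW1_lift_iff R).1 h1
    simp only [h.rForm_lift, hskew R a b hab] at h2
    refine ⟨R, rfl, a, fun x => h.scalar.eq_of_forall fun y => ?_⟩
    rw [hskew R a b hab, map_smul, LinearMap.smul_apply, smul_eq_mul]
    have h3 := h2 x y
    rw [h.symm y x, h.kahler_skew y x] at h3
    linarith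
  | w1m =>
    obtain ⟨h1, h2⟩ := hα
    obtain ⟨R, rfl⟩ := h.exists_lift h1.1
    obtain ⟨a, b, hab⟩ := (h.inW1_lift_iff R).1 h1
    simp only [h.rForm_lift, hskew R a b hab] at h2
    refine ⟨R, rfl, b, fun x => h.scalar.eq_of_forall fun y => ?_⟩
    rw [hskew R a b hab, map_smul, LinearMap.smul_apply, smul_eq_mul, h.skew_complex]
    have h3 := h2 x y
    rw [h.symm y x, h.kahler_skew y x] at h3
    linarith
  | w2p =>
    obtain ⟨h1, h2⟩ := hα
    obtain ⟨R, rfl⟩ := h.exists_lift h1.1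
    obtain ⟨hI, h0, -⟩ := (h.inW2_lift_iff R).1 h1
    simp only [h.rForm_lift] at h2
    exact ⟨R, rfl, hI, fun x y => by rw [h2, h.symm], h0⟩
  | w2m =>
    obtain ⟨h1, h2⟩ := hα
    obtain ⟨R, rfl⟩ := h.exists_lift h1.1
    obtain ⟨hI, -, h0⟩ := (h.inW2_lift_iff R).1 h1
    simp only [h.rForm_lift] at h2
    exact ⟨R, rfl, hI, fun x y => by rw [h2, h.symm], h0⟩
  | w3 =>
    have h1 : InW3 (fun x y => g x y) (fun x => I x) α := hα
    obtain ⟨R, rfl⟩ := h.exists_lift h1.1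
    exact ⟨R, rfl, (h.inW3_lift_iff R).1 h1⟩
  | w4 =>
    have h1 : InW4 (fun x y => g x y) (fun x => I x) α := hα
    obtain ⟨R, rfl⟩ := h.exists_lift h1.1
    exact ⟨R, rfl, (h.inW4_lift_iff R).1 h1⟩
  | w5 =>
    have h1 : α = 0 := hα
    exact ⟨0, by rw [h1, LinearMap.comp_zero], rfl⟩

/-- `IsPart` records one trace condition for `w2p` and one for `w2m`. The other holds automatically:
`I R`, resp. `R`, is skew and so has trace zero. -/
theorem inComponent_of_isPart {R : W →ₗ[ℝ] W} {c : SU3Component} (hR : IsPart g I R c) :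
    InComponent (fun x y => g x y) (fun x => I x) (fun v => ψ (v 0) (v 1) (v 2)) (ψ ∘ₗ R) c := by
  cases c with
  | w1p =>
    obtain ⟨a, ha⟩ := hR
    refine ⟨(h.inW1_lift_iff R).2 ⟨a, 0, fun x => by rw [ha, zero_smul, add_zero]⟩, fun x y => ?_⟩
    rw [h.rForm_lift, h.rForm_lift, ha, ha, map_smul, map_smul, LinearMap.smul_apply,
      LinearMap.smul_apply, h.symm]
  | w1m =>
    obtain ⟨a, ha⟩ := hR
    refine ⟨(h.inW1_lift_iff R).2 ⟨0, a, fun x => by rw [ha, zero_smul, zero_add]⟩, fun x y => ?_⟩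
    rw [h.rForm_lift, h.rForm_lift, ha, ha, map_smul, map_smul, LinearMap.smul_apply,
      LinearMap.smul_apply, h.symm, h.kahler_skew, smul_neg, h.symm _ x]
  | w2p =>
    obtain ⟨hI, hs, h0⟩ := hR
    have he := h.scalar.isOrthoFrame_orthoFrame
    refine ⟨(h.inW2_lift_iff R).2 ⟨hI, h0, ?_⟩, fun x y => ?_⟩
    · have h1 : LinearMap.trace ℝ W (I ∘ₗ R) = - LinearMap.trace ℝ W (I ∘ₗ R) := by
        rw [h.scalar.trace_eq he, ← Finset.sum_neg_distrib]
        refine Finset.sum_congr rfl fun i _ => ?_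
        set x := orthoFrame 6 (fun x y => g x y) i
        rw [LinearMap.comp_apply]
        linarith [h.skew_complex (R x) x, hs x (I x), congrArg (g x) (hI x), h.symm x (I (R x))]
      linarith
    · rw [h.rForm_lift, h.rForm_lift, hs, h.symm]
  | w2m =>
    obtain ⟨hI, hs, h0⟩ := hR
    have he := h.scalar.isOrthoFrame_orthoFrame
    refine ⟨(h.inW2_lift_iff R).2 ⟨hI, ?_, h0⟩, fun x y => ?_⟩
    · rw [h.scalar.trace_eq he]
      refine Finset.sum_eq_zero fun i _ => ?_
      linarith [hs (orthoFrame 6 (fun x y => g x y) i) (orthoFrame 6 (fun x y => g x y) i),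
        h.symm (R (orthoFrame 6 (fun x y => g x y) i)) (orthoFrame 6 (fun x y => g x y) i)]
    · rw [h.rForm_lift, h.rForm_lift, hs, h.symm]
  | w3 => exact (h.inW3_lift_iff R).2 hR
  | w4 => exact (h.inW4_lift_iff R).2 hR
  | w5 =>
    have h1 : R = 0 := hR
    show ψ ∘ₗ R = 0
    rw [h1, LinearMap.comp_zero]

omit h in
theorem isPart_sub {R R' : W →ₗ[ℝ] W} {c : SU3Component} (hR : IsPart g I R c)
    (hR' : IsPart g I R' c) : IsPart g I (R - R') c := by
  cases c with
  | w1p =>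
    obtain ⟨a, ha⟩ := hR
    obtain ⟨b, hb⟩ := hR'
    exact ⟨a - b, fun x => by rw [LinearMap.sub_apply, ha, hb, sub_smul]⟩
  | w1m =>
    obtain ⟨a, ha⟩ := hR
    obtain ⟨b, hb⟩ := hR'
    exact ⟨a - b, fun x => by rw [LinearMap.sub_apply, ha, hb, sub_smul]⟩
  | w2p =>
    refine ⟨fun x => ?_, fun x y => ?_, ?_⟩
    · simp [hR.1, hR'.1]
    · simp [hR.2.1, hR'.2.1]
    · simp [hR.2.2, hR'.2.2]
  | w2m =>
    refine ⟨fun x => ?_, fun x y => ?_, ?_⟩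
    · simp [hR.1, hR'.1]
    · simp [hR.2.1, hR'.2.1]; ring
    · rw [LinearMap.comp_sub, map_sub, hR.2.2, hR'.2.2, sub_zero]
  | w3 =>
    refine ⟨fun x => ?_, fun x y => ?_⟩
    · simp [hR.1, hR'.1]; abel
    · simp [hR.2, hR'.2]
  | w4 =>
    refine ⟨fun x => ?_, fun x y => ?_⟩
    · simp [hR.1, hR'.1]; abel
    · simp [hR.2, hR'.2]; ring
  | w5 =>
    have h1 : R = 0 := hR
    have h2 : R' = 0 := hR'
    show R - R' = 0
    rw [h1, h2, sub_zero]

/-- The sum of the components is direct. -/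
theorem isPart_eq_zero {R : SU3Component → W →ₗ[ℝ] W} (hR : ∀ c, IsPart g I (R c) c)
    (h0 : R .w1p + R .w1m + R .w2p + R .w2m + R .w3 + R .w4 = 0) (c : SU3Component) :
    R c = 0 := by
  obtain ⟨a, ha⟩ := hR .w1p
  obtain ⟨b, hb⟩ := hR .w1m
  obtain ⟨p1, p2, p3⟩ := hR .w2p
  obtain ⟨m1, m2, m3⟩ := hR .w2m
  obtain ⟨s1, s2⟩ := hR .w3
  obtain ⟨t1, t2⟩ := hR .w4
  have hsum : ∀ x y, a * g x y - b * g x (I y) + g (R .w2p x) y + g (R .w2m x) y + g (R .w3 x) y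
      + g (R .w4 x) y = 0 := by
    intro x y
    have h1 := congrArg (fun T : W →ₗ[ℝ] W => g (T x) y) h0
    simp only [LinearMap.add_apply, ha, hb, map_add, map_smul, LinearMap.smul_apply, smul_eq_mul,
      LinearMap.zero_apply, map_zero, h.skew_complex] at h1
    linarith
  -- The complex linear and antilinear parts separate under `(x, y) ↦ (I x, I y)`; exchanging `x`
  -- and `y` then separates symmetric and skew parts, and traces remove the multiples of `1` and
  -- `I`.
  have hadd : ∀ x y, a * g x y - b * g x (I y) + g (R .w2p x) y + g (R .w2m x) y = 0 ∧
      g (R .w3 x) y + g (R .w4 x) y = 0 := by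
    intro x y
    have h1 := hsum x y
    have h2 := hsum (I x) (I y)
    simp only [p1, m1, s1, t1, map_neg, LinearMap.neg_apply, h.orthogonal, h.square] at h2
    rw [h.skew_complex] at h2
    constructor <;> linarith
  have h2p : ∀ x y, a * g x y + g (R .w2p x) y = 0 := by
    intro x y
    have h1 := (hadd x y).1
    have h2 := (hadd y x).1
    rw [p2, m2, h.symm y, h.symm y (R .w2p x), h.symm y (R .w2m x), h.kahler_skew y] at h2
    linarith
  have h2m : ∀ x y, - b * g x (I y) + g (R .w2m x) y = 0 := by
    intro x y
    linarith [h2p x y, (hadd x y).1]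
  have h3 : ∀ x y, g (R .w3 x) y = 0 := by
    intro x y
    have h1 := (hadd x y).2
    have h2 := (hadd y x).2
    rw [s2, t2, h.symm y, h.symm y] at h2
    linarith
  have he := h.scalar.isOrthoFrame_orthoFrame
  have ha0 : a = 0 := by
    have h1 : R .w2p = (- a) • LinearMap.id := LinearMap.ext fun x =>
      h.scalar.eq_of_forall fun y => by
        simp only [LinearMap.smul_apply, LinearMap.id_apply, map_smul, smul_eq_mul]
        linarith [h2p x y]
    rw [h1, map_smul, h.trace_id, smul_eq_mul] at p3
    linarith
  have hb0 : b = 0 := by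
    have h1 : R .w2m = (- b) • I := LinearMap.ext fun x =>
      h.scalar.eq_of_forall fun y => by
        simp only [LinearMap.smul_apply, map_smul, smul_eq_mul, h.skew_complex]
        linarith [h2m x y]
    rw [h1, LinearMap.comp_smul, map_smul, h.trace_complex_complex, smul_eq_mul] at m3
    linarith
  have hz : ∀ T : W →ₗ[ℝ] W, (∀ x y, g (T x) y = 0) → T = 0 := fun T hT =>
    LinearMap.ext fun x => h.scalar.eq_of_forall fun y => by simp [hT]
  cases c with
  | w1p => exact LinearMap.ext fun x => by rw [ha, ha0, zero_smul, LinearMap.zero_apply]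
  | w1m => exact LinearMap.ext fun x => by rw [hb, hb0, zero_smul, LinearMap.zero_apply]
  | w2p => exact hz _ fun x y => by have := h2p x y; rw [ha0] at this; linarith
  | w2m => exact hz _ fun x y => by have := h2m x y; rw [hb0] at this; linarith
  | w3 => exact hz _ h3
  | w4 => exact hz _ fun x y => by linarith [h3 x y, (hadd x y).2]
  | w5 => exact hR .w5

end IsSU3Form

end SU3Parts
end

noncomputable section

/-! ### The intrinsic torsion of an `SU(3)`-structure at a point. -/

section IntrinsicTorsion

variable {W : Type*} [AddCommGroup W] [Module ℝ W]

theorem derivAction_two (A : W →ₗ[ℝ] W) (b : CovTensor 2 W) (v : Fin 2 → W) :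
    derivAction A b v = - (b ![A (v 0), v 1] + b ![v 0, A (v 1)]) := by
  have h0 : Function.update v 0 (A (v 0)) = ![A (v 0), v 1] := by
    ext i
    fin_cases i <;> rfl
  have h1 : Function.update v 1 (A (v 1)) = ![v 0, A (v 1)] := by
    ext i
    fin_cases i <;> rfl
  rw [derivAction, Fin.sum_univ_two, h0, h1]

theorem derivAction_three (A : W →ₗ[ℝ] W) (b : CovTensor 3 W) (v : Fin 3 → W) :
    derivAction A b v = - (b ![A (v 0), v 1, v 2] + b ![v 0, A (v 1), v 2]
      + b ![v 0, v 1, A (v 2)]) := by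
  have h0 : Function.update v 0 (A (v 0)) = ![A (v 0), v 1, v 2] := by
    ext i
    fin_cases i <;> rfl
  have h1 : Function.update v 1 (A (v 1)) = ![v 0, A (v 1), v 2] := by
    ext i
    fin_cases i <;> rfl
  have h2 : Function.update v 2 (A (v 2)) = ![v 0, v 1, A (v 2)] := by
    ext i
    fin_cases i <;> rfl
  rw [derivAction, Fin.sum_univ_three, h0, h1, h2]

/-- The conditions on the value `A = ζ v` of the intrinsic torsion `ζ`, where `α`, `β`, `γ` are the
covariant derivatives of `ω`, `ψ₊`, `ψ₋` in the direction `v`. -/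
def IsTorsionAt (G : W → W → ℝ) (I : W → W) (ψp ψm : CovTensor 3 W) (α : CovTensor 2 W)
    (β γ : CovTensor 3 W) (A : W →ₗ[ℝ] W) : Prop :=
  InPerp G (InSU3 G I ψp ψm) A ∧ α + derivAction A (kahlerForm G I) = 0 ∧
    β + derivAction A ψp = 0 ∧ γ + derivAction A ψm = 0

namespace IsSU3Form

variable {g : W →ₗ[ℝ] W →ₗ[ℝ] ℝ} {I : W →ₗ[ℝ] W} {ψ : W →ₗ[ℝ] W →ₗ[ℝ] W →ₗ[ℝ] ℝ}
  {Q : W →ₗ[ℝ] W →ₗ[ℝ] W} (h : IsSU3Form g I ψ Q)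

local notation "gf" => fun x y => g x y
local notation "If" => fun x => I x
local notation "ψp" => fun v : Fin 3 → W => ψ (v 0) (v 1) (v 2)
local notation "ψm" => fun v : Fin 3 → W => - ψ (I (v 0)) (v 1) (v 2)

theorem derivAction_kahler (A : W →ₗ[ℝ] W) (v : Fin 2 → W) :
    derivAction A (kahlerForm gf If) v = - (g (A (v 0)) (I (v 1)) + g (v 0) (I (A (v 1)))) :=
  derivAction_two A _ v

theorem derivAction_plus (A : W →ₗ[ℝ] W) (v : Fin 3 → W) : derivAction A ψp v =
    - (ψ (A (v 0)) (v 1) (v 2) + ψ (v 0) (A (v 1)) (v 2) + ψ (v 0) (v 1) (A (v 2))) :=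
  derivAction_three A _ v

theorem derivAction_minus (A : W →ₗ[ℝ] W) (v : Fin 3 → W) : derivAction A ψm v =
    ψ (I (A (v 0))) (v 1) (v 2) + ψ (I (v 0)) (A (v 1)) (v 2) + ψ (I (v 0)) (v 1) (A (v 2)) := by
  rw [derivAction_three]
  simp only [Matrix.cons_val]
  ring

include h

/-- Skew-symmetric endomorphisms with vanishing trace form vanish. -/
theorem eq_zero_of_trace {A : W →ₗ[ℝ] W} (hA : InSO gf A)
    (h0 : LinearMap.trace ℝ W (A ∘ₗ A) = 0) : A = 0 := by
  have he := h.scalar.isOrthoFrame_orthoFrame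
  obtain ⟨b, hb⟩ := h.scalar.exists_basis he
  rw [h.scalar.trace_eq he] at h0
  have hA' : ∀ x y, g (A x) y = - g x (A y) := hA
  simp only [LinearMap.comp_apply, hA' (A _), Finset.sum_neg_distrib, neg_eq_zero] at h0
  have h1 := (Finset.sum_eq_zero_iff_of_nonneg fun i _ => by
    by_cases hz : A (orthoFrame 6 gf i) = 0
    · rw [hz, map_zero]
    · exact (h.scalar.pos _ hz).le).1 h0
  refine b.ext fun i => ?_
  rw [hb]
  exact h.scalar.eq_zero_of_self (h1 i (Finset.mem_univ i))

theorem inU3_iff {A : W →ₗ[ℝ] W} :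
    InU3 gf If A ↔ InSO gf A ∧ ∀ x, A (I x) = I (A x) := by
  refine and_congr_right fun hA => ?_
  have hA' : ∀ x y, g (A x) y = - g x (A y) := hA
  constructor
  · intro h1 x
    refine h.scalar.eq_of_forall fun y => ?_
    have h2 := congrFun h1 ![y, x]
    rw [derivAction_kahler] at h2
    simp only [Matrix.cons_val, hA', Pi.zero_apply] at h2
    rw [h.symm _ y, h.symm _ y]
    linarith
  · intro h1
    ext v
    rw [derivAction_kahler, hA', h1]
    simp

theorem inSO_cross (t : W) : InSO gf (Q t) := fun x y => by
  show g (Q t x) y = - g x (Q t y)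
  rw [h.cross, h.cross', h.skew23]

theorem inSO_complex : InSO gf I := h.skew_complex

/-- `Q t ∘ B` is antilinear, so conjugation by `I` changes its sign but not its trace. Thus the
endomorphisms `Q t` are orthogonal to `𝔲(3)`. -/
theorem trace_cross_comp {B : W →ₗ[ℝ] W} (hB : ∀ x, B (I x) = I (B x)) (t : W) :
    LinearMap.trace ℝ W (Q t ∘ₗ B) = 0 := by
  have h1 : Q t ∘ₗ B = - (I ∘ₗ (Q t ∘ₗ B) ∘ₗ (- I)) := LinearMap.ext fun x => by
    simp only [LinearMap.neg_apply, LinearMap.comp_apply, map_neg, hB, h.cross_complex,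
      h.complex_cross, h.square, neg_neg]
  have h2 : LinearMap.trace ℝ W (I ∘ₗ (Q t ∘ₗ B) ∘ₗ (- I)) =
      LinearMap.trace ℝ W (Q t ∘ₗ B) := by
    have := h.scalar.finite
    have : Module.Free ℝ W := inferInstance
    rw [LinearMap.trace_comp_comm']
    congr 1
    exact LinearMap.ext fun x => by simp [h.square]
  have h3 := congrArg (LinearMap.trace ℝ W) h1
  rw [map_neg, h2] at h3
  linarith

/-- Annihilating `ψ` means that the cyclic lift of `B` vanishes; pairing it with `ψ ∘ I` leaves the
trace. Thus `I` is orthogonal to `𝔰𝔲(3)`. -/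
theorem trace_complex_comp {B : W →ₗ[ℝ] W} (hB : derivAction B ψp = 0) :
    LinearMap.trace ℝ W (I ∘ₗ B) = 0 := by
  have he := h.scalar.isOrthoFrame_orthoFrame
  have h1 : cyclicLift ψ B = 0 := by
    ext x y z
    have h2 := congrFun hB ![x, y, z]
    rw [derivAction_plus] at h2
    simp only [Matrix.cons_val, Pi.zero_apply] at h2
    rw [cyclicLift_apply, ← h.rot x (B y) z, h.rot (B z) x y]
    simp only [LinearMap.zero_apply]
    linarith
  have h2 := h.sum_cyclicLift he B h.rot_complex
  rw [h1] at h2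
  simp only [LinearMap.zero_apply, zero_mul, Finset.sum_const_zero] at h2
  rw [h.trace_comp_complex he]
  linarith

theorem trace_cross_complex (t : W) : LinearMap.trace ℝ W (Q t ∘ₗ I) = 0 :=
  h.trace_cross_comp (fun _ => rfl) t

/-- The intrinsic torsion of an `SU(3)`-structure, in terms of the covariant derivatives of its
tensors. -/
theorem isTorsionAt_iff {t : W} {b : ℝ} {α : CovTensor 2 W} {β γ : CovTensor 3 W}
    (hα : ∀ v, α v = ψ t (v 0) (v 1))
    (hβ : ∀ v, β v = b * ψ (I (v 0)) (v 1) (v 2) - wedgeKahler g I t (v 0) (v 1) (v 2))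
    (hγ : ∀ v, γ v = b * ψ (v 0) (v 1) (v 2) - wedgeKahler g I (I t) (v 0) (v 1) (v 2))
    (A : W →ₗ[ℝ] W) : IsTorsionAt gf If ψp ψm α β γ A ↔
      A = - (1 / 2 : ℝ) • Q (I t) + (b / 3) • I := by
  -- `-(1/2) Q(I t)` in `𝔲(3)^⊥` accounts for `α` and the `♭ ∧ ω` terms by `wedgeKahler_cross`;
  -- `(b/3) I` accounts for the rotation of the phase, since `I` acts once in each of the three
  -- arguments.
  have hex : IsTorsionAt gf If ψp ψm α β γ (- (1 / 2 : ℝ) • Q (I t) + (b / 3) • I) := by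
    refine ⟨⟨fun x y => ?_, fun B hB => ?_⟩, ?_, ?_, ?_⟩
    · have h1 : g (Q (I t) x) y = - g x (Q (I t) y) := h.inSO_cross (I t) x y
      simp only [LinearMap.add_apply, LinearMap.smul_apply, map_add, map_smul, smul_eq_mul, h1,
        h.skew_complex]
      ring
    · rw [LinearMap.add_comp, LinearMap.smul_comp, LinearMap.smul_comp, map_add, map_smul, map_smul,
        h.trace_cross_comp (h.inU3_iff.1 hB.1).2, h.trace_complex_comp hB.2.1]
      simp
    · ext v
      rw [Pi.add_apply, hα, derivAction_kahler]
      have h1 : g (v 0) (I (Q (I t) (v 1))) = ψ (I t) (v 0) (I (v 1)) := by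
        rw [h.complex_cross, map_neg, h.cross', h.skew23, neg_neg, h.complex13]
      simp only [LinearMap.add_apply, LinearMap.smul_apply, map_add, map_smul, smul_eq_mul, h1,
        h.cross, h.orthogonal, h.square, map_neg]
      rw [← h.complex13, h.square, map_neg, LinearMap.neg_apply, LinearMap.neg_apply]
      simp only [Pi.zero_apply]
      ring
    · ext v
      rw [Pi.add_apply, hβ, derivAction_plus]
      have h1 := h.wedgeKahler_cross (I t) (v 0) (v 1) (v 2)
      have h2 : wedgeKahler g I (- t) (v 0) (v 1) (v 2) = - wedgeKahler g I t (v 0) (v 1) (v 2) := by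
        simp only [wedgeKahler, map_neg, LinearMap.neg_apply]
        ring
      rw [h.square, h2] at h1
      simp only [LinearMap.add_apply, LinearMap.smul_apply, map_add, map_smul, smul_eq_mul,
        Pi.zero_apply, ← h.complex12 (v 0) (v 1) (v 2), ← h.complex13 (v 0) (v 1) (v 2)]
      linarith
    · ext v
      rw [Pi.add_apply, hγ, derivAction_minus]
      have h1 := h.wedgeKahler_cross t (v 0) (v 1) (v 2)
      have h2 : ∀ w, I (Q (I t) w) = Q t w := fun w => by
        rw [h.complex_cross, h.square, map_neg, LinearMap.neg_apply, neg_neg]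
      simp only [LinearMap.add_apply, LinearMap.smul_apply, map_add, map_smul, smul_eq_mul,
        Pi.zero_apply, h.complex12 (v 0) (Q (I t) (v 1)), h.complex13 (v 0) (v 1) (Q (I t) (v 2)),
        h.complex12 (v 0) (I (v 1)), h.complex13 (v 0) (v 1) (I (v 2)), h2, h.square, map_neg,
        LinearMap.neg_apply]
      linarith
  refine ⟨fun hA => ?_, fun hA => hA ▸ hex⟩
  obtain ⟨⟨a1, a2⟩, a3, a4, a5⟩ := hA
  obtain ⟨⟨b1, b2⟩, b3, b4, b5⟩ := hex
  set A' := - (1 / 2 : ℝ) • Q (I t) + (b / 3) • I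
  -- Uniqueness: the difference of two solutions stabilises all tensors, hence lies in `𝔰𝔲(3)`, and
  -- is orthogonal to `𝔰𝔲(3)`, hence to itself.
  have hSO : InSO gf (A - A') := fun x y => by
    have h1 : g (A x) y = - g x (A y) := a1 x y
    have h2 : g (A' x) y = - g x (A' y) := b1 x y
    simp only [LinearMap.sub_apply, map_sub, h1, h2]
    ring
  have hSU : InSU3 gf If ψp ψm (A - A') := by
    refine ⟨⟨hSO, ?_⟩, ?_, ?_⟩
    · ext v
      have h1 := congrFun (a3.trans b3.symm) v
      simp only [Pi.add_apply, derivAction_kahler] at h1 ⊢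
      simp only [LinearMap.sub_apply, map_sub, Pi.zero_apply]
      linarith
    · ext v
      have h1 := congrFun (a4.trans b4.symm) v
      simp only [Pi.add_apply, derivAction_plus] at h1 ⊢
      simp only [LinearMap.sub_apply, map_sub, Pi.zero_apply]
      linarith
    · ext v
      have h1 := congrFun (a5.trans b5.symm) v
      simp only [Pi.add_apply, derivAction_minus] at h1 ⊢
      simp only [LinearMap.sub_apply, map_sub, Pi.zero_apply]
      linarith
  have h0 : A - A' = 0 := by
    refine h.eq_zero_of_trace hSO ?_
    rw [LinearMap.sub_comp, map_sub, a2 _ hSU, b2 _ hSU, sub_zero]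
  exact sub_eq_zero.1 h0

/-- `I` belongs to `𝔲(3)`, is orthogonal to `Q(I t)`, and `tr (I ∘ I) = -6`, so pairing with `I`
reads off `b`. -/
theorem inPerp_inU3_iff (t : W) (b : ℝ) :
    InPerp gf (InU3 gf If) (- (1 / 2 : ℝ) • Q (I t) + (b / 3) • I) ↔ b = 0 := by
  constructor
  · rintro ⟨-, h1⟩
    have h2 := h1 I (h.inU3_iff.2 ⟨h.inSO_complex, fun _ => rfl⟩)
    rw [LinearMap.add_comp, LinearMap.smul_comp, LinearMap.smul_comp, map_add, map_smul, map_smul,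
      h.trace_cross_complex, h.trace_complex_complex] at h2
    simp only [smul_eq_mul] at h2
    linarith
  · rintro rfl
    refine ⟨fun x y => ?_, fun B hB => ?_⟩
    · have h1 : g (Q (I t) x) y = - g x (Q (I t) y) := h.inSO_cross (I t) x y
      simp only [LinearMap.add_apply, LinearMap.smul_apply, map_add, map_smul, smul_eq_mul, h1,
        h.skew_complex]
      ring
    · rw [LinearMap.add_comp, LinearMap.smul_comp, LinearMap.smul_comp, map_add, map_smul, map_smul,
        h.trace_cross_comp (h.inU3_iff.1 hB).2]
      simp

end IsSU3Form

end IntrinsicTorsion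
end

noncomputable section

/-! ### The pointwise criterion for the type. -/

section TorsionTypes

variable {W : Type*} [AddCommGroup W] [Module ℝ W]

/-- The pointwise condition to be of type `∑_{c ∈ C} 𝒲_c`, in terms of the covariant derivatives
`Dω`, `Dp`, `Dm` of `ω`, `ψ₊`, `ψ₋`. -/
def HasTypeAt (G : W → W → ℝ) (I : W → W) (ψp ψm : CovTensor 3 W) (Dω : W → CovTensor 2 W)
    (Dp Dm : W → CovTensor 3 W) (C : Set SU3Component) : Prop :=
  ∃ (ζ : W →ₗ[ℝ] W →ₗ[ℝ] W) (a : SU3Component → (W →ₗ[ℝ] W →ₗ[ℝ] W →ₗ[ℝ] ℝ)),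
    (∀ v, IsTorsionAt G I ψp ψm (Dω v) (Dp v) (Dm v) (ζ v)) ∧
    (∀ c, InComponent G I ψp (a c) c) ∧ (∀ c, c ∉ C → a c = 0) ∧
    (∀ u v w, Dω u ![v, w] =
      (a .w1p + a .w1m + a .w2p + a .w2m + a .w3 + a .w4) u v w) ∧
    (SU3Component.w5 ∉ C → ∀ v, InPerp G (InU3 G I) (ζ v))

namespace IsSU3Form

variable {g : W →ₗ[ℝ] W →ₗ[ℝ] ℝ} {I : W →ₗ[ℝ] W} {ψ : W →ₗ[ℝ] W →ₗ[ℝ] W →ₗ[ℝ] ℝ}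
  {Q : W →ₗ[ℝ] W →ₗ[ℝ] W} (h : IsSU3Form g I ψ Q)
include h

variable {R : W →ₗ[ℝ] W} {b : W →ₗ[ℝ] ℝ} {Dω : W → CovTensor 2 W} {Dp Dm : W → CovTensor 3 W}
  (hω : ∀ u v, Dω u v = ψ (R u) (v 0) (v 1))
  (hp : ∀ u v, Dp u v = b u * ψ (I (v 0)) (v 1) (v 2) - wedgeKahler g I (R u) (v 0) (v 1) (v 2))
  (hm : ∀ u v, Dm u v = b u * ψ (v 0) (v 1) (v 2) - wedgeKahler g I (I (R u)) (v 0) (v 1) (v 2))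
include hω hp hm

/-- Since the torsion is unique and the sum of the modules is direct, the existential statement
reduces to the vanishing of the components of any one explicit decomposition of `R`. -/
theorem hasTypeAt_iff {T : SU3Component → W →ₗ[ℝ] W} (hT : ∀ c, IsPart g I (T c) c)
    (hsum : T .w1p + T .w1m + T .w2p + T .w2m + T .w3 + T .w4 = R) (C : Set SU3Component) :
    HasTypeAt (fun x y => g x y) (fun x => I x) (fun v => ψ (v 0) (v 1) (v 2))
      (fun v => - ψ (I (v 0)) (v 1) (v 2)) Dω Dp Dm C ↔
      (∀ c, c ∉ C → T c = 0) ∧ (SU3Component.w5 ∉ C → ∀ v, b v = 0) := by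
  constructor
  · rintro ⟨ζ, a, h1, h2, h3, h4, h5⟩
    have hζ : ∀ v, ζ v = - (1 / 2 : ℝ) • Q (I (R v)) + (b v / 3) • I := fun v =>
      (h.isTorsionAt_iff (hω v) (hp v) (hm v) (ζ v)).1 (h1 v)
    choose R' hR' hpart using fun c => h.isPart_of_inComponent (h2 c)
    have hR : R' .w1p + R' .w1m + R' .w2p + R' .w2m + R' .w3 + R' .w4 = R := by
      refine h.lift_injective ?_
      ext u v w
      have h6 := h4 u v w
      rw [hω] at h6
      simp only [hR'] at h6
      simp only [LinearMap.comp_apply, LinearMap.add_apply, map_add, Matrix.cons_val] at h6 ⊢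
      exact h6.symm
    have hTR : ∀ c, R' c - T c = 0 := by
      refine h.isPart_eq_zero (R := fun c => R' c - T c) (fun c => isPart_sub (hpart c) (hT c)) ?_
      rw [← sub_eq_zero.2 (hR.trans hsum.symm)]
      abel
    refine ⟨fun c hc => ?_, fun h5C v => ?_⟩
    · have h6 : R' c = 0 := h.lift_injective (by rw [← hR', h3 c hc, LinearMap.comp_zero])
      have h7 := hTR c
      rw [h6, zero_sub, neg_eq_zero] at h7
      exact h7
    · have h6 := h5 h5C v
      rw [hζ] at h6
      exact (h.inPerp_inU3_iff _ _).1 h6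
  · rintro ⟨h1, h2⟩
    let ζ : W →ₗ[ℝ] W →ₗ[ℝ] W :=
      { toFun := fun v => - (1 / 2 : ℝ) • Q (I (R v)) + (b v / 3) • I
        map_add' := fun x y => by
          ext v
          simp only [map_add, LinearMap.add_apply, LinearMap.smul_apply, smul_add, add_div,
            add_smul]
          abel
        map_smul' := fun t x => by
          ext v
          simp only [map_smul, LinearMap.add_apply, LinearMap.smul_apply, RingHom.id_apply,
            smul_add, smul_eq_mul, smul_smul]
          congr 2 <;> ring }
    refine ⟨ζ, fun c => ψ ∘ₗ T c, fun v => (h.isTorsionAt_iff (hω v) (hp v) (hm v) _).2 rfl,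
      fun c => h.inComponent_of_isPart (hT c), fun c hc => ?_, fun u v w => ?_, fun h5 v => ?_⟩
    · simp only [h1 c hc, LinearMap.comp_zero]
    · rw [hω, ← hsum]
      simp only [LinearMap.comp_apply, LinearMap.add_apply, map_add, Matrix.cons_val]
    · exact (h.inPerp_inU3_iff _ _).2 (h2 h5 v)

/-- The type of a structure with torsion determined by a symmetric endomorphism `S`, a vector `z`
and a phase. -/
theorem hasTypeAt_iff_of_symmetric {S : W →ₗ[ℝ] W} (hS : ∀ x y, g (S x) y = g x (S y)) {c s : ℝ}
    (hcs : c ^ 2 + s ^ 2 = 1) {z : W} (hR : ∀ v, R v = c • S v - s • I (S v) + Q (I z) v)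
    {t : ℝ} (ht : 6 * t = LinearMap.trace ℝ W S) {C : Set SU3Component} (h4 : .w4 ∈ C) :
    HasTypeAt (fun x y => g x y) (fun x => I x) (fun v => ψ (v 0) (v 1) (v 2))
      (fun v => - ψ (I (v 0)) (v 1) (v 2)) Dω Dp Dm C ↔
      (.w1p ∉ C → t * c = 0) ∧ (.w1m ∉ C → t * s = 0) ∧
      (.w2p ∉ C → ∀ x y, c * (2 * t * g x y) = c * (g (S x) y + g (S (I x)) (I y))) ∧
      (.w2m ∉ C → ∀ x y, s * (2 * t * g x y) = s * (g (S x) y + g (S (I x)) (I y))) ∧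
      (.w3 ∉ C → ∀ x y, g (S (I x)) (I y) = g (S x) y) ∧ (.w5 ∉ C → ∀ v, b v = 0) := by
  -- `S = t + Sc + Sa`, with `Sc` complex linear and trace-free, `Sa` antilinear, both symmetric.
  let Sc : W →ₗ[ℝ] W := (1 / 2 : ℝ) • (S - I ∘ₗ S ∘ₗ I) - t • LinearMap.id
  let Sa : W →ₗ[ℝ] W := (1 / 2 : ℝ) • (S + I ∘ₗ S ∘ₗ I)
  have hSc : ∀ x, Sc x = (1 / 2 : ℝ) • (S x - I (S (I x))) - t • x := fun x => rfl
  have hSa : ∀ x, Sa x = (1 / 2 : ℝ) • (S x + I (S (I x))) := fun x => rfl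
  have gSc : ∀ x y, g (Sc x) y = (1 / 2) * (g (S x) y + g (S (I x)) (I y)) - t * g x y := by
    intro x y
    rw [hSc]
    simp only [map_sub, map_smul, LinearMap.sub_apply, LinearMap.smul_apply, smul_eq_mul,
      h.skew_complex]
    ring
  have gSa : ∀ x y, g (Sa x) y = (1 / 2) * (g (S x) y - g (S (I x)) (I y)) := by
    intro x y
    rw [hSa]
    simp only [map_add, map_smul, LinearMap.add_apply, LinearMap.smul_apply, smul_eq_mul,
      h.skew_complex]
    ring
  have cSc : ∀ x, Sc (I x) = I (Sc x) := by
    intro x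
    rw [hSc, hSc]
    simp only [h.square, map_sub, map_smul, map_neg]
    module
  have cSa : ∀ x, Sa (I x) = - I (Sa x) := by
    intro x
    rw [hSa, hSa]
    simp only [h.square, map_add, map_smul, map_neg]
    module
  have sSc : ∀ x y, g (Sc x) y = g x (Sc y) := by
    intro x y
    rw [h.symm x, gSc, gSc, hS x, hS (I x), h.symm x, h.symm (I x), h.symm x]
  have sSa : ∀ x y, g (Sa x) y = g x (Sa y) := by
    intro x y
    rw [h.symm x, gSa, gSa, hS x, hS (I x), h.symm x, h.symm (I x)]
  have tSc : LinearMap.trace ℝ W Sc = 0 := by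
    have := h.scalar.finite
    have h1 : LinearMap.trace ℝ W (I ∘ₗ S ∘ₗ I) = - LinearMap.trace ℝ W S := by
      rw [LinearMap.trace_comp_comm', LinearMap.comp_assoc, ← map_neg]
      congr 1
      exact LinearMap.ext fun x => by simp [h.square]
    simp only [Sc, map_sub, map_smul, h1, h.trace_id, smul_eq_mul]
    linarith
  -- `c S - s I S` is sorted by type: `I ∘ Sc` is skew because `Sc` commutes with `I`, whereas `I ∘
  -- Sa` is symmetric because `Sa` anticommutes with it. `Q (I z)` is antilinear and skew.
  let T : SU3Component → W →ₗ[ℝ] W := fun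
    | .w1p => (t * c) • LinearMap.id
    | .w1m => (- (t * s)) • I
    | .w2p => c • Sc
    | .w2m => - s • (I ∘ₗ Sc)
    | .w3 => c • Sa - s • (I ∘ₗ Sa)
    | .w4 => Q (I z)
    | .w5 => 0
  have hT : ∀ d, IsPart g I (T d) d := by
    intro d
    cases d with
    | w1p => exact ⟨t * c, fun x => rfl⟩
    | w1m => exact ⟨- (t * s), fun x => rfl⟩
    | w2p =>
      refine ⟨fun x => ?_, fun x y => ?_, ?_⟩
      · simp only [T, LinearMap.smul_apply, cSc, map_smul]
      · simp only [T, LinearMap.smul_apply, map_smul, sSc]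
      · simp only [T, map_smul, tSc, smul_zero]
    | w2m =>
      refine ⟨fun x => ?_, fun x y => ?_, ?_⟩
      · simp only [T, LinearMap.smul_apply, LinearMap.comp_apply, cSc, map_smul]
      · simp only [T, LinearMap.smul_apply, LinearMap.comp_apply, map_smul, sSc, h.skew_complex,
          cSc, smul_eq_mul]
        ring
      · have h1 : I ∘ₗ T .w2m = s • Sc := LinearMap.ext fun x => by
          simp [T, h.square]
        rw [h1, map_smul, tSc, smul_zero]
    | w3 =>
      refine ⟨fun x => ?_, fun x y => ?_⟩
      · simp only [T, LinearMap.smul_apply, LinearMap.comp_apply, LinearMap.sub_apply, cSa,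
          map_smul, map_sub, map_neg]
        module
      · simp only [T, LinearMap.smul_apply, LinearMap.comp_apply, LinearMap.sub_apply, map_smul,
          map_sub, sSa, h.skew_complex, cSa, map_neg, smul_eq_mul]
        ring
    | w4 =>
      refine ⟨fun x => ?_, h.inSO_cross (I z)⟩
      simp only [T]
      rw [h.cross_complex, h.complex_cross, neg_neg]
    | w5 => exact rfl
  have hsum : T .w1p + T .w1m + T .w2p + T .w2m + T .w3 + T .w4 = R := by
    ext x
    simp only [T, LinearMap.add_apply, LinearMap.smul_apply, LinearMap.comp_apply,
      LinearMap.sub_apply, LinearMap.id_apply, hR, hSc, hSa, map_smul, map_sub, map_add, h.square]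
    module
  rw [h.hasTypeAt_iff hω hp hm hT hsum]
  have hz : ∀ A : W →ₗ[ℝ] W, A = 0 ↔ ∀ x y, g (A x) y = 0 := fun A =>
    ⟨fun hA x y => by rw [hA]; simp, fun hA =>
      LinearMap.ext fun x => h.scalar.eq_of_forall fun y => by simp [hA]⟩
  have e1p : T .w1p = 0 ↔ t * c = 0 := by
    refine ⟨fun h0 => ?_, fun h0 => by simp only [T, h0, zero_smul]⟩
    have h1 := congrArg (LinearMap.trace ℝ W) h0
    simp only [T, map_smul, h.trace_id, map_zero, smul_eq_mul] at h1
    linarith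
  have e1m : T .w1m = 0 ↔ t * s = 0 := by
    refine ⟨fun h0 => ?_, fun h0 => by simp only [T, h0, neg_zero, zero_smul]⟩
    have h1 := congrArg (fun A => LinearMap.trace ℝ W (I ∘ₗ A)) h0
    simp only [T, LinearMap.comp_smul, map_smul, h.trace_complex_complex, LinearMap.comp_zero,
      map_zero, smul_eq_mul] at h1
    linarith
  have e2p : T .w2p = 0 ↔
      ∀ x y, c * (2 * t * g x y) = c * (g (S x) y + g (S (I x)) (I y)) := by
    rw [hz]
    refine forall₂_congr fun x y => ?_
    simp only [T, LinearMap.smul_apply, map_smul, gSc, smul_eq_mul]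
    constructor <;> intro h0 <;> linarith
  have e2m : T .w2m = 0 ↔
      ∀ x y, s * (2 * t * g x y) = s * (g (S x) y + g (S (I x)) (I y)) := by
    -- Pairing with `I y` removes the factor `I`.
    have h1 : ∀ x y, g (T .w2m x) (I y) = - (s * g (Sc x) y) := by
      intro x y
      simp only [T, LinearMap.smul_apply, LinearMap.comp_apply, map_smul, h.orthogonal, smul_eq_mul]
      ring
    have h2 : T .w2m = 0 ↔ ∀ x y, s * g (Sc x) y = 0 := by
      rw [hz]
      refine forall_congr' fun x => ⟨fun h0 y => ?_, fun h0 y => ?_⟩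
      · have h3 := h1 x y
        rw [h0] at h3
        linarith
      · have h3 := h1 x (- I y)
        rw [h0, map_neg, h.square, neg_neg, neg_zero] at h3
        exact h3
    rw [h2]
    refine forall₂_congr fun x y => ?_
    rw [gSc]
    constructor <;> intro h0 <;> linarith
  have e3 : T .w3 = 0 ↔ ∀ x y, g (S (I x)) (I y) = g (S x) y := by
    have h1 : T .w3 = 0 ↔ Sa = 0 := by
      refine ⟨fun h0 => ?_, fun h0 => by simp only [T, h0, smul_zero, LinearMap.comp_zero, sub_zero]⟩
      ext x
      -- Applying `c + s I`, the inverse of `c - s I` as `c² + s² = 1`; hence the `𝒲₃` condition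
      -- does not depend on the phase.
      have h1 := congrArg (fun A : W →ₗ[ℝ] W => c • A x + s • I (A x)) h0
      simp only [T, LinearMap.sub_apply, LinearMap.smul_apply, LinearMap.comp_apply, map_sub,
        map_smul, h.square, LinearMap.zero_apply, map_zero, smul_zero, add_zero] at h1
      have h2 : (c ^ 2 + s ^ 2) • Sa x = 0 := by
        rw [← h1]
        module
      rwa [hcs, one_smul] at h2
    rw [h1, hz]
    refine forall₂_congr fun x y => ?_
    rw [gSa]
    constructor <;> intro h0 <;> linarith
  constructor
  · rintro ⟨h1, h2⟩
    exact ⟨fun hc => e1p.1 (h1 _ hc), fun hc => e1m.1 (h1 _ hc), fun hc => e2p.1 (h1 _ hc),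
      fun hc => e2m.1 (h1 _ hc), fun hc => e3.1 (h1 _ hc), h2⟩
  · rintro ⟨h1, h2, h3, h5, h6, h7⟩
    refine ⟨fun d hd => ?_, h7⟩
    cases d with
    | w1p => exact e1p.2 (h1 hd)
    | w1m => exact e1m.2 (h2 hd)
    | w2p => exact e2p.2 (h3 hd)
    | w2m => exact e2m.2 (h5 hd)
    | w3 => exact e3.2 (h6 hd)
    | w4 => exact absurd h4 hd
    | w5 => exact rfl

end IsSU3Form

end TorsionTypes
end

noncomputable section

/-! ### Tensor fields in preferred charts. -/

section Charts

open Set Filter Topology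

variable {n : ℕ} {N : Type*} [TopologicalSpace N] [ChartedSpace (EuclideanSpace ℝ (Fin n)) N]
  [IsManifold (𝓡 n) ∞ N]

/-- The coordinates of a tangent vector at `x`, in the preferred chart at `p`. -/
def coordVec (p x : N) (v : TangentSpace (𝓡 n) x) : EuclideanSpace ℝ (Fin n) :=
  mfderiv (𝓡 n) 𝓘(ℝ, EuclideanSpace ℝ (Fin n)) (extChartAt (𝓡 n) p) x v

theorem coordVec_coordField {p : N} {u : EuclideanSpace ℝ (Fin n)}
    (hu : u ∈ (extChartAt (𝓡 n) p).target) (w : EuclideanSpace ℝ (Fin n)) :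
    coordVec p _ (coordField p u w) = w := by
  have : IsManifold (𝓡 n) 1 N := IsManifold.of_le (n := ∞) (by norm_num)
  have h1 := mfderiv_extChartAt_comp_mfderivWithin_extChartAt_symm (I := 𝓡 n) (x := p) hu
  rw [ModelWithCorners.range_eq_univ, mfderivWithin_univ] at h1
  exact congrArg (fun A => A w) h1

theorem coordField_coordVec {p x : N} (hx : x ∈ (extChartAt (𝓡 n) p).source)
    (v : TangentSpace (𝓡 n) x) :
    (coordField p (extChartAt (𝓡 n) p x) (coordVec p x v) : EuclideanSpace ℝ (Fin n)) = v := by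
  have : IsManifold (𝓡 n) 1 N := IsManifold.of_le (n := ∞) (by norm_num)
  have h1 := mfderivWithin_extChartAt_symm_comp_mfderiv_extChartAt' (I := 𝓡 n) (x := p) hx
  rw [ModelWithCorners.range_eq_univ, mfderivWithin_univ] at h1
  exact congrArg (fun A => A v) h1

theorem coordVec_self (p : N) (v : TangentSpace (𝓡 n) p) : coordVec p p v = v := by
  have : IsManifold (𝓡 n) 1 N := IsManifold.of_le (n := ∞) (by norm_num)
  exact congrArg (fun A => A v) (mfderiv_extChartAt_self (I := 𝓡 n) (x := p))

theorem coordField_self (p : N) (w : EuclideanSpace ℝ (Fin n)) :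
    (coordField p (extChartAt (𝓡 n) p p) w : EuclideanSpace ℝ (Fin n)) = w :=
  (congrArg (coordField p (extChartAt (𝓡 n) p p)) (coordVec_self p w)).symm.trans
    (coordField_coordVec (mem_extChartAt_source p) w)

/-- Connects smoothness in the tangent bundle with the coordinates used by `covDerivAlong`. -/
theorem trivializationAt_tangent_snd {p x : N} (hx : x ∈ (chartAt (EuclideanSpace ℝ (Fin n)) p).source)
    (v : TangentSpace (𝓡 n) x) :
    (trivializationAt (EuclideanSpace ℝ (Fin n)) (TangentSpace (𝓡 n)) p
      (⟨x, v⟩ : TangentBundle (𝓡 n) N)).2 = coordVec p x v := by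
  have : IsManifold (𝓡 n) 1 N := IsManifold.of_le (n := ∞) (by norm_num)
  have h1 := TangentBundle.continuousLinearMapAt_trivializationAt (I := 𝓡 n) hx
  have h2 := congrArg (fun A => A v) h1
  refine Eq.trans ?_ h2
  have h3 := (trivializationAt (EuclideanSpace ℝ (Fin n)) (TangentSpace (𝓡 n)) p).coe_linearMapAt_of_mem
    (R := ℝ) (b := x) hx
  exact (congrFun h3 v).symm

/-- The value of a tensor field in terms of its expression in a chart. -/
theorem eq_chartTensor {k : ℕ} (T : ∀ x : N, CovTensor k (TangentSpace (𝓡 n) x)) {p x : N}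
    (hx : x ∈ (extChartAt (𝓡 n) p).source) (v : Fin k → TangentSpace (𝓡 n) x) :
    T x v = chartTensor T p (extChartAt (𝓡 n) p x) (fun i => coordVec p x (v i)) := by
  have h1 : ∀ (y : N) (v' : Fin k → EuclideanSpace ℝ (Fin n)), y = x → v' = v → T x v = T y v' := by
    rintro y v' rfl rfl
    rfl
  exact h1 _ _ ((extChartAt (𝓡 n) p).left_inv hx) (funext fun i => coordField_coordVec hx (v i))

theorem chartTensor_self {k : ℕ} (T : ∀ x : N, CovTensor k (TangentSpace (𝓡 n) x)) (p : N)
    (v : Fin k → TangentSpace (𝓡 n) p) :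
    chartTensor T p (extChartAt (𝓡 n) p p) v = T p v := by
  rw [eq_chartTensor T (mem_extChartAt_source p) v]
  simp only [coordVec_self]

/-- Coordinate fields are smooth. -/
theorem contMDiffAt_coordField {p : N} {u : EuclideanSpace ℝ (Fin n)}
    (hu : u ∈ (extChartAt (𝓡 n) p).target) (w : EuclideanSpace ℝ (Fin n)) :
    ContMDiffAt 𝓘(ℝ, EuclideanSpace ℝ (Fin n)) (𝓡 n).tangent ∞
      (fun u => (⟨(extChartAt (𝓡 n) p).symm u, coordField p u w⟩ : TangentBundle (𝓡 n) N)) u := by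
  have : IsManifold (𝓡 n) 1 N := IsManifold.of_le (n := ∞) (by norm_num)
  have hs : ContMDiffAt 𝓘(ℝ, EuclideanSpace ℝ (Fin n)) (𝓡 n) ∞ (extChartAt (𝓡 n) p).symm u :=
    (contMDiffOn_extChartAt_symm p u hu).contMDiffAt ((isOpen_extChartAt_target p).mem_nhds hu)
  have hmem : ∀ y ∈ (extChartAt (𝓡 n) p).target,
      (extChartAt (𝓡 n) p).symm y ∈ (chartAt (EuclideanSpace ℝ (Fin n)) p).source := by
    intro y hy
    rw [← extChartAt_source (𝓡 n)]
    exact (extChartAt (𝓡 n) p).map_target hy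
  refine ((trivializationAt (EuclideanSpace ℝ (Fin n)) (TangentSpace (𝓡 n)) p).contMDiffAt_iff
    ?_).2 ⟨hs, ?_⟩
  · rw [Bundle.Trivialization.mem_source]
    exact hmem u hu
  · refine (contMDiffAt_const (c := w)).congr_of_eventuallyEq ?_
    filter_upwards [(isOpen_extChartAt_target p).mem_nhds hu] with y hy
    rw [trivializationAt_tangent_snd (hmem y hy), coordVec_coordField hy]

theorem contDiffAt_chartTensor_metric
    (g : Bundle.ContMDiffRiemannianMetric (𝓡 n) ∞ (EuclideanSpace ℝ (Fin n))
      (fun x : N => TangentSpace (𝓡 n) x)) {p : N} {u : EuclideanSpace ℝ (Fin n)}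
    (hu : u ∈ (extChartAt (𝓡 n) p).target) (w : Fin 2 → EuclideanSpace ℝ (Fin n)) :
    ContDiffAt ℝ ∞ (fun u => chartTensor (n := n)
      (fun x (a : Fin 2 → TangentSpace (𝓡 n) x) => metricField g x (a 0) (a 1)) p u w) u := by
  have hs : ContMDiffAt 𝓘(ℝ, EuclideanSpace ℝ (Fin n)) (𝓡 n) ∞ (extChartAt (𝓡 n) p).symm u :=
    (contMDiffOn_extChartAt_symm p u hu).contMDiffAt ((isOpen_extChartAt_target p).mem_nhds hu)
  have h1 : ContMDiffAt 𝓘(ℝ, EuclideanSpace ℝ (Fin n)) ((𝓡 n).prod 𝓘(ℝ)) ∞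
      (fun u => Bundle.TotalSpace.mk' ℝ (E := Bundle.Trivial N ℝ) ((extChartAt (𝓡 n) p).symm u)
        (g.inner ((extChartAt (𝓡 n) p).symm u) (coordField p u (w 0)) (coordField p u (w 1)))) u := by
    apply ContMDiffAt.clm_bundle_apply₂ (F₁ := EuclideanSpace ℝ (Fin n))
      (F₂ := EuclideanSpace ℝ (Fin n))
    · exact ContMDiffAt.comp u g.contMDiff.contMDiffAt hs
    · exact contMDiffAt_coordField hu (w 0)
    · exact contMDiffAt_coordField hu (w 1)
  rw [Bundle.contMDiffAt_totalSpace] at h1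
  exact h1.2.contDiffAt

end Charts
end

noncomputable section

/-! ### The product rule for tensor fields along maps. -/

section Leibniz

open Filter Topology

/-- The product rule for a family of multilinear forms on `ℝⁿ` with differentiable coefficients. -/
theorem hasFDerivAt_multilinear_apply {n k : ℕ} {F : Type*} [NormedAddCommGroup F] [NormedSpace ℝ F]
    {τ : EuclideanSpace ℝ (Fin n) → MultilinearMap ℝ (fun _ : Fin k => EuclideanSpace ℝ (Fin n)) ℝ}
    {f : F → EuclideanSpace ℝ (Fin n)} {f' : F →L[ℝ] EuclideanSpace ℝ (Fin n)} {u : F}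
    (hτ : ∀ w, DifferentiableAt ℝ (fun y => τ y w) (f u)) (hf : HasFDerivAt f f' u)
    {c : Fin k → F → EuclideanSpace ℝ (Fin n)} {c' : Fin k → F →L[ℝ] EuclideanSpace ℝ (Fin n)}
    (hc : ∀ i, HasFDerivAt (c i) (c' i) u) :
    DifferentiableAt ℝ (fun x => τ (f x) (fun i => c i x)) u ∧
    ∀ v, fderiv ℝ (fun x => τ (f x) (fun i => c i x)) u v =
      fderiv ℝ (fun y => τ y (fun i => c i u)) (f u) (f' v) +
        ∑ i, τ (f u) (Function.update (fun j => c j u) i (c' i v)) := by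
  classical
  let e : Fin n → EuclideanSpace ℝ (Fin n) := fun j => EuclideanSpace.basisFun (Fin n) ℝ j
  have he : ∀ x : EuclideanSpace ℝ (Fin n), x = ∑ j, x j • e j := fun x =>
    ((EuclideanSpace.basisFun (Fin n) ℝ).sum_repr x).symm
  -- `τ y` is the sum of its coefficients on basis vectors times fixed monomials `Θ s`; only scalar
  -- coefficients depend on `y`, so differentiability of those is enough.
  let Θ : (Fin k → Fin n) → ContinuousMultilinearMap ℝ (fun _ : Fin k => EuclideanSpace ℝ (Fin n)) ℝ :=
    fun s => (ContinuousMultilinearMap.mkPiAlgebra ℝ (Fin k) ℝ).compContinuousLinearMap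
      fun i => EuclideanSpace.proj (s i)
  have hexp : ∀ y w, τ y w = ∑ s : Fin k → Fin n, τ y (fun i => e (s i)) * Θ s w := by
    intro y w
    have h1 : w = fun i => ∑ j, w i j • e j := funext fun i => he (w i)
    conv_lhs => rw [h1]
    rw [MultilinearMap.map_sum]
    refine Finset.sum_congr rfl fun s _ => ?_
    rw [MultilinearMap.map_smul_univ, smul_eq_mul, mul_comm]
    rfl
  have hcc : HasFDerivAt (fun x => fun i => c i x) (ContinuousLinearMap.pi c') u :=
    hasFDerivAt_pi.2 hc
  have hΘ : ∀ s, HasFDerivAt (fun x => Θ s (fun i => c i x))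
      (((Θ s).linearDeriv (fun i => c i u)).comp (ContinuousLinearMap.pi c')) u := fun s =>
    ((Θ s).hasFDerivAt (fun i => c i u)).comp u hcc
  have hτf : ∀ s : Fin k → Fin n, HasFDerivAt (fun x => τ (f x) (fun i => e (s i)))
      ((fderiv ℝ (fun y => τ y (fun i => e (s i))) (f u)).comp f') u := fun s =>
    (hτ _).hasFDerivAt.comp u hf
  have hmain := HasFDerivAt.fun_sum (u := Finset.univ) fun (s : Fin k → Fin n) _ =>
    (hτf s).mul (hΘ s)
  have hfun : (fun x => τ (f x) (fun i => c i x)) = fun x => ∑ s : Fin k → Fin n,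
      τ (f x) (fun i => e (s i)) * Θ s (fun i => c i x) := funext fun x => hexp _ _
  replace hmain := hmain.congr_of_eventuallyEq (f₁ := fun x => τ (f x) (fun i => c i x))
    (Eventually.of_forall fun x => congrFun hfun x)
  refine ⟨hmain.differentiableAt, fun v => ?_⟩
  have hbase : fderiv ℝ (fun y => τ y (fun i => c i u)) (f u) (f' v) =
      ∑ s : Fin k → Fin n, fderiv ℝ (fun y => τ y (fun i => e (s i))) (f u) (f' v) *
        Θ s (fun i => c i u) := by
    have h1 : (fun y => τ y (fun i => c i u)) = fun y => ∑ s : Fin k → Fin n,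
      τ y (fun i => e (s i)) * Θ s (fun i => c i u) := funext fun y => hexp _ _
    rw [h1, (HasFDerivAt.fun_sum (u := Finset.univ) fun (s : Fin k → Fin n) _ =>
      ((hτ (fun i => e (s i))).hasFDerivAt.mul_const (Θ s (fun i => c i u)))).fderiv]
    simp [mul_comm]
  rw [hmain.fderiv, hbase]
  simp only [hexp (f u) (Function.update _ _ _)]
  rw [Finset.sum_comm, ← Finset.sum_add_distrib]
  simp only [_root_.sum_apply, _root_.add_apply,
    _root_.smul_apply, ContinuousLinearMap.comp_apply, smul_eq_mul,
    ContinuousMultilinearMap.linearDeriv_apply, ContinuousLinearMap.coe_pi', Finset.mul_sum]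
  refine Finset.sum_congr rfl fun s _ => ?_
  ring

variable {n : ℕ} {N : Type*} [TopologicalSpace N] [ChartedSpace (EuclideanSpace ℝ (Fin n)) N]

/-- The expression in a chart of a field of multilinear forms. -/
def chartMultilinear {k : ℕ}
    (T : ∀ x : N, MultilinearMap ℝ (fun _ : Fin k => TangentSpace (𝓡 n) x) ℝ) (p : N)
    (u : EuclideanSpace ℝ (Fin n)) :
    MultilinearMap ℝ (fun _ : Fin k => EuclideanSpace ℝ (Fin n)) ℝ :=
  (T ((extChartAt (𝓡 n) p).symm u)).compLinearMap fun _ =>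
    (mfderiv 𝓘(ℝ, EuclideanSpace ℝ (Fin n)) (𝓡 n) (extChartAt (𝓡 n) p).symm u).toLinearMap

/-- The product rule for a tensor field evaluated on vector fields along a map, in terms of the
covariant derivatives. -/
theorem fderiv_chartTensor_along [IsManifold (𝓡 n) ∞ N] {k : ℕ}
    (G : ∀ x : N, TangentSpace (𝓡 n) x → TangentSpace (𝓡 n) x → ℝ)
    {T : ∀ x : N, MultilinearMap ℝ (fun _ : Fin k => TangentSpace (𝓡 n) x) ℝ} {p : N}
    (hT : ∀ w, DifferentiableAt ℝ (fun u => chartTensor (fun x v => T x v) p u w)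
      (extChartAt (𝓡 n) p p))
    {F : Type*} [NormedAddCommGroup F] [NormedSpace ℝ F] {f : F → EuclideanSpace ℝ (Fin n)}
    {f' : F →L[ℝ] EuclideanSpace ℝ (Fin n)} {u : F} (hf : HasFDerivAt f f' u)
    (hfu : f u = extChartAt (𝓡 n) p p)
    {c : Fin k → F → EuclideanSpace ℝ (Fin n)} {c' : Fin k → F →L[ℝ] EuclideanSpace ℝ (Fin n)}
    (hc : ∀ i, HasFDerivAt (c i) (c' i) u) :
    DifferentiableAt ℝ (fun x => chartTensor (fun x v => T x v) p (f x) (fun i => c i x)) u ∧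
    ∀ (v : F) (v' : TangentSpace (𝓡 n) p) (w d : Fin k → TangentSpace (𝓡 n) p), f' v = v' →
      (∀ i, c i u = w i) → (∀ i, c' i v = d i) →
      fderiv ℝ (fun x => chartTensor (fun x v => T x v) p (f x) (fun i => c i x)) u v =
      covDeriv G (fun x v => T x v) p v' w +
        ∑ i, T p (Function.update w i (d i + christoffel G p v' (w i))) := by
  have h1 := hasFDerivAt_multilinear_apply (τ := chartMultilinear T p) (hfu ▸ hT) hf hc
  refine ⟨h1.1, fun v v' w d hv' hw hd => (h1.2 v).trans ?_⟩
  have h2 : ∀ w : Fin k → TangentSpace (𝓡 n) p, chartMultilinear T p (f u) w = T p w := by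
    intro w
    rw [hfu]
    exact chartTensor_self (fun x v => T x v) p w
  have h3 : fderiv ℝ (fun y => chartMultilinear T p y (fun i => c i u)) (f u) (f' v) =
      chartDeriv (fun x v => T x v) p v' w := by
    rw [hfu, hv', funext hw]
    rfl
  have h4 : ∀ i, T p (Function.update w i (d i + christoffel G p v' (w i))) =
      chartMultilinear T p (f u) (Function.update (fun j => c j u) i (c' i v)) +
      T p (Function.update w i (christoffel G p v' (w i))) := fun i => by
    rw [MultilinearMap.map_update_add, ← h2 (Function.update w i (d i)), hd, funext hw]
    rfl
  rw [h3, Finset.sum_congr rfl fun i _ => h4 i, Finset.sum_add_distrib]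
  show _ = chartDeriv (fun x v => T x v) p v' w - _ + _
  ring

end Leibniz
end

noncomputable section

/-! ### The Levi-Civita connection. -/

section LeviCivita

open Filter Topology

/-- A bilinear map as a multilinear map. -/
def bilinMultilinear {V : Type*} [AddCommGroup V] [Module ℝ V] (b : V →ₗ[ℝ] V →ₗ[ℝ] ℝ) :
    MultilinearMap ℝ (fun _ : Fin 2 => V) ℝ where
  toFun v := b (v 0) (v 1)
  map_update_add' v i x y := by
    fin_cases i <;> simp [Function.update]
  map_update_smul' v i c x := by
    fin_cases i <;> simp [Function.update]

variable {n : ℕ} {N : Type*} [TopologicalSpace N] [ChartedSpace (EuclideanSpace ℝ (Fin n)) N]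

/-- The coefficients of a field of bilinear forms are differentiable at `p`. -/
def DifferentiableBilinAt (b : ∀ x : N, TangentSpace (𝓡 n) x →ₗ[ℝ] TangentSpace (𝓡 n) x →ₗ[ℝ] ℝ)
    (p : N) : Prop :=
  ∀ w : Fin 2 → EuclideanSpace ℝ (Fin n), DifferentiableAt ℝ
    (fun u => chartTensor (fun x v => bilinMultilinear (b x) v) p u w) (extChartAt (𝓡 n) p p)

variable {b : ∀ x : N, TangentSpace (𝓡 n) x →ₗ[ℝ] TangentSpace (𝓡 n) x →ₗ[ℝ] ℝ} {p : N}

/-- `sharp` represents a form only if it is linear, so linearity of the metric derivatives in every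
argument is needed before the Koszul formula can be used. -/
theorem exists_chartDeriv_trilinear (hd : DifferentiableBilinAt b p) :
    ∃ D : TangentSpace (𝓡 n) p →ₗ[ℝ] TangentSpace (𝓡 n) p →ₗ[ℝ] TangentSpace (𝓡 n) p →ₗ[ℝ] ℝ,
      ∀ v w, chartDeriv (fun x (a : Fin 2 → TangentSpace (𝓡 n) x) => b x (a 0) (a 1)) p v w =
        D v (w 0) (w 1) := by
  let E := EuclideanSpace ℝ (Fin n)
  let F : E → E → E → ℝ := fun w z u => b _ (coordField p u w) (coordField p u z)
  have hF : ∀ w z, DifferentiableAt ℝ (F w z) (extChartAt (𝓡 n) p p) := fun w z => hd ![w, z]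
  have hadd : ∀ u w w' : E, coordField p u (w + w') = coordField p u w + coordField p u w' :=
    fun u w w' => map_add _ _ _
  have hsmul : ∀ (c : ℝ) (u w : E), coordField p u (c • w) = c • coordField p u w :=
    fun c u w => map_smul _ _ _
  have hF1 : ∀ w w' z, F (w + w') z = F w z + F w' z := fun w w' z => funext fun u => by
    show b _ (coordField p u (w + w')) _ = _
    rw [hadd, map_add]
    rfl
  have hF2 : ∀ (c : ℝ) w z, F (c • w) z = c • F w z := fun c w z => funext fun u => by
    show b _ (coordField p u (c • w)) _ = _
    rw [hsmul, map_smul]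
    rfl
  have hF3 : ∀ w z z', F w (z + z') = F w z + F w z' := fun w z z' => funext fun u => by
    show b _ _ (coordField p u (z + z')) = _
    rw [hadd, map_add]
    rfl
  have hF4 : ∀ (c : ℝ) w z, F w (c • z) = c • F w z := fun c w z => funext fun u => by
    show b _ _ (coordField p u (c • z)) = _
    rw [hsmul, map_smul]
    rfl
  let A : E →ₗ[ℝ] E →ₗ[ℝ] (E →L[ℝ] ℝ) :=
    LinearMap.mk₂ ℝ (fun w z => fderiv ℝ (F w z) (extChartAt (𝓡 n) p p))
      (fun w w' z => by rw [hF1, fderiv_add (hF _ _) (hF _ _)])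
      (fun c w z => by rw [hF2, fderiv_const_smul (hF _ _)])
      (fun w z z' => by rw [hF3, fderiv_add (hF _ _) (hF _ _)])
      (fun c w z => by rw [hF4, fderiv_const_smul (hF _ _)])
  let D : E →ₗ[ℝ] E →ₗ[ℝ] E →ₗ[ℝ] ℝ :=
    LinearMap.mk₂ ℝ (fun v w => (ContinuousLinearMap.coeLM ℝ ∘ₗ A w).flip v)
      (fun v v' w => by ext; simp) (fun c v w => by ext; simp) (fun v w w' => by ext; simp)
      (fun c v w => by ext; simp)
  refine ⟨D, fun v w => ?_⟩
  have hw : w = ![w 0, w 1] := by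
    ext i
    fin_cases i <;> rfl
  rw [hw]
  rfl

variable (hp : IsScalarProduct n (b p)) (hd : DifferentiableBilinAt b p)
include hp hd

theorem christoffel_apply (v w z : TangentSpace (𝓡 n) p) :
    b p (christoffel (fun x v w => b x v w) p v w) z = (1 / 2) *
      (chartDeriv (fun x (a : Fin 2 → TangentSpace (𝓡 n) x) => b x (a 0) (a 1)) p v ![w, z]
        + chartDeriv (fun x (a : Fin 2 → TangentSpace (𝓡 n) x) => b x (a 0) (a 1)) p w ![v, z]
        - chartDeriv (fun x (a : Fin 2 → TangentSpace (𝓡 n) x) => b x (a 0) (a 1)) p z ![v, w]) := by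
  obtain ⟨D, hD⟩ := exists_chartDeriv_trilinear hd
  have h := hp.sharp_apply ((1 / 2 : ℝ) • (D v w + D w v - (D.flip v).flip w)) z
  have hsharp : christoffel (fun x v w => b x v w) p v w = sharp n (fun x y => b p x y)
      ((1 / 2 : ℝ) • (D v w + D w v - (D.flip v).flip w)) := by
    refine congrArg (sharp n (fun x y => b p x y)) (funext fun z => ?_)
    simp only [hD]
    rfl
  refine (congrArg (fun y => b p y z) hsharp).trans (h.trans ?_)
  simp only [hD]
  rfl

/-- The Koszul formula determines the Levi-Civita connection. -/
theorem christoffel_eq {c : TangentSpace (𝓡 n) p → TangentSpace (𝓡 n) p → TangentSpace (𝓡 n) p → ℝ}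
    (hc : ∀ v x y, chartDeriv (fun x (a : Fin 2 → TangentSpace (𝓡 n) x) => b x (a 0) (a 1)) p v
      ![x, y] = c v x y + c v y x)
    (hs : ∀ v x y, c v x y = c x v y) (v w z : TangentSpace (𝓡 n) p) :
    b p (christoffel (fun x v w => b x v w) p v w) z = c v w z := by
  rw [christoffel_apply hp hd, hc, hc, hc, hs w v, hs w z, hs v z]
  ring

variable (hb : ∀ x v w, b x v w = b x w v)
include hb

theorem christoffel_comm (v w : TangentSpace (𝓡 n) p) :
    christoffel (fun x v w => b x v w) p v w = christoffel (fun x v w => b x v w) p w v := by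
  refine hp.eq_of_forall fun z => ?_
  rw [christoffel_apply hp hd, christoffel_apply hp hd]
  have h : chartDeriv (fun x (a : Fin 2 → TangentSpace (𝓡 n) x) => b x (a 0) (a 1)) p z ![v, w] =
      chartDeriv (fun x (a : Fin 2 → TangentSpace (𝓡 n) x) => b x (a 0) (a 1)) p z ![w, v] :=
    congrArg (fun F : EuclideanSpace ℝ (Fin n) → ℝ => fderiv ℝ F (extChartAt (𝓡 n) p p) z)
      (funext fun u => hb _ _ _)
  rw [h]
  ring

/-- The metric is parallel. -/
theorem covDeriv_metric (v : TangentSpace (𝓡 n) p) (w : Fin 2 → TangentSpace (𝓡 n) p) :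
    covDeriv (fun x v w => b x v w) (fun x v => bilinMultilinear (b x) v) p v w = 0 := by
  have h : ∀ z x y, chartDeriv (fun x (a : Fin 2 → TangentSpace (𝓡 n) x) => b x (a 0) (a 1)) p z
      ![x, y] = chartDeriv (fun x (a : Fin 2 → TangentSpace (𝓡 n) x) => b x (a 0) (a 1)) p z
      ![y, x] := fun z x y =>
    congrArg (fun F : EuclideanSpace ℝ (Fin n) → ℝ => fderiv ℝ F (extChartAt (𝓡 n) p p) z)
      (funext fun u => hb _ _ _)
  obtain ⟨x, y, rfl⟩ : ∃ x y, w = ![x, y] := ⟨w 0, w 1, by ext i; fin_cases i <;> rfl⟩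
  have e : covDeriv (fun x v w => b x v w) (fun x v => bilinMultilinear (b x) v) p v ![x, y] =
      chartDeriv (fun x (a : Fin 2 → TangentSpace (𝓡 n) x) => b x (a 0) (a 1)) p v ![x, y] -
      (b p (christoffel (fun x v w => b x v w) p v x) y +
        b p x (christoffel (fun x v w => b x v w) p v y)) := by
    rw [covDeriv, Fin.sum_univ_two]
    rfl
  rw [e, hb p x, christoffel_apply hp hd, christoffel_apply hp hd, h v y x, h x v y, h y v x]
  ring

omit hp hd hb in
/-- The exterior derivative of a three-form, in terms of a torsion-free connection. -/
theorem exteriorDeriv_eq_covDeriv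
    {G : ∀ x : N, TangentSpace (𝓡 n) x → TangentSpace (𝓡 n) x → ℝ}
    {T : ∀ x : N, TangentSpace (𝓡 n) x [⋀^Fin 3]→ₗ[ℝ] ℝ} {p : N}
    (hG : ∀ v w : TangentSpace (𝓡 n) p, christoffel G p v w = christoffel G p w v)
    (w : Fin 4 → TangentSpace (𝓡 n) p) :
    exteriorDeriv (fun x v => T x v) p w =
      covDeriv G (fun x v => T x v) p (w 0) ![w 1, w 2, w 3]
      - covDeriv G (fun x v => T x v) p (w 1) ![w 0, w 2, w 3]
      + covDeriv G (fun x v => T x v) p (w 2) ![w 0, w 1, w 3]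
      - covDeriv G (fun x v => T x v) p (w 3) ![w 0, w 1, w 2] := by
  have h0 : (0 : Fin 4).removeNth w = ![w 1, w 2, w 3] := by ext i; fin_cases i <;> rfl
  have h1 : (1 : Fin 4).removeNth w = ![w 0, w 2, w 3] := by ext i; fin_cases i <;> rfl
  have h2 : (2 : Fin 4).removeNth w = ![w 0, w 1, w 3] := by ext i; fin_cases i <;> rfl
  have h3 : (3 : Fin 4).removeNth w = ![w 0, w 1, w 2] := by ext i; fin_cases i <;> rfl
  have hc : ∀ v x y z, covDeriv G (fun x v => T x v) p v ![x, y, z] =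
      chartDeriv (fun x v => T x v) p v ![x, y, z] - (T p ![christoffel G p v x, y, z] +
        T p ![x, christoffel G p v y, z] + T p ![x, y, christoffel G p v z]) := by
    intro v x y z
    rw [covDeriv, Fin.sum_univ_three]
    congr 4 <;> · ext i; fin_cases i <;> rfl
  have s12 : ∀ x y z, T p ![x, y, z] = - T p ![y, x, z] := fun x y z => by
    rw [← (T p).map_swap ![y, x, z] (i := 0) (j := 1) (by decide)]
    congr 1; ext i; fin_cases i <;> rfl
  have s23 : ∀ x y z, T p ![x, y, z] = - T p ![x, z, y] := fun x y z => by
    rw [← (T p).map_swap ![x, z, y] (i := 1) (j := 2) (by decide)]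
    congr 1; ext i; fin_cases i <;> rfl
  rw [exteriorDeriv, Fin.sum_univ_four, h0, h1, h2, h3, hc, hc, hc, hc, hG (w 1) (w 0),
    hG (w 2) (w 0), hG (w 3) (w 0), hG (w 2) (w 1), hG (w 3) (w 1), hG (w 3) (w 2)]
  simp only [Fin.val_zero, Fin.val_one, Fin.val_two, show ((3 : Fin 4) : ℕ) = 3 from rfl]
  -- Of the twelve connection terms, each symbol `Γ(w_i, w_j)` with `i < j` occurs twice; with `T`
  -- alternating, the two occurrences cancel.
  generalize christoffel G p (w 0) (w 1) = a
  generalize christoffel G p (w 0) (w 2) = b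
  generalize christoffel G p (w 0) (w 3) = c
  generalize christoffel G p (w 1) (w 2) = d
  generalize christoffel G p (w 1) (w 3) = e
  generalize christoffel G p (w 2) (w 3) = f
  rw [s12 (w 1) b, s23 (w 1) (w 2) c, s12 (w 1) c, s23 (w 0) (w 2) e]
  ring

end LeviCivita
end

noncomputable section

/-! ### Vector fields along maps. -/

section AlongMaps

open Set Filter Topology

variable {k n : ℕ} {N : Type*} [TopologicalSpace N] [ChartedSpace (EuclideanSpace ℝ (Fin n)) N]
  {M : Type*} [TopologicalSpace M] [ChartedSpace (EuclideanSpace ℝ (Fin k)) M]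

/-- The expression of a map in the preferred charts at `m` and at its image. -/
def mapChart (ι : M → N) (m : M) (u : EuclideanSpace ℝ (Fin k)) : EuclideanSpace ℝ (Fin n) :=
  extChartAt (𝓡 n) (ι m) (ι ((extChartAt (𝓡 k) m).symm u))

/-- The coordinates of a vector field along a map. -/
def fieldChart (ι : M → N) (Z : ∀ q : M, TangentSpace (𝓡 n) (ι q)) (m : M)
    (u : EuclideanSpace ℝ (Fin k)) : EuclideanSpace ℝ (Fin n) :=
  coordVec (ι m) (ι ((extChartAt (𝓡 k) m).symm u)) (Z ((extChartAt (𝓡 k) m).symm u))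

/-- The image under the differential of `ι` of the field with constant coordinates `x` in the
preferred chart at `m`. -/
def coordTangent (ι : M → N) (m : M) (x : EuclideanSpace ℝ (Fin k)) (q : M) :
    TangentSpace (𝓡 n) (ι q) :=
  mfderiv (𝓡 k) (𝓡 n) ι q
    (mfderiv 𝓘(ℝ, EuclideanSpace ℝ (Fin k)) (𝓡 k) (extChartAt (𝓡 k) m).symm
      (extChartAt (𝓡 k) m q) x)

theorem coordTangent_symm (ι : M → N) (m : M) (x : EuclideanSpace ℝ (Fin k))
    {u : EuclideanSpace ℝ (Fin k)} (hu : u ∈ (extChartAt (𝓡 k) m).target) :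
    coordTangent ι m x ((extChartAt (𝓡 k) m).symm u) =
      mfderiv (𝓡 k) (𝓡 n) ι ((extChartAt (𝓡 k) m).symm u) (coordField m u x) := by
  refine congrArg (mfderiv (𝓡 k) (𝓡 n) ι ((extChartAt (𝓡 k) m).symm u)) ?_
  refine congrArg (fun y => (mfderiv 𝓘(ℝ, EuclideanSpace ℝ (Fin k)) (𝓡 k)
    (extChartAt (𝓡 k) m).symm y x : EuclideanSpace ℝ (Fin k))) ?_
  exact (extChartAt (𝓡 k) m).right_inv hu

variable {ι : M → N} {m : M}

theorem contDiffAt_mapChart (hι : ContMDiffAt (𝓡 k) (𝓡 n) ∞ ι m) :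
    ContDiffAt ℝ ∞ (mapChart (k := k) (n := n) ι m) (extChartAt (𝓡 k) m m) := by
  have h := (contMDiffAt_iff.1 hι).2
  rw [ModelWithCorners.range_eq_univ, contDiffWithinAt_univ] at h
  exact h

theorem hasFDerivAt_mapChart (hι : ContMDiffAt (𝓡 k) (𝓡 n) ∞ ι m) :
    HasFDerivAt (mapChart (k := k) (n := n) ι m)
      (mfderiv (𝓡 k) (𝓡 n) ι m : EuclideanSpace ℝ (Fin k) →L[ℝ] EuclideanSpace ℝ (Fin n))
      (extChartAt (𝓡 k) m m) := by
  have h : ∀ A : EuclideanSpace ℝ (Fin k) →L[ℝ] EuclideanSpace ℝ (Fin n),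
      HasFDerivWithinAt (mapChart (k := k) (n := n) ι m) A (range (𝓡 k)) (extChartAt (𝓡 k) m m) →
      HasFDerivAt (mapChart (k := k) (n := n) ι m) A (extChartAt (𝓡 k) m m) := fun A hA => by
    rwa [ModelWithCorners.range_eq_univ, hasFDerivWithinAt_univ] at hA
  exact h _ (hι.mdifferentiableAt (by norm_num)).hasMFDerivAt.2

theorem mapChart_self (ι : M → N) (m : M) :
    mapChart (k := k) (n := n) ι m (extChartAt (𝓡 k) m m) = extChartAt (𝓡 n) (ι m) (ι m) := by
  rw [mapChart, extChartAt_to_inv]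

theorem eventually_mem_charts (hι : ContinuousAt ι m) :
    ∀ᶠ u in 𝓝 (extChartAt (𝓡 k) m m), u ∈ (extChartAt (𝓡 k) m).target ∧
      ι ((extChartAt (𝓡 k) m).symm u) ∈ (extChartAt (𝓡 n) (ι m)).source := by
  refine (((isOpen_extChartAt_target (I := 𝓡 k) m).eventually_mem (mem_extChartAt_target m)).and ?_)
  have h1 : ContinuousAt (fun u => ι ((extChartAt (𝓡 k) m).symm u)) (extChartAt (𝓡 k) m m) := by
    refine ContinuousAt.comp ?_ (continuousAt_extChartAt_symm m)
    rw [extChartAt_to_inv]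
    exact hι
  refine h1.eventually_mem ?_
  rw [extChartAt_to_inv]
  exact extChartAt_source_mem_nhds (ι m)

variable [IsManifold (𝓡 n) ∞ N]

theorem fieldChart_self (Z : ∀ q : M, TangentSpace (𝓡 n) (ι q)) :
    fieldChart (k := k) (n := n) ι Z m (extChartAt (𝓡 k) m m) = Z m := by
  have h : ∀ q, q = m → (coordVec (ι m) (ι q) (Z q) : EuclideanSpace ℝ (Fin n)) = Z m := by
    rintro q rfl
    exact coordVec_self _ _
  exact h _ (extChartAt_to_inv m)

variable [IsManifold (𝓡 k) ∞ M]

/-- The chain rule. It turns derivatives of tangential coordinate fields into second derivatives of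
the chart expression of `ι`, whose symmetry makes the second fundamental form symmetric. -/
theorem fieldChart_coordTangent (hι : ContMDiff (𝓡 k) (𝓡 n) ∞ ι) (x : EuclideanSpace ℝ (Fin k)) :
    ∀ᶠ u in 𝓝 (extChartAt (𝓡 k) m m),
      fieldChart (k := k) (n := n) ι (coordTangent ι m x) m u = fderiv ℝ (mapChart (k := k) (n := n) ι m) u x := by
  have : IsManifold (𝓡 k) 1 M := IsManifold.of_le (n := ∞) (by norm_num)
  have : IsManifold (𝓡 n) 1 N := IsManifold.of_le (n := ∞) (by norm_num)
  filter_upwards [eventually_mem_charts (k := k) (n := n) (hι m).continuousAt] with u ⟨hu, hs⟩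
  have h1 : MDifferentiableAt 𝓘(ℝ, EuclideanSpace ℝ (Fin k)) (𝓡 k) (extChartAt (𝓡 k) m).symm u :=
    ((contMDiffOn_extChartAt_symm (n := ∞) m u hu).contMDiffAt
      ((isOpen_extChartAt_target m).mem_nhds hu)).mdifferentiableAt (by norm_num)
  have h2 : MDifferentiableAt (𝓡 k) (𝓡 n) ι ((extChartAt (𝓡 k) m).symm u) :=
    (hι _).mdifferentiableAt (by norm_num)
  rw [extChartAt_source] at hs
  have h3 := mdifferentiableAt_extChartAt (I := 𝓡 n) hs
  have h4 := mfderiv_comp u (h3.comp _ h2) h1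
  have h5 := mfderiv_comp _ h3 h2
  rw [h5] at h4
  rw [fieldChart, coordTangent_symm ι m x hu, ← mfderiv_eq_fderiv]
  exact (congrArg (fun A => A x) h4).symm

theorem fderiv_fieldChart_coordTangent (hι : ContMDiff (𝓡 k) (𝓡 n) ∞ ι)
    (x v : EuclideanSpace ℝ (Fin k)) :
    DifferentiableAt ℝ (fieldChart (k := k) (n := n) ι (coordTangent ι m x) m) (extChartAt (𝓡 k) m m) ∧
    fderiv ℝ (fieldChart (k := k) (n := n) ι (coordTangent ι m x) m) (extChartAt (𝓡 k) m m) v =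
      fderiv ℝ (fderiv ℝ (mapChart (k := k) (n := n) ι m)) (extChartAt (𝓡 k) m m) v x := by
  have hle : (1 : WithTop ℕ∞) + 1 ≤ ∞ := by
    rw [one_add_one_eq_two]
    exact WithTop.coe_le_coe.2 le_top
  have h1 : DifferentiableAt ℝ (fderiv ℝ (mapChart (k := k) (n := n) ι m)) (extChartAt (𝓡 k) m m) :=
    ((contDiffAt_mapChart (hι m)).fderiv_right (m := 1) hle).differentiableAt (by norm_num)
  have h2 := fieldChart_coordTangent (m := m) hι x
  have h3 := (h1.hasFDerivAt.clm_apply (hasFDerivAt_const x _)).congr_of_eventuallyEq h2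
  refine ⟨h3.differentiableAt, ?_⟩
  rw [h3.fderiv]
  simp

/-- Symmetry of the second derivative of a map. -/
theorem fderiv_fieldChart_coordTangent_comm (hι : ContMDiff (𝓡 k) (𝓡 n) ∞ ι)
    (x v : EuclideanSpace ℝ (Fin k)) :
    fderiv ℝ (fieldChart (k := k) (n := n) ι (coordTangent ι m x) m) (extChartAt (𝓡 k) m m) v =
      fderiv ℝ (fieldChart (k := k) (n := n) ι (coordTangent ι m v) m) (extChartAt (𝓡 k) m m) x := by
  rw [(fderiv_fieldChart_coordTangent hι x v).2, (fderiv_fieldChart_coordTangent hι v x).2]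
  refine ((contDiffAt_mapChart (hι m)).isSymmSndFDerivAt ?_) v x
  rw [minSmoothness_of_isRCLikeNormedField]
  exact WithTop.coe_le_coe.2 le_top

omit [IsManifold (𝓡 k) ∞ M] in
theorem differentiableAt_fieldChart {Z : ∀ q : M, TangentSpace (𝓡 n) (ι q)}
    (hZ : ContMDiff (𝓡 k) (𝓡 n).tangent ∞ (fun q => (⟨ι q, Z q⟩ : TangentBundle (𝓡 n) N))) :
    DifferentiableAt ℝ (fieldChart (k := k) (n := n) ι Z m) (extChartAt (𝓡 k) m m) := by
  have h1 := (Bundle.contMDiffAt_totalSpace.1 (hZ m)).2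
  have hι : ContMDiffAt (𝓡 k) (𝓡 n) ∞ ι m := (Bundle.contMDiffAt_totalSpace.1 (hZ m)).1
  have h2 := (contMDiffAt_iff.1 h1).2
  rw [ModelWithCorners.range_eq_univ, contDiffWithinAt_univ] at h2
  refine (h2.differentiableAt (by norm_num)).congr_of_eventuallyEq ?_
  filter_upwards [eventually_mem_charts (k := k) (n := n) hι.continuousAt] with u ⟨hu, hs⟩
  rw [extChartAt_source] at hs
  exact (trivializationAt_tangent_snd hs _).symm

omit [IsManifold (𝓡 k) ∞ M] in
/-- The product rule for a tensor field evaluated on vector fields along a map. -/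
theorem fderiv_apply_along {r : ℕ}
    (G : ∀ x : N, TangentSpace (𝓡 n) x → TangentSpace (𝓡 n) x → ℝ)
    {T : ∀ x : N, MultilinearMap ℝ (fun _ : Fin r => TangentSpace (𝓡 n) x) ℝ}
    (hT : ∀ w, DifferentiableAt ℝ (fun u => chartTensor (fun x v => T x v) (ι m) u w)
      (extChartAt (𝓡 n) (ι m) (ι m)))
    (hι : ContMDiffAt (𝓡 k) (𝓡 n) ∞ ι m) {Z : Fin r → ∀ q : M, TangentSpace (𝓡 n) (ι q)}
    (hZ : ∀ i, DifferentiableAt ℝ (fieldChart (k := k) (n := n) ι (Z i) m) (extChartAt (𝓡 k) m m)) :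
    DifferentiableAt ℝ (fun u => T (ι ((extChartAt (𝓡 k) m).symm u))
      (fun i => Z i ((extChartAt (𝓡 k) m).symm u))) (extChartAt (𝓡 k) m m) ∧
    ∀ v : TangentSpace (𝓡 k) m, fderiv ℝ (fun u => T (ι ((extChartAt (𝓡 k) m).symm u))
      (fun i => Z i ((extChartAt (𝓡 k) m).symm u))) (extChartAt (𝓡 k) m m) v =
      covDeriv G (fun x v => T x v) (ι m) (mfderiv (𝓡 k) (𝓡 n) ι m v) (fun i => Z i m) +
        ∑ i, T (ι m) (Function.update (fun i => Z i m) i (covDerivAlong G ι (Z i) m v)) := by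
  have h1 := fderiv_chartTensor_along G hT (hasFDerivAt_mapChart hι) (mapChart_self (k := k) (n := n) ι m)
    (fun i => (hZ i).hasFDerivAt)
  have h2 : (fun u => T (ι ((extChartAt (𝓡 k) m).symm u))
      (fun i => Z i ((extChartAt (𝓡 k) m).symm u))) =ᶠ[𝓝 (extChartAt (𝓡 k) m m)]
      fun u => chartTensor (fun x v => T x v) (ι m) (mapChart (k := k) (n := n) ι m u)
        (fun i => fieldChart (k := k) (n := n) ι (Z i) m u) := by
    filter_upwards [eventually_mem_charts (k := k) (n := n) hι.continuousAt] with u ⟨hu, hs⟩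
    exact eq_chartTensor (fun x v => T x v) hs _
  refine ⟨h1.1.congr_of_eventuallyEq h2, fun v => ?_⟩
  rw [h2.fderiv_eq]
  exact h1.2 v _ (fun i => Z i m) (fun i => fderiv ℝ (fieldChart (k := k) (n := n) ι (Z i) m) (extChartAt (𝓡 k) m m) v)
    rfl (fun i => fieldChart_self (Z i)) (fun i => rfl)

end AlongMaps
end

noncomputable section

/-! ### Metrics and three-forms along maps. -/

section MetricAlongMaps

open Set Filter Topology

/-- A vector function is differentiable if its scalar products with a basis are, for a
non-degenerate bilinear form with differentiable coefficients. -/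
theorem differentiableAt_of_bilin {n : ℕ} {F : Type*} [NormedAddCommGroup F] [NormedSpace ℝ F]
    {β : F → EuclideanSpace ℝ (Fin n) →ₗ[ℝ] EuclideanSpace ℝ (Fin n) →ₗ[ℝ] ℝ}
    {q : F → EuclideanSpace ℝ (Fin n)} {u₀ : F}
    (hβ : ∀ x y, DifferentiableAt ℝ (fun u => β u x y) u₀)
    (hq : ∀ y, DifferentiableAt ℝ (fun u => β u (q u) y) u₀)
    (h0 : ∀ x, (∀ y, β u₀ x y = 0) → x = 0) : DifferentiableAt ℝ q u₀ := by
  let e : Fin n → EuclideanSpace ℝ (Fin n) := fun j => EuclideanSpace.basisFun (Fin n) ℝ j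
  have he : ∀ x : EuclideanSpace ℝ (Fin n), x = ∑ j, x j • e j := fun x =>
    ((EuclideanSpace.basisFun (Fin n) ℝ).sum_repr x).symm
  -- The operator of `β u` in the standard basis. It is invertible at `u₀`, hence near `u₀`, and `q
  -- = A⁻¹ (A q)` there with both factors differentiable.
  let A : F → EuclideanSpace ℝ (Fin n) →L[ℝ] EuclideanSpace ℝ (Fin n) := fun u =>
    ∑ i, ∑ j, β u (e i) (e j) • (EuclideanSpace.proj i : EuclideanSpace ℝ (Fin n) →L[ℝ] ℝ).smulRight (e j)
  have hA : DifferentiableAt ℝ A u₀ := by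
    refine DifferentiableAt.fun_sum fun i _ => DifferentiableAt.fun_sum fun j _ => ?_
    exact (hβ _ _).smul_const _
  have hAx : ∀ u x, A u x = ∑ j, β u x (e j) • e j := by
    intro u x
    conv_rhs => rw [he x]
    simp only [A, _root_.sum_apply, _root_.smul_apply, ContinuousLinearMap.smulRight_apply,
      map_sum, map_smul, LinearMap.sum_apply, LinearMap.smul_apply, Finset.sum_smul, smul_eq_mul]
    rw [Finset.sum_comm]
    refine Finset.sum_congr rfl fun j _ => Finset.sum_congr rfl fun i _ => ?_
    rw [smul_smul, mul_comm]
    rfl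
  have hcoord : ∀ (c : Fin n → ℝ) (j : Fin n), (∑ i, c i • e i) j = c j := by
    intro c j
    simp [e, Pi.single_apply]
  have hinj : Function.Injective (A u₀) := by
    refine (injective_iff_map_eq_zero _).2 fun x hx => h0 x fun y => ?_
    have h1 : ∀ j, β u₀ x (e j) = 0 := fun j => by
      rw [← hcoord (fun j => β u₀ x (e j)) j, ← hAx, hx]
      rfl
    rw [he y]
    simp [h1]
  have hunit : IsUnit (A u₀) := by
    rw [ContinuousLinearMap.isUnit_iff_bijective]
    exact ⟨hinj, LinearMap.injective_iff_surjective.1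
      (show Function.Injective (A u₀).toLinearMap from hinj)⟩
  have h1 : DifferentiableAt ℝ (fun u => Ring.inverse (A u)) u₀ :=
    (differentiableAt_inverse hunit).comp u₀ hA
  have h2 : DifferentiableAt ℝ (fun u => A u (q u)) u₀ := by
    simp only [hAx]
    exact DifferentiableAt.fun_sum fun j _ => (hq _).smul_const _
  refine (h1.clm_apply h2).congr_of_eventuallyEq ?_
  have h3 : ∀ᶠ u in 𝓝 u₀, IsUnit (A u) := hA.continuousAt.eventually_mem
    (Units.isOpen.mem_nhds hunit)
  filter_upwards [h3] with u hu
  have h4 := Ring.inverse_mul_cancel _ hu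
  exact (congrArg (fun B => B (q u)) h4).symm

variable {k n : ℕ} {N : Type*} [TopologicalSpace N] [ChartedSpace (EuclideanSpace ℝ (Fin n)) N]
  [IsManifold (𝓡 n) ∞ N]

/-- A Riemannian metric as a field of bilinear forms. -/
def metricBilin (g : Bundle.ContMDiffRiemannianMetric (𝓡 n) ∞ (EuclideanSpace ℝ (Fin n))
    (fun x : N => TangentSpace (𝓡 n) x)) (x : N) :
    TangentSpace (𝓡 n) x →ₗ[ℝ] TangentSpace (𝓡 n) x →ₗ[ℝ] ℝ :=
  LinearMap.mk₂ ℝ (fun v w => g.inner x v w) (by simp) (by simp) (by simp) (by simp)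

variable (g : Bundle.ContMDiffRiemannianMetric (𝓡 n) ∞ (EuclideanSpace ℝ (Fin n))
    (fun x : N => TangentSpace (𝓡 n) x))

theorem isScalarProduct_metricBilin (x : N) : IsScalarProduct n (metricBilin g x) where
  symm v w := g.symm x v w
  pos v hv := g.pos x v hv
  finite := inferInstanceAs (Module.Finite ℝ (EuclideanSpace ℝ (Fin n)))
  finrank := finrank_euclideanSpace_fin (𝕜 := ℝ) (n := n)

theorem differentiableBilinAt_metricBilin (p : N) : DifferentiableBilinAt (metricBilin g) p :=
  fun w => (contDiffAt_chartTensor_metric g (mem_extChartAt_target p) w).differentiableAt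
    (by norm_num)

theorem christoffel_metric_comm (p : N) (v w : TangentSpace (𝓡 n) p) :
    christoffel (metricField g) p v w = christoffel (metricField g) p w v :=
  christoffel_comm (b := metricBilin g) (isScalarProduct_metricBilin g p)
    (differentiableBilinAt_metricBilin g p) (fun x v w => g.symm x v w) v w

variable {M : Type*} [TopologicalSpace M] [ChartedSpace (EuclideanSpace ℝ (Fin k)) M]
  {ι : M → N} {m : M} (hι : ContMDiffAt (𝓡 k) (𝓡 n) ∞ ι m)
include hι

/-- The product rule for the metric. -/
theorem fderiv_metric_along {Y Z : ∀ q : M, TangentSpace (𝓡 n) (ι q)}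
    (hY : DifferentiableAt ℝ (fieldChart (k := k) (n := n) ι Y m) (extChartAt (𝓡 k) m m))
    (hZ : DifferentiableAt ℝ (fieldChart (k := k) (n := n) ι Z m) (extChartAt (𝓡 k) m m)) :
    DifferentiableAt ℝ (fun u => metricBilin g (ι ((extChartAt (𝓡 k) m).symm u))
      (Y ((extChartAt (𝓡 k) m).symm u)) (Z ((extChartAt (𝓡 k) m).symm u)))
      (extChartAt (𝓡 k) m m) ∧
    ∀ v : TangentSpace (𝓡 k) m, fderiv ℝ (fun u => metricBilin g (ι ((extChartAt (𝓡 k) m).symm u))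
      (Y ((extChartAt (𝓡 k) m).symm u)) (Z ((extChartAt (𝓡 k) m).symm u)))
      (extChartAt (𝓡 k) m m) v =
      metricBilin g (ι m) (covDerivAlong (metricField g) ι Y m v) (Z m) +
        metricBilin g (ι m) (Y m) (covDerivAlong (metricField g) ι Z m v) := by
  have h := fderiv_apply_along (metricField g) (T := fun x => bilinMultilinear (metricBilin g x))
    (differentiableBilinAt_metricBilin g (ι m)) hι (Z := ![Y, Z])
    (fun i => by fin_cases i; exacts [hY, hZ])
  refine ⟨h.1, fun v => (h.2 v).trans ?_⟩
  have h0 : covDeriv (metricField g) (fun x v => bilinMultilinear (metricBilin g x) v) (ι m)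
      (mfderiv (𝓡 k) (𝓡 n) ι m v) (fun i => (![Y, Z] : Fin 2 → ∀ q : M, TangentSpace (𝓡 n) (ι q)) i m)
      = 0 := covDeriv_metric (b := metricBilin g) (isScalarProduct_metricBilin g _)
    (differentiableBilinAt_metricBilin g _) (fun x v w => g.symm x v w) _ _
  rw [h0, zero_add, Fin.sum_univ_two]
  rfl

/-- The product rule for a three-form. -/
theorem fderiv_form_along {Φ : ∀ x : N, TangentSpace (𝓡 n) x [⋀^Fin 3]→ₗ[ℝ] ℝ}
    (hΦ : SmoothTensor (fun x v => Φ x v)) {X Y Z : ∀ q : M, TangentSpace (𝓡 n) (ι q)}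
    (hX : DifferentiableAt ℝ (fieldChart (k := k) (n := n) ι X m) (extChartAt (𝓡 k) m m))
    (hY : DifferentiableAt ℝ (fieldChart (k := k) (n := n) ι Y m) (extChartAt (𝓡 k) m m))
    (hZ : DifferentiableAt ℝ (fieldChart (k := k) (n := n) ι Z m) (extChartAt (𝓡 k) m m)) :
    DifferentiableAt ℝ (fun u => triForm (Φ (ι ((extChartAt (𝓡 k) m).symm u)))
      (X ((extChartAt (𝓡 k) m).symm u)) (Y ((extChartAt (𝓡 k) m).symm u))
      (Z ((extChartAt (𝓡 k) m).symm u))) (extChartAt (𝓡 k) m m) ∧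
    ∀ v : TangentSpace (𝓡 k) m, fderiv ℝ (fun u => triForm (Φ (ι ((extChartAt (𝓡 k) m).symm u)))
      (X ((extChartAt (𝓡 k) m).symm u)) (Y ((extChartAt (𝓡 k) m).symm u))
      (Z ((extChartAt (𝓡 k) m).symm u))) (extChartAt (𝓡 k) m m) v =
      covDeriv (metricField g) (fun x v => Φ x v) (ι m) (mfderiv (𝓡 k) (𝓡 n) ι m v)
        ![X m, Y m, Z m] +
      (triForm (Φ (ι m)) (covDerivAlong (metricField g) ι X m v) (Y m) (Z m) +
        triForm (Φ (ι m)) (X m) (covDerivAlong (metricField g) ι Y m v) (Z m) +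
        triForm (Φ (ι m)) (X m) (Y m) (covDerivAlong (metricField g) ι Z m v)) := by
  have h := fderiv_apply_along (metricField g) (T := fun x => (Φ x).toMultilinearMap)
    (fun w => ((hΦ (ι m) w).contDiffAt ((isOpen_extChartAt_target (ι m)).mem_nhds
      (mem_extChartAt_target (ι m)))).differentiableAt (by norm_num)) hι (Z := ![X, Y, Z])
    (fun i => by fin_cases i; exacts [hX, hY, hZ])
  have hv : ∀ q, (fun i => (![X, Y, Z] : Fin 3 → ∀ q : M, TangentSpace (𝓡 n) (ι q)) i q) =
      ![X q, Y q, Z q] := fun q => by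
    ext i
    fin_cases i <;> rfl
  simp only [hv] at h
  refine ⟨h.1, fun v => (h.2 v).trans ?_⟩
  rw [Fin.sum_univ_three]
  have hu0 : ∀ a, Function.update ![X m, Y m, Z m] 0 a = ![a, Y m, Z m] := fun a => by
    ext i; fin_cases i <;> rfl
  have hu1 : ∀ a, Function.update ![X m, Y m, Z m] 1 a = ![X m, a, Z m] := fun a => by
    ext i; fin_cases i <;> rfl
  have hu2 : ∀ a, Function.update ![X m, Y m, Z m] 2 a = ![X m, Y m, a] := fun a => by
    ext i; fin_cases i <;> rfl
  rw [hu0, hu1, hu2]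
  rfl

omit hι in
/-- The vector field along `ι` with constant coordinates in the preferred chart at `ι m`. -/
def coordAlong (ι : M → N) (m : M) (e : EuclideanSpace ℝ (Fin n)) (q : M) :
    TangentSpace (𝓡 n) (ι q) :=
  (coordField (ι m) (extChartAt (𝓡 n) (ι m) (ι q)) e : EuclideanSpace ℝ (Fin n))

omit hι [TopologicalSpace M] in
theorem coordAlong_self (e : EuclideanSpace ℝ (Fin n)) : coordAlong (n := n) ι m e m = e :=
  coordField_self (ι m) e

theorem fieldChart_coordAlong (e : EuclideanSpace ℝ (Fin n)) :
    fieldChart (k := k) (n := n) ι (coordAlong ι m e) m =ᶠ[𝓝 (extChartAt (𝓡 k) m m)] fun _ => e := by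
  filter_upwards [eventually_mem_charts (k := k) (n := n) hι.continuousAt] with u ⟨hu, hs⟩
  have h1 := coordVec_coordField ((extChartAt (𝓡 n) (ι m)).map_source hs) e
  have h2 : ∀ x : N, x = ι ((extChartAt (𝓡 k) m).symm u) → ∀ a : EuclideanSpace ℝ (Fin n),
      coordVec (ι m) x a = coordVec (ι m) (ι ((extChartAt (𝓡 k) m).symm u)) a := by
    rintro x rfl a
    rfl
  exact (h2 _ ((extChartAt (𝓡 n) (ι m)).left_inv hs) _).symm.trans h1

theorem differentiableAt_coordAlong (e : EuclideanSpace ℝ (Fin n)) :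
    DifferentiableAt ℝ (fieldChart (k := k) (n := n) ι (coordAlong ι m e) m)
      (extChartAt (𝓡 k) m m) :=
  (differentiableAt_const e).congr_of_eventuallyEq (fieldChart_coordAlong hι e)

/-- A vector field along a map is differentiable if its scalar products with the coordinate
fields are. -/
theorem differentiableAt_fieldChart_of_metric {Z : ∀ q : M, TangentSpace (𝓡 n) (ι q)}
    (hZ : ∀ e, DifferentiableAt ℝ (fun u => metricBilin g (ι ((extChartAt (𝓡 k) m).symm u))
      (Z ((extChartAt (𝓡 k) m).symm u)) (coordAlong ι m e ((extChartAt (𝓡 k) m).symm u)))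
      (extChartAt (𝓡 k) m m)) :
    DifferentiableAt ℝ (fieldChart (k := k) (n := n) ι Z m) (extChartAt (𝓡 k) m m) := by
  let D : M → EuclideanSpace ℝ (Fin n) →ₗ[ℝ] EuclideanSpace ℝ (Fin n) := fun q =>
    (mfderiv 𝓘(ℝ, EuclideanSpace ℝ (Fin n)) (𝓡 n) (extChartAt (𝓡 n) (ι m)).symm
      (extChartAt (𝓡 n) (ι m) (ι q))).toLinearMap
  let b : M → EuclideanSpace ℝ (Fin n) →ₗ[ℝ] EuclideanSpace ℝ (Fin n) →ₗ[ℝ] ℝ := fun q =>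
    metricBilin g (ι q)
  refine differentiableAt_of_bilin (β := fun u => (b ((extChartAt (𝓡 k) m).symm u)).compl₁₂
    (D ((extChartAt (𝓡 k) m).symm u)) (D ((extChartAt (𝓡 k) m).symm u))) ?_ ?_ ?_
  · exact fun x y => (fderiv_metric_along g hι (differentiableAt_coordAlong hι x)
      (differentiableAt_coordAlong hι y)).1
  · intro y
    refine (hZ y).congr_of_eventuallyEq ?_
    filter_upwards [eventually_mem_charts (k := k) (n := n) hι.continuousAt] with u ⟨hu, hs⟩
    have h1 := coordField_coordVec hs (Z ((extChartAt (𝓡 k) m).symm u))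
    exact congrArg (fun a => b ((extChartAt (𝓡 k) m).symm u) a
      (D ((extChartAt (𝓡 k) m).symm u) y)) h1
  · intro x hx
    have h1 : ∀ y, (coordAlong (n := n) ι m y ((extChartAt (𝓡 k) m).symm (extChartAt (𝓡 k) m m)) :
        EuclideanSpace ℝ (Fin n)) = y := by
      intro y
      rw [extChartAt_to_inv]
      exact coordAlong_self y
    have h2 : metricBilin g (ι ((extChartAt (𝓡 k) m).symm (extChartAt (𝓡 k) m m))) x x = 0 := by
      have h3 := hx x
      have h4 : b ((extChartAt (𝓡 k) m).symm (extChartAt (𝓡 k) m m)) 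
        (coordAlong (n := n) ι m x ((extChartAt (𝓡 k) m).symm (extChartAt (𝓡 k) m m)))
        (coordAlong (n := n) ι m x ((extChartAt (𝓡 k) m).symm (extChartAt (𝓡 k) m m))) = 0 := h3
      rw [h1] at h4
      exact h4
    exact (isScalarProduct_metricBilin g _).eq_zero_of_self h2

end MetricAlongMaps
end

noncomputable section

/-! ### The Gauss and Weingarten formulas. -/

section Hypersurfaces

open Set Filter Topology

theorem coordTangent_self {k n : ℕ} {N : Type*} [TopologicalSpace N]
    [ChartedSpace (EuclideanSpace ℝ (Fin n)) N] {M : Type*} [TopologicalSpace M]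
    [ChartedSpace (EuclideanSpace ℝ (Fin k)) M] [IsManifold (𝓡 k) ∞ M] (ι : M → N) (m : M)
    (x : TangentSpace (𝓡 k) m) :
    coordTangent (n := n) ι m x m = mfderiv (𝓡 k) (𝓡 n) ι m x :=
  congrArg (fun y : TangentSpace (𝓡 k) m => (mfderiv (𝓡 k) (𝓡 n) ι m) y) (coordField_self m x)

variable {N : Type*} [TopologicalSpace N] [ChartedSpace (EuclideanSpace ℝ (Fin 7)) N]
  [IsManifold (𝓡 7) ∞ N] (S : G2Structure N)
  {M : Type*} [TopologicalSpace M] [ChartedSpace (EuclideanSpace ℝ (Fin 6)) M]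

/-- The induced metric, as a field of bilinear forms. -/
def inducedBilin (ι : M → N) (q : M) :
    TangentSpace (𝓡 6) q →ₗ[ℝ] TangentSpace (𝓡 6) q →ₗ[ℝ] ℝ :=
  (metricBilin S.metric (ι q)).compl₁₂ (mfderiv (𝓡 6) (𝓡 7) ι q).toLinearMap
    (mfderiv (𝓡 6) (𝓡 7) ι q).toLinearMap

theorem inducedBilin_apply (ι : M → N) (q : M) (x y : TangentSpace (𝓡 6) q) :
    inducedBilin S ι q x y = metricBilin S.metric (ι q) (mfderiv (𝓡 6) (𝓡 7) ι q x)
      (mfderiv (𝓡 6) (𝓡 7) ι q y) := rfl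

variable {S} {ι : M → N} {ν : ∀ m : M, TangentSpace (𝓡 7) (ι m)} (hM : S.IsHypersurface ι ν)
include hM

theorem isScalarProduct_inducedBilin (m : M) : IsScalarProduct 6 (inducedBilin S ι m) := by
  have h := (isScalarProduct_metricBilin S.metric (ι m)).pullback
    (L := (mfderiv (𝓡 6) (𝓡 7) ι m).toLinearMap) (hM.immersion m)
  have h6 : Module.finrank ℝ (TangentSpace (𝓡 6) m) = 6 :=
    finrank_euclideanSpace_fin (𝕜 := ℝ) (n := 6)
  rw [h6] at h
  exact h

variable [IsManifold (𝓡 6) ∞ M] (m : M)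

theorem differentiableAt_coordTangent (x : EuclideanSpace ℝ (Fin 6)) :
    DifferentiableAt ℝ (fieldChart (k := 6) (n := 7) ι (coordTangent ι m x) m)
      (extChartAt (𝓡 6) m m) :=
  (fderiv_fieldChart_coordTangent hM.smooth x 0).1

omit hM [IsManifold (𝓡 7) ∞ N] [IsManifold (𝓡 6) ∞ M] in
theorem eventually_coordTangent : ∀ᶠ u in 𝓝 (extChartAt (𝓡 6) m m), ∀ x,
    mfderiv (𝓡 6) (𝓡 7) ι ((extChartAt (𝓡 6) m).symm u) (coordField m u x) =
      coordTangent ι m x ((extChartAt (𝓡 6) m).symm u) := by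
  filter_upwards [(isOpen_extChartAt_target (I := 𝓡 6) m).eventually_mem
    (mem_extChartAt_target m)] with u hu x
  exact (coordTangent_symm ι m x hu).symm

/-- The covariant derivatives of tangential coordinate fields commute. -/
theorem covDerivAlong_coordTangent_comm (v x : TangentSpace (𝓡 6) m) :
    covDerivAlong S.G ι (coordTangent ι m x) m v = covDerivAlong S.G ι (coordTangent ι m v) m x := by
  have h1 := fderiv_fieldChart_coordTangent_comm (m := m) hM.smooth x v
  have h2 : christoffel S.G (ι m) (mfderiv (𝓡 6) (𝓡 7) ι m v) (coordTangent ι m x m) =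
      christoffel S.G (ι m) (mfderiv (𝓡 6) (𝓡 7) ι m x) (coordTangent ι m v m) := by
    rw [coordTangent_self, coordTangent_self]
    exact christoffel_metric_comm S.metric _ _ _
  exact congrArg₂ (fun a b : TangentSpace (𝓡 7) (ι m) => a + b) h1 h2

/-- Metric compatibility of the ambient connection along `ι`. Combined with the symmetry in
`covDerivAlong_coordTangent_comm`, these are the hypotheses of `christoffel_eq`. -/
theorem chartDeriv_inducedBilin :
    DifferentiableBilinAt (inducedBilin S ι) m ∧ ∀ v x y : TangentSpace (𝓡 6) m,
    chartDeriv (fun q (a : Fin 2 → TangentSpace (𝓡 6) q) => inducedBilin S ι q (a 0) (a 1)) m v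
      ![x, y] =
    metricBilin S.metric (ι m) (covDerivAlong S.G ι (coordTangent ι m x) m v)
      (mfderiv (𝓡 6) (𝓡 7) ι m y) +
    metricBilin S.metric (ι m) (covDerivAlong S.G ι (coordTangent ι m y) m v)
      (mfderiv (𝓡 6) (𝓡 7) ι m x) := by
  have h := fun x y => fderiv_metric_along S.metric (hM.smooth m)
    (differentiableAt_coordTangent hM m x) (differentiableAt_coordTangent hM m y)
  have he : ∀ w : Fin 2 → EuclideanSpace ℝ (Fin 6),
      (fun u => chartTensor (fun q v => bilinMultilinear (inducedBilin S ι q) v) m u w)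
      =ᶠ[𝓝 (extChartAt (𝓡 6) m m)]
      fun u => metricBilin S.metric (ι ((extChartAt (𝓡 6) m).symm u))
        (coordTangent ι m (w 0) ((extChartAt (𝓡 6) m).symm u))
        (coordTangent ι m (w 1) ((extChartAt (𝓡 6) m).symm u)) := fun w => by
    filter_upwards [eventually_coordTangent (ι := ι) m] with u hu
    rw [← hu, ← hu]
    rfl
  refine ⟨fun w => (h _ _).1.congr_of_eventuallyEq (he w), fun v x y => ?_⟩
  refine (congrArg (fun A : EuclideanSpace ℝ (Fin 6) →L[ℝ] ℝ => A v) (he ![x, y]).fderiv_eq).trans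
    (((h x y).2 v).trans ?_)
  rw [coordTangent_self, coordTangent_self, (isScalarProduct_metricBilin S.metric _).symm
    (mfderiv (𝓡 6) (𝓡 7) ι m x)]

/-- The Levi-Civita connection of the hypersurface is the tangential part of that of the ambient
manifold. -/
theorem inducedBilin_christoffel (v w z : TangentSpace (𝓡 6) m) :
    inducedBilin S ι m (christoffel (S.inducedMetric ι) m v w) z =
      metricBilin S.metric (ι m) (covDerivAlong S.G ι (coordTangent ι m w) m v)
        (mfderiv (𝓡 6) (𝓡 7) ι m z) :=
  christoffel_eq (b := inducedBilin S ι) (isScalarProduct_inducedBilin hM m)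
    (chartDeriv_inducedBilin hM m).1 (chartDeriv_inducedBilin hM m).2
    (fun v x y => by rw [covDerivAlong_coordTangent_comm hM]) v w z

omit [IsManifold (𝓡 6) ∞ M] in
theorem secondForm_eq (x y : TangentSpace (𝓡 6) m) : S.secondForm ι ν m x y =
    metricBilin S.metric (ι m) (covDerivAlong S.G ι (coordTangent ι m y) m x) (ν m) := by
  have h : metricBilin S.metric (ι m) (ν m) (ν m) = 1 := hM.unit m
  have h2 : S.secondForm ι ν m x y = metricBilin S.metric (ι m)
    (metricBilin S.metric (ι m) (covDerivAlong S.G ι (coordTangent ι m y) m x) (ν m) • ν m)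
    (ν m) := rfl
  rw [h2, map_smul, LinearMap.smul_apply, h, smul_eq_mul, mul_one]

omit [IsManifold (𝓡 6) ∞ M] in
theorem shapeTensor_eq (x y : TangentSpace (𝓡 6) m) : S.shapeTensor ι ν m x y =
    S.secondForm ι ν m x y • ν m := by
  rw [secondForm_eq hM]
  rfl

omit [IsManifold (𝓡 6) ∞ M] in
theorem exists_tangent_normal (a : TangentSpace (𝓡 7) (ι m)) :
    ∃ w, a = mfderiv (𝓡 6) (𝓡 7) ι m w + metricBilin S.metric (ι m) (ν m) a • ν m :=
  (isScalarProduct_metricBilin S.metric (ι m)).exists_tangent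
    (L := (mfderiv (𝓡 6) (𝓡 7) ι m).toLinearMap) (hM.immersion m) (hM.unit m) (hM.normal m)
    (congrArg (· + 1) (finrank_euclideanSpace_fin (𝕜 := ℝ) (n := 6))) a

/-- The Gauss formula. -/
theorem covDerivAlong_coordTangent (v w : TangentSpace (𝓡 6) m) :
    covDerivAlong S.G ι (coordTangent ι m w) m v =
      mfderiv (𝓡 6) (𝓡 7) ι m (christoffel (S.inducedMetric ι) m v w) +
        S.secondForm ι ν m v w • ν m := by
  have hs := isScalarProduct_metricBilin S.metric (ι m)
  have hn : ∀ x, metricBilin S.metric (ι m) (ν m) (mfderiv (𝓡 6) (𝓡 7) ι m x) = 0 := hM.normal m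
  obtain ⟨t, ht⟩ := exists_tangent_normal hM m (covDerivAlong S.G ι (coordTangent ι m w) m v)
  have h1 : t = christoffel (S.inducedMetric ι) m v w := by
    refine (isScalarProduct_inducedBilin hM m).eq_of_forall fun z => ?_
    rw [inducedBilin_christoffel hM, ht, inducedBilin_apply, map_add, map_smul,
      LinearMap.add_apply, LinearMap.smul_apply, hn, smul_zero, add_zero]
  rw [← h1, secondForm_eq hM, hs.symm _ (ν m)]
  exact ht

/-- The Weingarten formula, with a symmetric shape operator. -/
theorem exists_shapeOperator :
    ∃ A : TangentSpace (𝓡 6) m →ₗ[ℝ] TangentSpace (𝓡 6) m,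
      (∀ x y, S.secondForm ι ν m x y = inducedBilin S ι m (A x) y) ∧
      (∀ x y, inducedBilin S ι m (A x) y = inducedBilin S ι m x (A y)) ∧
      ∀ v, covDerivAlong S.G ι ν m v = - mfderiv (𝓡 6) (𝓡 7) ι m (A v) := by
  have hs := isScalarProduct_metricBilin S.metric (ι m)
  have hν := differentiableAt_fieldChart (m := m) hM.smooth_normal
  have hW : ∀ v x, metricBilin S.metric (ι m) (covDerivAlong S.G ι ν m v)
      (mfderiv (𝓡 6) (𝓡 7) ι m x) = - S.secondForm ι ν m v x := by
    intro v x
    have h := (fderiv_metric_along S.metric (hM.smooth m) hν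
      (differentiableAt_coordTangent hM m x)).2 v
    have h0 : (fun u => metricBilin S.metric (ι ((extChartAt (𝓡 6) m).symm u))
        (ν ((extChartAt (𝓡 6) m).symm u)) (coordTangent ι m x ((extChartAt (𝓡 6) m).symm u))) =
        fun _ => 0 := funext fun u => hM.normal _ _
    rw [h0, fderiv_const_apply, coordTangent_self] at h
    rw [secondForm_eq hM, hs.symm _ (ν m)]
    exact eq_neg_of_add_eq_zero_left h.symm
  have hN : ∀ v : TangentSpace (𝓡 6) m,
      metricBilin S.metric (ι m) (ν m) (covDerivAlong S.G ι ν m v) = 0 := by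
    intro v
    have h := (fderiv_metric_along S.metric (hM.smooth m) hν hν).2 v
    have h0 : (fun u => metricBilin S.metric (ι ((extChartAt (𝓡 6) m).symm u))
        (ν ((extChartAt (𝓡 6) m).symm u)) (ν ((extChartAt (𝓡 6) m).symm u))) =
        fun _ => 1 := funext fun u => hM.unit _
    rw [h0, fderiv_const_apply, hs.symm _ (ν m)] at h
    have h' : (0 : ℝ) = _ := h
    linarith
  have hsymm : ∀ x y, S.secondForm ι ν m x y = S.secondForm ι ν m y x := fun x y => by
    rw [secondForm_eq hM, secondForm_eq hM, covDerivAlong_coordTangent_comm hM]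
  -- Linearity in the second argument is read off from `hW`, where that argument enters through the
  -- differential of `ι`; linearity in the first follows by symmetry.
  have hadd : ∀ x y z, S.secondForm ι ν m x (y + z) =
      S.secondForm ι ν m x y + S.secondForm ι ν m x z := fun x y z => by
    linarith [hW x (y + z), hW x y, hW x z, congrArg (metricBilin S.metric (ι m)
      (covDerivAlong S.G ι ν m x)) (map_add (mfderiv (𝓡 6) (𝓡 7) ι m) y z),
      map_add (metricBilin S.metric (ι m) (covDerivAlong S.G ι ν m x))
        (mfderiv (𝓡 6) (𝓡 7) ι m y) (mfderiv (𝓡 6) (𝓡 7) ι m z)]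
  have hsmul : ∀ (c : ℝ) x y, S.secondForm ι ν m x (c • y) = c • S.secondForm ι ν m x y :=
    fun c x y => by
    have h1 := hW x (c • y)
    rw [map_smul, map_smul, hW] at h1
    rw [← neg_eq_iff_eq_neg.2 h1, smul_neg, neg_neg]
  obtain ⟨A, hA⟩ := (isScalarProduct_inducedBilin hM m).exists_endomorphism
    (LinearMap.mk₂ ℝ (S.secondForm ι ν m)
      (fun x y z => by rw [hsymm, hadd, hsymm z, hsymm z])
      (fun c x y => by rw [hsymm, hsmul, hsymm y]) hadd hsmul)
  replace hA : ∀ x y, inducedBilin S ι m (A x) y = S.secondForm ι ν m x y := hA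
  refine ⟨A, fun x y => (hA x y).symm, fun x y => ?_, fun v => ?_⟩
  · rw [hA, (isScalarProduct_inducedBilin hM m).symm, hA, hsymm]
  · obtain ⟨t, ht⟩ := exists_tangent_normal hM m (covDerivAlong S.G ι ν m v)
    rw [hN, zero_smul, add_zero] at ht
    have h1 : t = - A v := by
      refine (isScalarProduct_inducedBilin hM m).eq_of_forall fun z => ?_
      rw [map_neg, LinearMap.neg_apply, hA, ← hW, ht]
      rfl
    rw [ht, h1]
    exact map_neg (mfderiv (𝓡 6) (𝓡 7) ι m) (A v)

end Hypersurfaces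
end

noncomputable section

/-! ### The induced almost complex structure and the field `P(ν, X)`. -/

section InducedStructure

open Set Filter Topology

variable {N : Type*} [TopologicalSpace N] [ChartedSpace (EuclideanSpace ℝ (Fin 7)) N]
  [IsManifold (𝓡 7) ∞ N] (S : G2Structure N)
  {M : Type*} [TopologicalSpace M] [ChartedSpace (EuclideanSpace ℝ (Fin 6)) M]

/-- The vector cross product as a bilinear map. -/
def G2Structure.crossBilin (x : N) :
    TangentSpace (𝓡 7) x →ₗ[ℝ] TangentSpace (𝓡 7) x →ₗ[ℝ] TangentSpace (𝓡 7) x :=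
  crossMap (metricBilin S.metric x) (S.form x)

theorem G2Structure.isCrossProduct (x : N) :
    IsCrossProduct (metricBilin S.metric x) (triForm (S.form x)) (S.crossBilin x) :=
  isCrossProduct_crossMap (isScalarProduct_metricBilin S.metric x) (S.exists_cayleyFrame x)

theorem G2Structure.contractVec_star (x : N) (a : TangentSpace (𝓡 7) x)
    (w : Fin 3 → TangentSpace (𝓡 7) x) : contractVec a (S.star x) w =
      crossFourForm (metricBilin S.metric x) (S.crossBilin x) a (w 0) (w 1) (w 2) :=
  contractVec_starPhi (isScalarProduct_metricBilin S.metric x) (S.exists_cayleyFrame x) a w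

/-- The differential of an immersion, as a linear map. -/
def immersionMap (ι : M → N) (q : M) : TangentSpace (𝓡 6) q →ₗ[ℝ] TangentSpace (𝓡 7) (ι q) :=
  (mfderiv (𝓡 6) (𝓡 7) ι q).toLinearMap

/-- The tangent space of a hypersurface, its unit normal, the induced almost complex structure and
the tangential part of the cross product. -/
abbrev IsHypersurfaceAt (ι : M → N) (ν : ∀ m : M, TangentSpace (𝓡 7) (ι m)) (q : M)
    (I : TangentSpace (𝓡 6) q →ₗ[ℝ] TangentSpace (𝓡 6) q)
    (R : TangentSpace (𝓡 6) q →ₗ[ℝ] TangentSpace (𝓡 6) q →ₗ[ℝ] TangentSpace (𝓡 6) q) : Prop :=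
  IsHyperplane (metricBilin S.metric (ι q)) (triForm (S.form (ι q))) (S.crossBilin (ι q))
    (immersionMap ι q) (ν q) I R

variable {S} {ι : M → N} {ν : ∀ m : M, TangentSpace (𝓡 7) (ι m)} (hM : S.IsHypersurface ι ν)
include hM

theorem exists_isHypersurfaceAt (q : M) : ∃ I R, IsHypersurfaceAt S ι ν q I R :=
  (S.isCrossProduct (ι q)).exists_isHyperplane (L := immersionMap ι q) (hM.immersion q)
    (finrank_euclideanSpace_fin (𝕜 := ℝ) (n := 6)) (hM.unit q) (hM.normal q)

omit hM in
-- `Function.invFun` returns a true preimage because `P(ν, ι_* x)` is tangent, and injectivity makes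
-- it unique.
theorem inducedSU3_complex (θ : M → ℝ) {q : M} {I R} (h : IsHypersurfaceAt S ι ν q I R)
    (x : TangentSpace (𝓡 6) q) : (S.inducedSU3 ι ν θ).I q x = I x := by
  refine h.injective (Eq.trans ?_ (h.complex x).symm)
  exact Function.invFun_eq (f := mfderiv (𝓡 6) (𝓡 7) ι q) ⟨I x, h.complex x⟩

/-- The field `P(ν, X)`, for a tangential coordinate field `X`. -/
def normalCross (S : G2Structure N) (ι : M → N) (ν : ∀ m : M, TangentSpace (𝓡 7) (ι m)) (m : M)
    (x : EuclideanSpace ℝ (Fin 6)) (q : M) : TangentSpace (𝓡 7) (ι q) :=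
  S.crossBilin (ι q) (ν q) (coordTangent ι m x q)

variable [IsManifold (𝓡 6) ∞ M] {m : M}

/-- The scalar products of `P(ν, X)` with coordinate fields are values of `φ` on differentiable
fields. -/
theorem differentiableAt_normalCross (x : EuclideanSpace ℝ (Fin 6)) :
    DifferentiableAt ℝ (fieldChart (k := 6) (n := 7) ι (normalCross S ι ν m x) m)
      (extChartAt (𝓡 6) m m) := by
  refine differentiableAt_fieldChart_of_metric S.metric (hM.smooth m) fun e => ?_
  refine (fderiv_form_along S.metric (hM.smooth m) S.smooth_form
    (differentiableAt_fieldChart (k := 6) (n := 7) (m := m) hM.smooth_normal)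
    (differentiableAt_coordTangent hM m x) (differentiableAt_coordAlong (hM.smooth m) e)).1.congr_of_eventuallyEq
      (Eventually.of_forall fun u => (S.isCrossProduct _).cross _ _ _)

/-- `⟨P(ν, X), E⟩ = φ(ν, X, E)` is differentiated in two ways for a coordinate field `E` with value
`a`; the terms with the derivative of `E` cancel. -/
theorem covDerivAlong_normalCross (v x : TangentSpace (𝓡 6) m) (a : TangentSpace (𝓡 7) (ι m)) :
    metricBilin S.metric (ι m) (covDerivAlong S.G ι (normalCross S ι ν m x) m v) a =
      covDeriv S.G S.phi (ι m) (mfderiv (𝓡 6) (𝓡 7) ι m v) ![ν m, mfderiv (𝓡 6) (𝓡 7) ι m x, a] +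
      triForm (S.form (ι m)) (covDerivAlong S.G ι ν m v) (mfderiv (𝓡 6) (𝓡 7) ι m x) a +
      triForm (S.form (ι m)) (ν m) (covDerivAlong S.G ι (coordTangent ι m x) m v) a := by
  have h1 := (fderiv_form_along S.metric (hM.smooth m) S.smooth_form
    (differentiableAt_fieldChart (k := 6) (n := 7) (m := m) hM.smooth_normal)
    (differentiableAt_coordTangent hM m x) (differentiableAt_coordAlong (hM.smooth m) a)).2 v
  have h2 := (fderiv_metric_along S.metric (hM.smooth m) (differentiableAt_normalCross hM x)
    (differentiableAt_coordAlong (hM.smooth m) a)).2 v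
  have h3 : (fun u => metricBilin S.metric (ι ((extChartAt (𝓡 6) m).symm u))
      (normalCross S ι ν m x ((extChartAt (𝓡 6) m).symm u))
      (coordAlong ι m a ((extChartAt (𝓡 6) m).symm u))) =
      fun u => triForm (S.form (ι ((extChartAt (𝓡 6) m).symm u))) (ν ((extChartAt (𝓡 6) m).symm u))
        (coordTangent ι m x ((extChartAt (𝓡 6) m).symm u))
        (coordAlong ι m a ((extChartAt (𝓡 6) m).symm u)) :=
    funext fun u => (S.isCrossProduct _).cross _ _ _
  rw [h3, h1] at h2
  have h4 : coordAlong (n := 7) ι m a m = a := coordAlong_self a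
  have h5 : ∀ c, metricBilin S.metric (ι m) (normalCross S ι ν m x m) c =
    triForm (S.form (ι m)) (ν m) (coordTangent ι m x m) c := (S.isCrossProduct _).cross _ _
  rw [h4, h5, coordTangent_self] at h2
  linear_combination - h2

end InducedStructure
end

noncomputable section

/-! ### Covariant derivatives of the induced tensors. -/

section InducedDerivatives

open Set Filter Topology

section CovDeriv

variable {n r : ℕ} {N : Type*} [TopologicalSpace N] [ChartedSpace (EuclideanSpace ℝ (Fin n)) N]
  {G : ∀ x : N, TangentSpace (𝓡 n) x → TangentSpace (𝓡 n) x → ℝ} {p : N}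
  {F : EuclideanSpace ℝ (Fin n) → ℝ}

theorem covDeriv_eq_fderiv {T : ∀ x : N, CovTensor r (TangentSpace (𝓡 n) x)}
    {w : Fin r → TangentSpace (𝓡 n) p}
    (hF : (fun u => chartTensor T p u w) =ᶠ[𝓝 (extChartAt (𝓡 n) p p)] F)
    (v : TangentSpace (𝓡 n) p) :
    covDeriv G T p v w = fderiv ℝ F (extChartAt (𝓡 n) p p) v -
      ∑ i, T p (Function.update w i (christoffel G p v (w i))) :=
  congrArg (fun B : EuclideanSpace ℝ (Fin n) →L[ℝ] ℝ => B v -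
      ∑ i, T p (Function.update w i (christoffel G p v (w i)))) hF.fderiv_eq

theorem covDeriv_two {T : ∀ x : N, CovTensor 2 (TangentSpace (𝓡 n) x)}
    {w : Fin 2 → TangentSpace (𝓡 n) p}
    (hF : (fun u => chartTensor T p u w) =ᶠ[𝓝 (extChartAt (𝓡 n) p p)] F)
    (v : TangentSpace (𝓡 n) p) :
    covDeriv G T p v w = fderiv ℝ F (extChartAt (𝓡 n) p p) v -
      (T p ![christoffel G p v (w 0), w 1] + T p ![w 0, christoffel G p v (w 1)]) := by
  rw [covDeriv_eq_fderiv hF, Fin.sum_univ_two]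
  congr 3 <;> · ext i; fin_cases i <;> rfl

theorem covDeriv_three {T : ∀ x : N, CovTensor 3 (TangentSpace (𝓡 n) x)}
    {w : Fin 3 → TangentSpace (𝓡 n) p}
    (hF : (fun u => chartTensor T p u w) =ᶠ[𝓝 (extChartAt (𝓡 n) p p)] F)
    (v : TangentSpace (𝓡 n) p) :
    covDeriv G T p v w = fderiv ℝ F (extChartAt (𝓡 n) p p) v -
      (T p ![christoffel G p v (w 0), w 1, w 2] + T p ![w 0, christoffel G p v (w 1), w 2]
        + T p ![w 0, w 1, christoffel G p v (w 2)]) := by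
  rw [covDeriv_eq_fderiv hF, Fin.sum_univ_three]
  congr 4 <;> · ext i; fin_cases i <;> rfl

/-- The product rule for tensors. -/
theorem covDeriv_smul_add {a c : N → ℝ} {T T' : ∀ x : N, CovTensor r (TangentSpace (𝓡 n) x)}
    {w : Fin r → TangentSpace (𝓡 n) p} [IsManifold (𝓡 n) ∞ N]
    (ha : MDifferentiableAt (𝓡 n) 𝓘(ℝ, ℝ) a p) (hc : MDifferentiableAt (𝓡 n) 𝓘(ℝ, ℝ) c p)
    (hT : DifferentiableAt ℝ (fun u => chartTensor T p u w) (extChartAt (𝓡 n) p p))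
    (hT' : DifferentiableAt ℝ (fun u => chartTensor T' p u w) (extChartAt (𝓡 n) p p))
    (v : TangentSpace (𝓡 n) p) :
    covDeriv G (fun x => a x • T x + c x • T' x) p v w =
      a p * covDeriv G T p v w + differential a p v * T p w +
      (c p * covDeriv G T' p v w + differential c p v * T' p w) := by
  have hd : ∀ {a : N → ℝ}, MDifferentiableAt (𝓡 n) 𝓘(ℝ, ℝ) a p → ∃ D : EuclideanSpace ℝ (Fin n) →L[ℝ] ℝ,
      HasFDerivAt (fun u => a ((extChartAt (𝓡 n) p).symm u)) D (extChartAt (𝓡 n) p p) ∧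
      D v = differential a p v := by
    intro a ha
    have h1 : ∀ D : EuclideanSpace ℝ (Fin n) →L[ℝ] ℝ,
        HasFDerivWithinAt (fun u => a ((extChartAt (𝓡 n) p).symm u)) D (Set.range (𝓡 n))
          (extChartAt (𝓡 n) p p) →
        HasFDerivAt (fun u => a ((extChartAt (𝓡 n) p).symm u)) D (extChartAt (𝓡 n) p p) :=
      fun D hD => by
        rwa [ModelWithCorners.range_eq_univ, hasFDerivWithinAt_univ] at hD
    exact ⟨mfderiv (𝓡 n) 𝓘(ℝ, ℝ) a p, h1 _ ha.hasMFDerivAt.2, rfl⟩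
  obtain ⟨D, hD, hDv⟩ := hd ha
  obtain ⟨D', hD', hDv'⟩ := hd hc
  have h1 := (hD.mul hT.hasFDerivAt).add (hD'.mul hT'.hasFDerivAt)
  have h2 : ∀ y : EuclideanSpace ℝ (Fin n),
      fderiv ℝ (fun u => chartTensor (fun x => a x • T x + c x • T' x) p u w)
        (extChartAt (𝓡 n) p p) y =
      a p * fderiv ℝ (fun u => chartTensor T p u w) (extChartAt (𝓡 n) p p) y + D y * T p w +
      (c p * fderiv ℝ (fun u => chartTensor T' p u w) (extChartAt (𝓡 n) p p) y + D' y * T' p w) := by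
    intro y
    have h3 := chartTensor_self T p w
    have h4 := chartTensor_self T' p w
    have h5 := congrArg (fun B : EuclideanSpace ℝ (Fin n) →L[ℝ] ℝ => B y) h1.fderiv
    refine h5.trans ?_
    simp only [_root_.add_apply, _root_.smul_apply, smul_eq_mul, extChartAt_to_inv]
    rw [h3, h4, mul_comm (T p w), mul_comm (T' p w)]
  have h3 : ∀ i, (fun x => a x • T x + c x • T' x) p
      (Function.update w i (christoffel G p v (w i))) =
      a p * T p (Function.update w i (christoffel G p v (w i))) +
        c p * T' p (Function.update w i (christoffel G p v (w i))) := fun i => rfl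
  simp only [covDeriv, chartDeriv]
  rw [Finset.sum_congr rfl fun i _ => h3 i, Finset.sum_add_distrib, ← Finset.mul_sum,
    ← Finset.mul_sum, h2 v, hDv, hDv']
  ring

end CovDeriv

variable {N : Type*} [TopologicalSpace N] [ChartedSpace (EuclideanSpace ℝ (Fin 7)) N]
  [IsManifold (𝓡 7) ∞ N] {S : G2Structure N}
  {M : Type*} [TopologicalSpace M] [ChartedSpace (EuclideanSpace ℝ (Fin 6)) M]
  {ι : M → N} {ν : ∀ m : M, TangentSpace (𝓡 7) (ι m)} (hM : S.IsHypersurface ι ν)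
include hM

/-- Expresses `ω` by `φ` and fields along `ι` at every point, so that it can be differentiated
without differentiating `I`. -/
theorem inducedSU3_omega (θ : M → ℝ) (q : M) (v : Fin 2 → TangentSpace (𝓡 6) q) :
    (S.inducedSU3 ι ν θ).omega q v = triForm (S.form (ι q)) (ν q) (immersionMap ι q (v 1))
      (immersionMap ι q (v 0)) := by
  obtain ⟨I, R, h⟩ := exists_isHypersurfaceAt hM q
  have h1 : (S.inducedSU3 ι ν θ).omega q v = metricBilin S.metric (ι q) (immersionMap ι q (v 0))
    (immersionMap ι q ((S.inducedSU3 ι ν θ).I q (v 1))) := rfl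
  rw [h1, inducedSU3_complex θ h, h.complex, h.cross.cross']

/-- Replaces `*φ` by `φ` with a cross product in its first argument, so that only `∇φ` is needed. -/
theorem pullback_contractVec_star (q : M) (v : Fin 3 → TangentSpace (𝓡 6) q) :
    G2Structure.pullback ι q (contractVec (ν q) (S.star (ι q))) v =
      - triForm (S.form (ι q)) (S.crossBilin (ι q) (ν q) (immersionMap ι q (v 0)))
        (immersionMap ι q (v 1)) (immersionMap ι q (v 2)) := by
  obtain ⟨I, R, h⟩ := exists_isHypersurfaceAt hM q
  have h1 := h.fourForm_normal (v 0) (v 1) (v 2)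
  rw [h.complex] at h1
  exact (S.contractVec_star _ _ _).trans h1

variable [IsManifold (𝓡 6) ∞ M] {m : M} {I : TangentSpace (𝓡 6) m →ₗ[ℝ] TangentSpace (𝓡 6) m}
  {R : TangentSpace (𝓡 6) m →ₗ[ℝ] TangentSpace (𝓡 6) m →ₗ[ℝ] TangentSpace (𝓡 6) m}
  (h : IsHypersurfaceAt S ι ν m I R) {z : TangentSpace (𝓡 6) m}
  (hz : ∀ x w, covDeriv S.G S.phi (ι m) x w = crossFourForm (metricBilin S.metric (ι m))
    (S.crossBilin (ι m)) (S.crossBilin (ι m) (immersionMap ι m z) x) (w 0) (w 1) (w 2))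
  {A : TangentSpace (𝓡 6) m →ₗ[ℝ] TangentSpace (𝓡 6) m}
  (hB : ∀ x y, S.secondForm ι ν m x y = inducedBilin S ι m (A x) y)
  (hA : ∀ v, covDerivAlong S.G ι ν m v = - mfderiv (𝓡 6) (𝓡 7) ι m (A v))
include h hz hB hA

omit hB in
-- In the derivative of `φ(ν, Y, X)` the tangential parts of `∇Y`, `∇X` cancel the induced
-- connection, and their normal parts vanish against `ν`. What remains, `∇φ` and the Weingarten
-- term, is `kahler_derivative`.
theorem covDeriv_inducedSU3_omega (θ : M → ℝ) (v : TangentSpace (𝓡 6) m)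
    (w : Fin 2 → TangentSpace (𝓡 6) m) :
    covDeriv (S.inducedMetric ι) (S.inducedSU3 ι ν θ).omega m v w =
      restrictTri (immersionMap ι m) (triForm (S.form (ι m))) (A v - I (R z v)) (w 0) (w 1) := by
  obtain ⟨x, y, rfl⟩ : ∃ x y, w = ![x, y] := ⟨w 0, w 1, by ext i; fin_cases i <;> rfl⟩
  have hev : (fun u => chartTensor (S.inducedSU3 ι ν θ).omega m u ![x, y])
      =ᶠ[𝓝 (extChartAt (𝓡 6) m m)]
      fun u => triForm (S.form (ι ((extChartAt (𝓡 6) m).symm u))) (ν ((extChartAt (𝓡 6) m).symm u))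
        (coordTangent ι m y ((extChartAt (𝓡 6) m).symm u))
        (coordTangent ι m x ((extChartAt (𝓡 6) m).symm u)) := by
    filter_upwards [eventually_coordTangent (ι := ι) m] with u hu
    exact (inducedSU3_omega hM θ _ _).trans (congrArg₂ (fun a b => triForm (S.form
      (ι ((extChartAt (𝓡 6) m).symm u))) (ν ((extChartAt (𝓡 6) m).symm u)) a b) (hu y) (hu x))
  have h1 := (fderiv_form_along S.metric (hM.smooth m) S.smooth_form
    (differentiableAt_fieldChart (k := 6) (n := 7) (m := m) hM.smooth_normal)
    (differentiableAt_coordTangent hM m y) (differentiableAt_coordTangent hM m x)).2 v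
  have h2 : covDeriv (S.inducedMetric ι) (S.inducedSU3 ι ν θ).omega m v ![x, y] = _ -
      ((S.inducedSU3 ι ν θ).omega m ![christoffel (S.inducedMetric ι) m v x, y] +
        (S.inducedSU3 ι ν θ).omega m ![x, christoffel (S.inducedMetric ι) m v y]) :=
    covDeriv_two (G := S.inducedMetric ι) hev v
  have h3 : ∀ a b : TangentSpace (𝓡 6) m, (S.inducedSU3 ι ν θ).omega m ![a, b] =
    triForm (S.form (ι m)) (ν m) (immersionMap ι m b) (immersionMap ι m a) :=
    fun a b => inducedSU3_omega hM θ _ _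
  have h4 := h.kahler_derivative z v (A v) y x
  have h5 : restrictTri (immersionMap ι m) (triForm (S.form (ι m))) (A v - I (R z v)) x y =
    - restrictTri (immersionMap ι m) (triForm (S.form (ι m))) (A v - I (R z v)) y x :=
    h.isSU3Form.skew23 _ _ _
  have hL : ∀ a, mfderiv (𝓡 6) (𝓡 7) ι m a = immersionMap ι m a := fun _ => rfl
  rw [h3, h3, h1] at h2
  refine h2.trans (Eq.trans ?_ h5.symm)
  rw [← h4, hz, hA, covDerivAlong_coordTangent hM, covDerivAlong_coordTangent hM,
    coordTangent_self, coordTangent_self]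
  simp only [hL, map_neg, map_add, map_smul, LinearMap.neg_apply, LinearMap.add_apply,
    LinearMap.smul_apply, h.cross.self12, h.cross.self13]
  simp only [Matrix.cons_val, smul_zero]
  ring

omit hA in
-- By the Gauss formula the normal parts of the derivatives of the three fields survive, weighted by
-- the second fundamental form; `form_derivative` collects them.
theorem covDeriv_pullback_form (v : TangentSpace (𝓡 6) m) (w : Fin 3 → TangentSpace (𝓡 6) m) :
    DifferentiableAt ℝ (fun u => chartTensor (fun q => G2Structure.pullback ι q (S.phi (ι q))) m u w)
      (extChartAt (𝓡 6) m m) ∧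
    covDeriv (S.inducedMetric ι) (fun q => G2Structure.pullback ι q (S.phi (ι q))) m v w =
      metricBilin S.metric (ι m) (immersionMap ι m z) (immersionMap ι m (I v)) *
        restrictTri (immersionMap ι m) (triForm (S.form (ι m))) (I (w 0)) (w 1) (w 2) -
      wedgeKahler (inducedBilin S ι m) I (A v - I (R z v)) (w 0) (w 1) (w 2) := by
  obtain ⟨x, y, t, rfl⟩ : ∃ x y t, w = ![x, y, t] :=
    ⟨w 0, w 1, w 2, by ext i; fin_cases i <;> rfl⟩
  have h3 : ∀ (q : M) (w : Fin 3 → TangentSpace (𝓡 6) q),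
      G2Structure.pullback ι q (S.phi (ι q)) w = triForm (S.form (ι q))
        (immersionMap ι q (w 0)) (immersionMap ι q (w 1)) (immersionMap ι q (w 2)) :=
    fun q w => congrArg (S.form (ι q)) (by ext i; fin_cases i <;> rfl)
  have hev : (fun u => chartTensor (fun q => G2Structure.pullback ι q (S.phi (ι q))) m u ![x, y, t])
      =ᶠ[𝓝 (extChartAt (𝓡 6) m m)]
      fun u => triForm (S.form (ι ((extChartAt (𝓡 6) m).symm u)))
        (coordTangent ι m x ((extChartAt (𝓡 6) m).symm u))
        (coordTangent ι m y ((extChartAt (𝓡 6) m).symm u))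
        (coordTangent ι m t ((extChartAt (𝓡 6) m).symm u)) := by
    filter_upwards [eventually_coordTangent (ι := ι) m] with u hu
    rw [← hu x, ← hu y, ← hu t]
    exact h3 _ _
  have h1 := fderiv_form_along S.metric (hM.smooth m) S.smooth_form
    (differentiableAt_coordTangent hM m x) (differentiableAt_coordTangent hM m y)
    (differentiableAt_coordTangent hM m t)
  refine ⟨h1.1.congr_of_eventuallyEq hev, ?_⟩
  have h2 : covDeriv (S.inducedMetric ι) (fun q => G2Structure.pullback ι q (S.phi (ι q))) m v
      ![x, y, t] = _ -
      (G2Structure.pullback ι m (S.phi (ι m)) ![christoffel (S.inducedMetric ι) m v x, y, t] +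
        G2Structure.pullback ι m (S.phi (ι m)) ![x, christoffel (S.inducedMetric ι) m v y, t] +
        G2Structure.pullback ι m (S.phi (ι m)) ![x, y, christoffel (S.inducedMetric ι) m v t]) :=
    covDeriv_three (G := S.inducedMetric ι) hev v
  have h4 := h.form_derivative z v (A v) x y t
  have hL : ∀ a, mfderiv (𝓡 6) (𝓡 7) ι m a = immersionMap ι m a := fun _ => rfl
  have hB' : ∀ x y, metricBilin S.metric (ι m) (immersionMap ι m (A x)) (immersionMap ι m y) =
    S.secondForm ι ν m x y := fun x y => (hB x y).symm
  rw [h3, h3, h3, h1.2 v] at h2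
  refine h2.trans (Eq.trans ?_ h4)
  rw [hz, covDerivAlong_coordTangent hM, covDerivAlong_coordTangent hM,
    covDerivAlong_coordTangent hM, coordTangent_self, coordTangent_self, coordTangent_self]
  simp only [hL, hB', map_add, map_smul, LinearMap.add_apply,
    LinearMap.smul_apply, Matrix.cons_val, smul_eq_mul]
  ring

theorem covDeriv_pullback_star (v : TangentSpace (𝓡 6) m) (w : Fin 3 → TangentSpace (𝓡 6) m) :
    DifferentiableAt ℝ (fun u => chartTensor
      (fun q => G2Structure.pullback ι q (contractVec (ν q) (S.star (ι q)))) m u w)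
      (extChartAt (𝓡 6) m m) ∧
    covDeriv (S.inducedMetric ι)
      (fun q => G2Structure.pullback ι q (contractVec (ν q) (S.star (ι q)))) m v w =
      metricBilin S.metric (ι m) (immersionMap ι m z) (immersionMap ι m (I v)) *
        restrictTri (immersionMap ι m) (triForm (S.form (ι m))) (w 0) (w 1) (w 2) -
      wedgeKahler (inducedBilin S ι m) I (I (A v - I (R z v))) (w 0) (w 1) (w 2) := by
  obtain ⟨x, y, t, rfl⟩ : ∃ x y t, w = ![x, y, t] :=
    ⟨w 0, w 1, w 2, by ext i; fin_cases i <;> rfl⟩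
  have h3 : ∀ (q : M) (w : Fin 3 → TangentSpace (𝓡 6) q),
      G2Structure.pullback ι q (contractVec (ν q) (S.star (ι q))) w =
      - triForm (S.form (ι q)) (S.crossBilin (ι q) (ν q) (immersionMap ι q (w 0)))
        (immersionMap ι q (w 1)) (immersionMap ι q (w 2)) := pullback_contractVec_star hM
  have hev : (fun u => chartTensor (fun q => G2Structure.pullback ι q
      (contractVec (ν q) (S.star (ι q)))) m u ![x, y, t]) =ᶠ[𝓝 (extChartAt (𝓡 6) m m)]
      fun u => - triForm (S.form (ι ((extChartAt (𝓡 6) m).symm u)))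
        (normalCross S ι ν m x ((extChartAt (𝓡 6) m).symm u))
        (coordTangent ι m y ((extChartAt (𝓡 6) m).symm u))
        (coordTangent ι m t ((extChartAt (𝓡 6) m).symm u)) := by
    filter_upwards [eventually_coordTangent (ι := ι) m] with u hu
    have hn : ∀ q, normalCross S ι ν m x q =
      S.crossBilin (ι q) (ν q) (coordTangent ι m x q) := fun _ => rfl
    rw [hn, ← hu x, ← hu y, ← hu t]
    exact h3 _ _
  have h1 := fderiv_form_along S.metric (hM.smooth m) S.smooth_form
    (differentiableAt_normalCross hM x) (differentiableAt_coordTangent hM m y)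
    (differentiableAt_coordTangent hM m t)
  refine ⟨h1.1.neg.congr_of_eventuallyEq hev, ?_⟩
  have h2 : covDeriv (S.inducedMetric ι)
      (fun q => G2Structure.pullback ι q (contractVec (ν q) (S.star (ι q)))) m v ![x, y, t] = _ -
      (G2Structure.pullback ι m (contractVec (ν m) (S.star (ι m)))
          ![christoffel (S.inducedMetric ι) m v x, y, t] +
        G2Structure.pullback ι m (contractVec (ν m) (S.star (ι m)))
          ![x, christoffel (S.inducedMetric ι) m v y, t] +
        G2Structure.pullback ι m (contractVec (ν m) (S.star (ι m)))
          ![x, y, christoffel (S.inducedMetric ι) m v t]) :=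
    covDeriv_three (G := S.inducedMetric ι) hev v
  have h4 := h.form_derivative' z v (A v) x y t
  have hL : ∀ a, mfderiv (𝓡 6) (𝓡 7) ι m a = immersionMap ι m a := fun _ => rfl
  have hB' : ∀ x y, metricBilin S.metric (ι m) (immersionMap ι m (A x)) (immersionMap ι m y) =
    S.secondForm ι ν m x y := fun x y => (hB x y).symm
  have hq : normalCross S ι ν m x m = S.crossBilin (ι m) (ν m) (immersionMap ι m x) :=
    congrArg (S.crossBilin (ι m) (ν m)) (coordTangent_self ι m x)
  -- Tested against `P(y, t)`, since `φ(∇(P(ν, X)), y, t) = ⟨∇(P(ν, X)), P(y, t)⟩`.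
  have h5 := covDerivAlong_normalCross hM v x
    (S.crossBilin (ι m) (immersionMap ι m y) (immersionMap ι m t))
  have h6 := fun v => congrArg Neg.neg (h1.2 v)
  have h7 : ∀ a, triForm (S.form (ι m)) (ν m) (immersionMap ι m a)
      (S.crossBilin (ι m) (immersionMap ι m y) (immersionMap ι m t)) =
      triForm (S.form (ι m)) (S.crossBilin (ι m) (ν m) (immersionMap ι m a)) (immersionMap ι m y)
        (immersionMap ι m t) := fun a => by
    rw [← h.cross.cross, h.cross.cross', ← h.cross.rot]
  rw [h.cross.cross', ← h.cross.rot, hz, hA, covDerivAlong_coordTangent hM] at h5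
  have h8 : fderiv ℝ (fun u => - triForm (S.form (ι ((extChartAt (𝓡 6) m).symm u)))
        (normalCross S ι ν m x ((extChartAt (𝓡 6) m).symm u))
        (coordTangent ι m y ((extChartAt (𝓡 6) m).symm u))
        (coordTangent ι m t ((extChartAt (𝓡 6) m).symm u))) (extChartAt (𝓡 6) m m) v = _ :=
    (congrArg (fun B : EuclideanSpace ℝ (Fin 6) →L[ℝ] ℝ => B v) fderiv_fun_neg).trans (h6 v)
  rw [h3, h3, h3, h8] at h2
  refine h2.trans (Eq.trans ?_ h4)
  rw [hz, covDerivAlong_coordTangent hM, covDerivAlong_coordTangent hM,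
    coordTangent_self, coordTangent_self, hq]
  simp only [hL, hB', map_neg, map_add, map_smul, LinearMap.neg_apply, LinearMap.add_apply,
    LinearMap.smul_apply, Matrix.cons_val, smul_eq_mul, h7, h.cross.self12] at h5 ⊢
  linear_combination - h5

end InducedDerivatives
end

noncomputable section

/-! ### The criterion for hypersurfaces. -/

section HypersurfaceTypes

open Set Filter Topology

variable {N : Type*} [TopologicalSpace N] [ChartedSpace (EuclideanSpace ℝ (Fin 7)) N]
  [IsManifold (𝓡 7) ∞ N] {S : G2Structure N}

/-- In a `G₂`-manifold of type `𝒳₄`, the covariant derivative of `φ` is given by `p_φ`. -/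
theorem G2Structure.IsTypeX4.exists_vec (hX4 : S.IsTypeX4) (p : N) : ∃ z : TangentSpace (𝓡 7) p,
    (∀ x w, covDeriv S.G S.phi p x w = crossFourForm (metricBilin S.metric p) (S.crossBilin p)
      (S.crossBilin p z x) (w 0) (w 1) (w 2)) ∧
    (∀ v, S.pCoderiv p v = - 12 * metricBilin S.metric p z v) ∧ S.pVec p = (- 12 : ℝ) • z := by
  have hs := isScalarProduct_metricBilin S.metric p
  obtain ⟨z, hz⟩ := exists_vec_of_inX4 (Φ := S.form p) hs (S.exists_cayleyFrame p) (hX4 p)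
  have hz' : ∀ x w, covDeriv S.G S.phi p x w = crossFourForm (metricBilin S.metric p)
      (S.crossBilin p) (S.crossBilin p z x) (w 0) (w 1) (w 2) := hz
  have hp : ∀ v, S.pCoderiv p v = - 12 * metricBilin S.metric p z v := by
    refine fun v => g2Star_wedge_g2Star hs (S.exists_cayleyFrame p) (z := z)
      (D := exteriorDeriv S.phi p) (fun w => ?_) v
    -- `dφ` is the alternation of `∇φ`, which `alternate_fourForm` computes as `3 z ∧ φ`.
    rw [exteriorDeriv_eq_covDeriv (G := S.G) (christoffel_metric_comm S.metric p), hz', hz', hz',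
      hz', ← (S.isCrossProduct p).alternate_fourForm]
    rfl
  refine ⟨z, hz', hp, hs.eq_of_forall fun v => ?_⟩
  have h1 := hs.sharp_apply ((- 12 : ℝ) • metricBilin S.metric p z) v
  have h2 : S.pVec p = sharp 7 (fun x y => metricBilin S.metric p x y)
      ⇑((- 12 : ℝ) • metricBilin S.metric p z) :=
    congrArg (sharp 7 (fun x y => metricBilin S.metric p x y)) (funext hp)
  rw [h2, h1, map_smul]

variable {M : Type*} [TopologicalSpace M] [ChartedSpace (EuclideanSpace ℝ (Fin 6)) M]
  [IsManifold (𝓡 6) ∞ M]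
  {ι : M → N} {ν : ∀ m : M, TangentSpace (𝓡 7) (ι m)} (hM : S.IsHypersurface ι ν)
  {θ : M → ℝ} (hθ : ContMDiff (𝓡 6) 𝓘(ℝ, ℝ) ∞ θ) (hX4 : S.IsTypeX4)
  (hp : ∀ m : M, S.pVec (ι m) ∈ Set.range (mfderiv (𝓡 6) (𝓡 7) ι m))
include hM hθ hX4 hp

/-- Supplies `hasTypeAt_iff_of_symmetric` with the shape operator as `S`, the mean curvature as `t`
and the rotated forms; the conclusion lists, module by module, what its absence means. -/
theorem hasType_inducedSU3_iff {C : Set SU3Component} (h4 : SU3Component.w4 ∈ C) :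
    (S.inducedSU3 ι ν θ).HasType C ↔ ∀ m : M,
      (SU3Component.w1p ∉ C → S.meanCurvatureLength ι ν m * Real.cos (θ m) = 0) ∧
      (SU3Component.w1m ∉ C → S.meanCurvatureLength ι ν m * Real.sin (θ m) = 0) ∧
      (SU3Component.w2p ∉ C → ∀ x y, Real.cos (θ m) *
          (2 * S.meanCurvatureLength ι ν m * (S.inducedSU3 ι ν θ).G m x y) =
        Real.cos (θ m) * (S.secondForm ι ν m x y +
          S.secondForm ι ν m ((S.inducedSU3 ι ν θ).I m x) ((S.inducedSU3 ι ν θ).I m y))) ∧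
      (SU3Component.w2m ∉ C → ∀ x y, Real.sin (θ m) *
          (2 * S.meanCurvatureLength ι ν m * (S.inducedSU3 ι ν θ).G m x y) =
        Real.sin (θ m) * (S.secondForm ι ν m x y +
          S.secondForm ι ν m ((S.inducedSU3 ι ν θ).I m x) ((S.inducedSU3 ι ν θ).I m y))) ∧
      (SU3Component.w3 ∉ C → ∀ x y, S.secondForm ι ν m ((S.inducedSU3 ι ν θ).I m x)
        ((S.inducedSU3 ι ν θ).I m y) = S.secondForm ι ν m x y) ∧
      (SU3Component.w5 ∉ C → ∀ x, S.pCoderiv (ι m) (mfderiv (𝓡 6) (𝓡 7) ι m x) =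
        12 * (- differential θ m ((S.inducedSU3 ι ν θ).I m x))) := by
  have hunfold : (S.inducedSU3 ι ν θ).HasType C ↔ ∀ m : M, HasTypeAt
    (fun x y => inducedBilin S ι m x y) ((S.inducedSU3 ι ν θ).I m) ((S.inducedSU3 ι ν θ).psiPlus m)
    ((S.inducedSU3 ι ν θ).psiMinus m)
    (fun v => covDeriv (S.inducedMetric ι) (S.inducedSU3 ι ν θ).omega m v)
    (fun v => covDeriv (S.inducedMetric ι) (S.inducedSU3 ι ν θ).psiPlus m v)
    (fun v => covDeriv (S.inducedMetric ι) (S.inducedSU3 ι ν θ).psiMinus m v) C := Iff.rfl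
  rw [hunfold]
  refine forall_congr' fun m => ?_
  obtain ⟨I, R, h⟩ := exists_isHypersurfaceAt hM m
  obtain ⟨z', hz', hco, hvec⟩ := hX4.exists_vec (ι m)
  -- Tangency of `p_φ = -12 z'` makes `z'` tangent, so that `Q(z, v)` and the formulas of
  -- `IsHyperplane` make sense.
  obtain ⟨z, rfl⟩ : ∃ z, immersionMap ι m z = z' := by
    obtain ⟨a, ha⟩ := hp m
    refine ⟨(- 1 / 12 : ℝ) • a, ?_⟩
    have ha' : immersionMap ι m a = (- 12 : ℝ) • z' := ha.trans hvec
    rw [map_smul, ha', smul_smul]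
    norm_num
  obtain ⟨A, hB, hsymm, hA⟩ := exists_shapeOperator hM m
  have hI : (S.inducedSU3 ι ν θ).I m = fun x => I x := funext (inducedSU3_complex θ h)
  set c := Real.cos (θ m) with hc
  set s := Real.sin (θ m) with hs
  have hcs : c ^ 2 + s ^ 2 = 1 := Real.cos_sq_add_sin_sq _
  have hrot := h.isSU3Form.rotate hcs
  let φ := restrictTri (immersionMap ι m) (triForm (S.form (ι m)))
  let ψ := c • φ + s • φ ∘ₗ I
  let δ : TangentSpace (𝓡 6) m →ₗ[ℝ] ℝ := (mfderiv (𝓡 6) 𝓘(ℝ, ℝ) θ m).toLinearMap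
  have hδ : ∀ v, differential θ m v = δ v := fun v => rfl
  -- The rotation of the phase: one part from `∇φ`, the other, `dθ`, from differentiating `cos θ`
  -- and `sin θ`.
  let b : TangentSpace (𝓡 6) m →ₗ[ℝ] ℝ :=
    metricBilin S.metric (ι m) (immersionMap ι m z) ∘ₗ immersionMap ι m ∘ₗ I + δ
  have hb : ∀ v, b v = metricBilin S.metric (ι m) (immersionMap ι m z) (immersionMap ι m (I v)) +
    δ v := fun v => rfl
  -- For `ψ = c φ + s φ ∘ I` one has `a ⌟ φ = (c a - s I a) ⌟ ψ`. Inserting `a = A v - I Q(z, v)`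
  -- gives the rotated cross product with `I z` as last term, the `𝒲₄` part.
  let T : TangentSpace (𝓡 6) m →ₗ[ℝ] TangentSpace (𝓡 6) m :=
    c • A - s • I ∘ₗ A + (c • R + s • R ∘ₗ I) (I z)
  have hTv : ∀ v, T v = c • A v - s • I (A v) + (c • R (I z) v + s • R (I (I z)) v) := fun v => rfl
  have hT : ∀ v, T v = c • (A v - I (R z v)) - s • I (A v - I (R z v)) := by
    intro v
    have h1 := h.isSU3Form.complex_cross z v
    rw [hTv, map_sub, h.square (R z v), h.square z, h1, map_neg, LinearMap.neg_apply]
    module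
  have hφI : ∀ x y t, φ (I (I x)) y t = - φ x y t := fun x y t => by
    rw [h.square, map_neg, LinearMap.neg_apply, LinearMap.neg_apply]
  have hψ : ∀ x y t, ψ x y t = c * φ x y t + s * φ (I x) y t := fun x y t => rfl
  have hφp : ∀ v, G2Structure.pullback ι m (S.phi (ι m)) v = φ (v 0) (v 1) (v 2) :=
    fun v => congrArg (S.form (ι m)) (by ext i; fin_cases i <;> rfl)
  have hφm : ∀ v, G2Structure.pullback ι m (contractVec (ν m) (S.star (ι m))) v =
      - φ (I (v 0)) (v 1) (v 2) := fun v => by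
    rw [pullback_contractVec_star hM, ← h.complex]
    rfl
  have hplus : (S.inducedSU3 ι ν θ).psiPlus m = fun v => ψ (v 0) (v 1) (v 2) := by
    funext v
    have h1 : (S.inducedSU3 ι ν θ).psiPlus m v = c * G2Structure.pullback ι m (S.phi (ι m)) v -
      s * G2Structure.pullback ι m (contractVec (ν m) (S.star (ι m))) v := rfl
    rw [h1, hφp, hφm, hψ]
    ring
  have hminus : (S.inducedSU3 ι ν θ).psiMinus m = fun v => - ψ (I (v 0)) (v 1) (v 2) := by
    funext v
    have h1 : (S.inducedSU3 ι ν θ).psiMinus m v = s * G2Structure.pullback ι m (S.phi (ι m)) v +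
      c * G2Structure.pullback ι m (contractVec (ν m) (S.star (ι m))) v := rfl
    rw [h1, hφp, hφm, hψ, hφI]
    ring
  have hK : ∀ u x y t, wedgeKahler (inducedBilin S ι m) I (T u) x y t =
      c * wedgeKahler (inducedBilin S ι m) I (A u - I (R z u)) x y t -
        s * wedgeKahler (inducedBilin S ι m) I (I (A u - I (R z u))) x y t := by
    intro u x y t
    rw [hT]
    generalize A u - I (R z u) = a
    simp only [wedgeKahler, map_sub, map_smul, LinearMap.sub_apply, LinearMap.smul_apply,
      smul_eq_mul]
    ring
  have hKI : ∀ u x y t, wedgeKahler (inducedBilin S ι m) I (I (T u)) x y t =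
      c * wedgeKahler (inducedBilin S ι m) I (I (A u - I (R z u))) x y t +
        s * wedgeKahler (inducedBilin S ι m) I (A u - I (R z u)) x y t := by
    intro u x y t
    rw [hT]
    generalize A u - I (R z u) = a
    rw [map_sub, map_smul, map_smul, h.square a]
    simp only [wedgeKahler, map_sub, map_smul, map_neg, LinearMap.sub_apply, LinearMap.smul_apply,
      LinearMap.neg_apply, smul_eq_mul]
    ring
  have hθm : MDifferentiableAt (𝓡 6) 𝓘(ℝ, ℝ) θ m := (hθ m).mdifferentiableAt (by norm_num)
  have hcos : HasMFDerivAt (𝓡 6) 𝓘(ℝ, ℝ) (fun q => Real.cos (θ q)) m _ :=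
    (Real.hasDerivAt_cos (θ m)).hasFDerivAt.hasMFDerivAt.comp m hθm.hasMFDerivAt
  have hsin : HasMFDerivAt (𝓡 6) 𝓘(ℝ, ℝ) (fun q => Real.sin (θ q)) m _ :=
    (Real.hasDerivAt_sin (θ m)).hasFDerivAt.hasMFDerivAt.comp m hθm.hasMFDerivAt
  have hnsin : HasMFDerivAt (𝓡 6) 𝓘(ℝ, ℝ) (fun q => - Real.sin (θ q)) m _ :=
    (Real.hasDerivAt_sin (θ m)).neg.hasFDerivAt.hasMFDerivAt.comp m hθm.hasMFDerivAt
  have dcos : ∀ v, differential (fun q => Real.cos (θ q)) m v = - s * δ v := fun v =>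
    (congrArg (fun B => B v) hcos.mfderiv).trans (mul_comm (δ v) (- s))
  have dsin : ∀ v, differential (fun q => Real.sin (θ q)) m v = c * δ v := fun v =>
    (congrArg (fun B => B v) hsin.mfderiv).trans (mul_comm (δ v) c)
  have dnsin : ∀ v, differential (fun q => - Real.sin (θ q)) m v = - c * δ v := fun v =>
    (congrArg (fun B => B v) hnsin.mfderiv).trans (mul_comm (δ v) (- c))
  have hDp : ∀ u v, covDeriv (S.inducedMetric ι) (S.inducedSU3 ι ν θ).psiPlus m u v =
      b u * ψ (I (v 0)) (v 1) (v 2) - wedgeKahler (inducedBilin S ι m) I (T u) (v 0) (v 1) (v 2) := by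
    intro u v
    have h1 : (S.inducedSU3 ι ν θ).psiPlus = fun q => Real.cos (θ q) • G2Structure.pullback ι q
        (S.phi (ι q)) + (- Real.sin (θ q)) • G2Structure.pullback ι q
        (contractVec (ν q) (S.star (ι q))) := by
      funext q
      exact (sub_eq_add_neg _ _).trans (congrArg _ (neg_smul _ _).symm)
    have h2 := covDeriv_pullback_form hM h hz' hB u v
    have h3 := covDeriv_pullback_star hM h hz' hB hA u v
    rw [h1, covDeriv_smul_add hcos.mdifferentiableAt hnsin.mdifferentiableAt h2.1 h3.1, h2.2, h3.2,
      dcos, dnsin, hφp, hφm, hψ, hφI, hK, hb, ← hc, ← hs]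
    ring
  have hDm : ∀ u v, covDeriv (S.inducedMetric ι) (S.inducedSU3 ι ν θ).psiMinus m u v =
      b u * ψ (v 0) (v 1) (v 2) - wedgeKahler (inducedBilin S ι m) I (I (T u)) (v 0) (v 1) (v 2) := by
    intro u v
    have h1 : (S.inducedSU3 ι ν θ).psiMinus = fun q => Real.sin (θ q) • G2Structure.pullback ι q
        (S.phi (ι q)) + Real.cos (θ q) • G2Structure.pullback ι q
        (contractVec (ν q) (S.star (ι q))) := rfl
    have h2 := covDeriv_pullback_form hM h hz' hB u v
    have h3 := covDeriv_pullback_star hM h hz' hB hA u v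
    rw [h1, covDeriv_smul_add hsin.mdifferentiableAt hcos.mdifferentiableAt h2.1 h3.1, h2.2, h3.2,
      dcos, dsin, hφp, hφm, hψ, hKI, hb, ← hc, ← hs]
    ring
  have hDω : ∀ u v, covDeriv (S.inducedMetric ι) (S.inducedSU3 ι ν θ).omega m u v =
      ψ (T u) (v 0) (v 1) := by
    intro u v
    rw [covDeriv_inducedSU3_omega hM h hz' hA, hψ, hT]
    generalize A u - I (R z u) = a
    simp only [map_sub, map_smul, h.square a, map_neg, LinearMap.sub_apply, LinearMap.smul_apply,
      LinearMap.neg_apply, smul_eq_mul]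
    show φ a (v 0) (v 1) = _
    linear_combination (- φ a (v 0) (v 1)) * hcs
  have htr : 6 * S.meanCurvatureLength ι ν m = LinearMap.trace ℝ _ A := by
    have hsc := isScalarProduct_inducedBilin hM m
    have hν : metricBilin S.metric (ι m) (ν m) (ν m) = 1 := hM.unit m
    have h1 : S.meanCurvatureLength ι ν m = metricBilin S.metric (ι m) ((1 / 6 : ℝ) •
      ∑ i, S.shapeTensor ι ν m (orthoFrame 6 (fun x y => inducedBilin S ι m x y) i)
        (orthoFrame 6 (fun x y => inducedBilin S ι m x y) i)) (ν m) := rfl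
    rw [hsc.trace_eq hsc.isOrthoFrame_orthoFrame, h1]
    simp only [shapeTensor_eq hM, hB, map_smul, map_sum, LinearMap.smul_apply,
      LinearMap.sum_apply, hν, smul_eq_mul, mul_one]
    ring
  have hmain := hrot.hasTypeAt_iff_of_symmetric (t := S.meanCurvatureLength ι ν m)
    hDω hDp hDm hsymm hcs (fun v => rfl) htr h4
  rw [hI, hplus, hminus]
  refine Iff.trans hmain ?_
  have hG : ∀ x y, (S.inducedSU3 ι ν θ).G m x y = inducedBilin S ι m x y := fun x y => rfl
  have hL : ∀ x, mfderiv (𝓡 6) (𝓡 7) ι m x = immersionMap ι m x := fun x => rfl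
  simp only [hB, hG, hL, hco, hδ]
  refine and_congr Iff.rfl (and_congr Iff.rfl (and_congr Iff.rfl (and_congr Iff.rfl
    (and_congr Iff.rfl (imp_congr Iff.rfl ⟨fun hv x => ?_, fun hv u => ?_⟩)))))
  -- The substitution `v = I x` turns `⟨z, I v⟩ + dθ(v) = 0` into `⟨z, x⟩ = dθ(I x)`, which times
  -- `-12` is the condition on `p d*φ`.
  · have h1 := hv (I x)
    rw [hb, h.square, map_neg, map_neg] at h1
    linarith
  · have h1 := hv (I u)
    rw [h.square, map_neg] at h1
    rw [hb]
    linarith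

end HypersurfaceTypes
end

/-! ### The ten characterisations. -/

noncomputable section

theorem corollary4p13
    {N : Type*} [TopologicalSpace N] [ChartedSpace (EuclideanSpace ℝ (Fin 7)) N]
    [IsManifold (𝓡 7) ∞ N] (S : G2Structure N)
    {M : Type*} [TopologicalSpace M] [ChartedSpace (EuclideanSpace ℝ (Fin 6)) M]
    [IsManifold (𝓡 6) ∞ M]
    (ι : M → N) (ν : ∀ m : M, TangentSpace (𝓡 7) (ι m)) (hM : S.IsHypersurface ι ν)
    (θ : M → ℝ) (hθ : ContMDiff (𝓡 6) 𝓘(ℝ, ℝ) ∞ θ)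
    -- the ambient structure is of type `𝒳₄`
    (hX4 : S.IsTypeX4)
    -- `p_φ` is tangent to `M`
    (hp : ∀ m : M, S.pVec (ι m) ∈ Set.range (mfderiv (𝓡 6) (𝓡 7) ι m))
    -- the induced structure, second fundamental form, shape tensor and mean curvature
    (Q : SU3Tensors M) (hQ : Q = S.inducedSU3 ι ν θ)
    (B : ∀ m : M, TangentSpace (𝓡 6) m → TangentSpace (𝓡 6) m → ℝ)
    (hB : B = S.secondForm ι ν)
    (II : ∀ m : M, TangentSpace (𝓡 6) m → TangentSpace (𝓡 6) m → TangentSpace (𝓡 7) (ι m))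
    (hII : II = S.shapeTensor ι ν)
    (H : ∀ m : M, TangentSpace (𝓡 7) (ι m)) (hH : H = S.meanCurvature ι ν)
    (h : M → ℝ) (hh : h = S.meanCurvatureLength ι ν) :
    -- `ι* p d*φ = 12 I dθ`, where `(I dθ)(x) = - dθ(I x)`
    (Q.HasType {.w1p, .w1m, .w2p, .w2m, .w3, .w4} ↔
      ∀ (m : M) (x : TangentSpace (𝓡 6) m),
        S.pCoderiv (ι m) (mfderiv (𝓡 6) (𝓡 7) ι m x) =
          12 * (- differential θ m (Q.I m x))) ∧
    -- `I B = B`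
    (Q.HasType {.w1p, .w1m, .w2p, .w2m, .w4, .w5} ↔
      ∀ (m : M) (x y : TangentSpace (𝓡 6) m), B m (Q.I m x) (Q.I m y) = B m x y) ∧
    -- `2 h sin θ ⟨·, ·⟩ = sin θ (1 + I) B`
    (Q.HasType {.w1p, .w1m, .w2p, .w3, .w4, .w5} ↔
      ∀ (m : M) (x y : TangentSpace (𝓡 6) m), Real.sin (θ m) * (2 * h m * Q.G m x y) =
        Real.sin (θ m) * (B m x y + B m (Q.I m x) (Q.I m y))) ∧
    -- `2 h cos θ ⟨·, ·⟩ = cos θ (1 + I) B`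
    (Q.HasType {.w1p, .w1m, .w2m, .w3, .w4, .w5} ↔
      ∀ (m : M) (x y : TangentSpace (𝓡 6) m), Real.cos (θ m) * (2 * h m * Q.G m x y) =
        Real.cos (θ m) * (B m x y + B m (Q.I m x) (Q.I m y))) ∧
    -- `h sin θ = 0`
    (Q.HasType {.w1p, .w2p, .w2m, .w3, .w4, .w5} ↔ ∀ m : M, h m * Real.sin (θ m) = 0) ∧
    -- `h cos θ = 0`
    (Q.HasType {.w1m, .w2p, .w2m, .w3, .w4, .w5} ↔ ∀ m : M, h m * Real.cos (θ m) = 0) ∧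
    -- `(1 + I) B = 2 h ⟨·, ·⟩`
    (Q.HasType {.w1p, .w1m, .w3, .w4, .w5} ↔
      ∀ (m : M) (x y : TangentSpace (𝓡 6) m),
        B m x y + B m (Q.I m x) (Q.I m y) = 2 * h m * Q.G m x y) ∧
    -- `M` is minimal
    (Q.HasType {.w2p, .w2m, .w3, .w4, .w5} ↔ ∀ m : M, H m = 0) ∧
    -- `M` is totally umbilic
    (Q.HasType {.w1p, .w1m, .w4, .w5} ↔
      ∀ (m : M) (x y : TangentSpace (𝓡 6) m), II m x y = Q.G m x y • H m) ∧
    -- `M` is totally geodesic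
    (Q.HasType {.w4, .w5} ↔
      ∀ (m : M) (x y : TangentSpace (𝓡 6) m), II m x y = 0) := by
  subst hQ hB hII hH hh
  have key := fun {C : Set SU3Component} (h4 : SU3Component.w4 ∈ C) =>
    hasType_inducedSU3_iff hM hθ hX4 hp h4
  have hν : ∀ m, ν m ≠ 0 := fun m h0 => by
    have h1 : metricBilin S.metric (ι m) (ν m) (ν m) = 1 := hM.unit m
    rw [h0, map_zero] at h1
    exact zero_ne_one h1
  have hH : ∀ m, S.meanCurvature ι ν m = S.meanCurvatureLength ι ν m • ν m := fun m => by
    have h1 : metricBilin S.metric (ι m) (ν m) (ν m) = 1 := hM.unit m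
    have h2 : S.meanCurvature ι ν m = ((1 / 6 : ℝ) * ∑ i, S.secondForm ι ν m
        (orthoFrame 6 (S.inducedMetric ι m) i) (orthoFrame 6 (S.inducedMetric ι m) i)) • ν m := by
      rw [mul_smul, Finset.sum_smul, G2Structure.meanCurvature]
      simp only [shapeTensor_eq hM]
    have h3 : S.meanCurvatureLength ι ν m =
      metricBilin S.metric (ι m) (S.meanCurvature ι ν m) (ν m) := rfl
    rw [h3, h2, map_smul, LinearMap.smul_apply, h1, smul_eq_mul, mul_one]
  have hcs : ∀ m, Real.cos (θ m) * Real.cos (θ m) + Real.sin (θ m) * Real.sin (θ m) = 1 :=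
    fun m => by linarith [Real.cos_sq_add_sin_sq (θ m)]
  -- Multiplying by `cos θ` and `sin θ` and adding: two conditions weighted by `cos θ` and by `sin
  -- θ` amount to the unweighted one.
  have hcancel : ∀ (m : M) {a b : ℝ}, Real.cos (θ m) * a = Real.cos (θ m) * b →
      Real.sin (θ m) * a = Real.sin (θ m) * b → a = b := fun m a b h1 h2 => by
    linear_combination Real.cos (θ m) * h1 + Real.sin (θ m) * h2 - (a - b) * hcs m
  refine ⟨?_, ?_, ?_, ?_, ?_, ?_, ?_, ?_, ?_, ?_⟩
  -- When a single module is missing the criterion is literally the asserted condition; only the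
  -- four cases with several missing modules remain.
  all_goals
    rw [key (by simp)]
    simp only [Set.mem_insert_iff, Set.mem_singleton_iff, reduceCtorEq, or_false, or_true,
      not_true_eq_false, not_false_eq_true, false_imp_iff, true_and, and_true, forall_const]
  · exact forall_congr' fun m => ⟨fun hm x y => (hcancel m (hm.1 x y) (hm.2 x y)).symm,
      fun hm => ⟨fun x y => by rw [hm], fun x y => by rw [hm]⟩⟩
  · refine forall_congr' fun m => ?_
    rw [hH, smul_eq_zero_iff_left (hν m)]
    refine ⟨fun hm => hcancel m ?_ ?_, fun hm => ?_⟩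
    · rw [mul_zero, mul_comm, hm.1]
    · rw [mul_zero, mul_comm, hm.2]
    · rw [hm, zero_mul, zero_mul]
      exact ⟨rfl, rfl⟩
  · refine forall_congr' fun m => ?_
    have hU : ∀ x y, S.shapeTensor ι ν m x y = (S.inducedSU3 ι ν θ).G m x y • S.meanCurvature ι ν m ↔
        S.secondForm ι ν m x y = S.meanCurvatureLength ι ν m * (S.inducedSU3 ι ν θ).G m x y :=
      fun x y => by
        rw [shapeTensor_eq hM, hH, smul_smul, smul_left_inj (hν m), mul_comm]
    simp only [hU]
    obtain ⟨I, R, h⟩ := exists_isHypersurfaceAt hM m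
    refine ⟨fun hm x y => ?_, fun hm => ?_⟩
    -- The absence of `𝒲₂` gives `(1 + I) B = 2 h ⟨·, ·⟩`, that of `𝒲₃` gives `I B = B`; together `B
    -- = h ⟨·, ·⟩`.
    · have h1 := hcancel m (hm.1 x y) (hm.2.1 x y)
      rw [hm.2.2] at h1
      linarith
    · have hI : ∀ x y, (S.inducedSU3 ι ν θ).G m ((S.inducedSU3 ι ν θ).I m x)
          ((S.inducedSU3 ι ν θ).I m y) = (S.inducedSU3 ι ν θ).G m x y := fun x y => by
        rw [inducedSU3_complex θ h, inducedSU3_complex θ h]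
        exact h.orthogonal x y
      simp only [hm, hI]
      exact ⟨fun x y => by ring, fun x y => by ring, fun _ _ => trivial⟩
  · refine forall_congr' fun m => ?_
    have hU : ∀ x y, S.shapeTensor ι ν m x y = 0 ↔ S.secondForm ι ν m x y = 0 := fun x y => by
      rw [shapeTensor_eq hM, smul_eq_zero_iff_left (hν m)]
    simp only [hU]
    refine ⟨fun hm x y => ?_, fun hm => ?_⟩
    -- The absence of `𝒲₁` removes `h` as well, leaving `B = 0`.
    · have h0 : S.meanCurvatureLength ι ν m = 0 := by
        refine hcancel m ?_ ?_
        · rw [mul_zero, mul_comm, hm.1]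
        · rw [mul_zero, mul_comm, hm.2.1]
      have h1 := hcancel m (hm.2.2.1 x y) (hm.2.2.2.1 x y)
      rw [hm.2.2.2.2, h0] at h1
      linarith
    · have h0 : S.meanCurvatureLength ι ν m = 0 := by
        have h1 : S.meanCurvature ι ν m = 0 := by
          rw [G2Structure.meanCurvature, Finset.sum_eq_zero fun i _ => (hU _ _).2 (hm _ _), smul_zero]
        rw [hH] at h1
        exact (smul_eq_zero_iff_left (hν m)).1 h1
      simp only [hm, h0]
      simp

end
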